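/- Let $(A,[\cdot,\cdot],\rho)$ be a Lie algebroid over a smooth manifold $M$, with differential $d$ on $\Gamma(\bigwedge^\bullet A^*)$. Let $\pi\in\Gamma(\bigwedge^2A)$, $N\in\Gamma(A\otimes A^*)$, $\sigma\in\Gamma(\bigwedge^2A^*)$, $H\in\Gamma(\bigwedge^3A^*)$; write $\pi^\sharp\alpha=\pi(\alpha,\cdot)$, $\sigma^\flat X=\sigma(X,\cdot)$, and $$[X,Y]_N=[NX,Y]+[X,NY]-N[X,Y],\qquad [\alpha,\beta]_\pi=\mathcal L_{\pi^\sharp\alpha}\beta-\mathcal L_{\pi^\sharp\beta}\alpha-d(\pi(\alpha,\beta)),$$ $$T_N(X,Y)=[NX,NY]-N[X,Y]_N,\qquad C_{\pi,N}=([\cdot,\cdot]_N)_\pi-([\cdot,\cdot]_\pi)_{{}^tN},$$ $$\mathcal H(X,Y,Z)=H(NX,NY,Z)+H(NY,NZ,X)+H(NZ,NX,Y),$$ and let $d_N$ be the differential defined by $[\cdot,\cdot]_N$ and the anchor $\rho\circ N$. For $\psi\in\Gamma(\bigwedge^3A^*)$, the quadruple $(\pi,N,\psi,H)$ is a *Poisson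 quasi-Nijenhuis structure with background* if $N\pi^\sharp=\pi^\sharp\,{}^tN$, $d\psi=0$, $dH=0$, $[\pi,\pi]_{SN}=0$, $d_N\psi=d\mathcal H$ and, for all $X,Y\in\Gamma(A)$, $\alpha,\beta\in\Gamma(A^*)$, $$C_{\pi,N}(\alpha,\beta)=2H(\pi^\sharp\alpha,\pi^\sharp\beta,\cdot),\qquad T_N(X,Y)=-\pi^\sharp\big(H(NX,Y,\cdot)-H(NY,X,\cdot)+\psi(X,Y,\cdot)\big).$$ Let $\mu+H$ denote the Courant structure on $A\oplus A^*$ with pairing $\langle X+\alpha,Y+\beta\rangle=\beta(X)+\alpha(Y)$, anchor $X+\alpha\mapsto\rho(X)$ and Dorfman bracket $$[X+\alpha,Y+\beta]=[X,Y]+\mathcal L_X\beta-i_Yd\alpha-H(X,Y,\cdot),$$ let $J=\pi+N+\sigma$ denote the endomorphism $J(X+\alpha)=(NX+\pi^\sharp\alpha)+(\sigma^\flat X-{}^tN\alpha)$, and let $S_J=\{\pi+N+\sigma,\mu+H\}$ be the deformed structure, with anchor the composite of $J$ and the anchor above, and bracket $[x,y]_J=[Jx,y]+[x,Jy]-J[x,y]$.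 **Theorem.** If $(\pi,N,-d\sigma,H)$ is a Poisson quasi-Nijenhuis structure with background on $A$, then: 1. $S_J=\{\pi+N+\sigma,\mu+H\}$ defines a Lie quasi-bialgebroid structure on $(A^*,A)$, that is: the bracket and anchor of $S_J$ restrict to a Lie algebroid structure on $A^*$; and there are a degree one derivation $\delta$ of the Gerstenhaber algebra $(\Gamma(\bigwedge^\bullet A^*),\wedge,[\cdot,\cdot])$ of this Lie algebroid, and a $\varphi\in\Gamma(\bigwedge^3A^*)$, with $\delta^2=[\varphi,\cdot]$ and $\delta\varphi=0$, which are given by $S_J$: if $\rho_J$ is the anchor of $S_J$ and $[X,Y]_J=[X,Y]'+\varphi'(X,Y)$ with $[X,Y]'\in\Gamma(A)$, $\varphi'(X,Y)\in\Gamma(A^*)$ for $X,Y\in\Gamma(A)$, then $\delta f(X)=\rho_J(X)f$, $\delta\alpha(X,Y)=\rho_J(X)\alpha(Y)-\rho_J(Y)\alpha(X)-\alpha([X,Y]')$ and $\varphi(X,Y,Z)=\langle\varphi'(X,Y),Z\rangle$. 2. Equivalently, $S_J$ is a Courant algebroid structure on $A\oplus A^*$ with its canonical pairing. No integrability of $J$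 (vanishing of its Nijenhuis torsion) is assumed. -/

import Mathlib

open scoped Manifold ContDiff

noncomputable section

/-! ## Smooth sections as a module over smooth functions -/

section SmoothSections

variable {E : Type*} [NormedAddCommGroup E] [NormedSpace ℝ E]
  {H : Type*} [TopologicalSpace H] {I : ModelWithCorners ℝ E H}
  {M : Type*} [TopologicalSpace M] [ChartedSpace H M]
  {F : Type*} [NormedAddCommGroup F] [NormedSpace ℝ F]
  {V : M → Type*} [TopologicalSpace (Bundle.TotalSpace F V)]
  [∀ x, AddCommGroup (V x)] [∀ x, Module ℝ (V x)] [∀ x, TopologicalSpace (V x)]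
  [FiberBundle F V] [VectorBundle ℝ F V]

/-- Pointwise multiplication of a smooth section by a smooth function. -/
instance smoothSectionSMul : SMul C^∞⟮I, M; ℝ⟯ Cₛ^∞⟮I; F, V⟯ where
  smul f s := ⟨fun x => f x • s x, f.contMDiff.smul_section s.contMDiff⟩

theorem smoothSection_smul_apply (f : C^∞⟮I, M; ℝ⟯) (s : Cₛ^∞⟮I; F, V⟯) (x : M) :
    (f • s) x = f x • s x := rfl

/-- `Γ(V)` is a module over `C^∞(M)`. -/
instance smoothSectionModule : Module C^∞⟮I, M; ℝ⟯ Cₛ^∞⟮I; F, V⟯ where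
  one_smul s := by
    ext x; exact one_smul ℝ (s x)
  mul_smul f g s := by
    ext x; exact mul_smul (f x) (g x) (s x)
  smul_zero f := by
    ext x; exact smul_zero (f x)
  smul_add f s t := by
    ext x; exact smul_add (f x) (s x) (t x)
  add_smul f g s := by
    ext x; exact add_smul (f x) (g x) (s x)
  zero_smul s := by
    ext x; exact zero_smul ℝ (s x)

end SmoothSections

/-! ## Tensors on a vector bundle

Throughout, `R` plays the role of `C^∞(M)`, `Derivation ℝ R R` that of the vector fields on `M`,
`L` that of the sections `Γ(A)`, `Module.Dual R L` that of `Γ(A*)`, `R`-linear endomorphisms of `L`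
that of `Γ(A ⊗ A*)`, and `R`-multilinear alternating maps `L [⋀^Fin p]→ₗ[R] R` that of
`Γ(⋀^p A*)`. -/

section Tensors

variable {R : Type*} [CommRing R] {L : Type*} [AddCommGroup L] [Module R L]

/-- A bivector `π ∈ Γ(⋀² A)`, given by the skew-symmetric map `π♯ : Γ(A*) → Γ(A)`,
`π♯ α = π(α, ·)`. -/
structure Bivector (R : Type*) [CommRing R]
    (L : Type*) [AddCommGroup L] [Module R L] where
  /-- the map `π♯` -/
  sharp : Module.Dual R L →ₗ[R] L
  alt : ∀ α : Module.Dual R L, α (sharp α) = 0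

/-- `π(α, β) = ⟨β, π♯ α⟩`. -/
def Bivector.eval (π : Bivector R L) (α β : Module.Dual R L) : R := β (π.sharp α)

/-- The `1`-form `H(X, Y, ·)` of a `3`-form `H`, as a bilinear map in `X` and `Y`. -/
def contract₂ (H : L [⋀^Fin 3]→ₗ[R] R) : L →ₗ[R] L →ₗ[R] Module.Dual R L :=
  LinearMap.mk₂ R
    (fun X Y =>
      { toFun := fun Z => H ![X, Y, Z]
        map_add' := fun Z Z' => by
          have e : ∀ W, ![X, Y, W] = Function.update ![X, Y, 0] 2 W := fun W => by
            ext i; fin_cases i <;> rfl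
          rw [e (Z + Z'), e Z, e Z']; exact H.map_update_add _ _ _ _
        map_smul' := fun f Z => by
          have e : ∀ W, ![X, Y, W] = Function.update ![X, Y, 0] 2 W := fun W => by
            ext i; fin_cases i <;> rfl
          rw [e (f • Z), e Z]; exact H.map_update_smul _ _ _ _ })
    (fun X X' Y => by
      ext Z
      have e : ∀ W, ![W, Y, Z] = Function.update ![0, Y, Z] 0 W := fun W => by
        ext i; fin_cases i <;> rfl
      change H _ = H _ + H _
      rw [e, e X, e X']; exact H.map_update_add _ _ _ _)
    (fun f X Y => by
      ext Z
      have e : ∀ W, ![W, Y, Z] = Function.update ![0, Y, Z] 0 W := fun W => by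
        ext i; fin_cases i <;> rfl
      change H _ = f • H _
      rw [e, e X]; exact H.map_update_smul _ _ _ _)
    (fun X Y Y' => by
      ext Z
      have e : ∀ W, ![X, W, Z] = Function.update ![X, 0, Z] 1 W := fun W => by
        ext i; fin_cases i <;> rfl
      change H _ = H _ + H _
      rw [e, e Y, e Y']; exact H.map_update_add _ _ _ _)
    (fun f X Y => by
      ext Z
      have e : ∀ W, ![X, W, Z] = Function.update ![X, 0, Z] 1 W := fun W => by
        ext i; fin_cases i <;> rfl
      change H _ = f • H _
      rw [e, e Y]; exact H.map_update_smul _ _ _ _)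

theorem contract₂_apply (H : L [⋀^Fin 3]→ₗ[R] R) (X Y Z : L) :
    contract₂ H X Y Z = H ![X, Y, Z] := rfl

/-- The map `σ♭ : Γ(A) → Γ(A*)`, `σ♭ X = σ(X, ·)`, of a `2`-form `σ`. -/
def flat (σ : L [⋀^Fin 2]→ₗ[R] R) : L →ₗ[R] Module.Dual R L :=
  have e₀ : ∀ Y W : L, ![W, Y] = Function.update ![0, Y] 0 W := fun Y W => by
    ext i; fin_cases i <;> rfl
  have e₁ : ∀ X W : L, ![X, W] = Function.update ![X, 0] 1 W := fun X W => by
    ext i; fin_cases i <;> rfl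
  LinearMap.mk₂ R (fun X Y => σ ![X, Y])
    (fun X X' Y => by rw [e₀, e₀ Y X, e₀ Y X']; exact σ.map_update_add _ _ _ _)
    (fun f X Y => by rw [e₀, e₀ Y X]; exact σ.map_update_smul _ _ _ _)
    (fun X Y Y' => by rw [e₁, e₁ X Y, e₁ X Y']; exact σ.map_update_add _ _ _ _)
    (fun f X Y => by rw [e₁, e₁ X Y]; exact σ.map_update_smul _ _ _ _)

theorem flat_apply (σ : L [⋀^Fin 2]→ₗ[R] R) (X Y : L) : flat σ X Y = σ ![X, Y] := rfl

/-- The `3`-form `𝓗(X, Y, Z) = H(NX, NY, Z) + H(NY, NZ, X) + H(NZ, NX, Y)`, as a function of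
three sections. -/
def calH (N : Module.End R L) (H : L [⋀^Fin 3]→ₗ[R] R) (v : Fin 3 → L) : R :=
  H ![N (v 0), N (v 1), v 2] + H ![N (v 1), N (v 2), v 0] + H ![N (v 2), N (v 0), v 1]

end Tensors

/-! ## Anchored brackets and Lie algebroids -/

section Algebra

variable {R : Type*} [CommRing R] [Algebra ℝ R]

/-- A biadditive bracket on an `R`-module `P` (the sections of a vector bundle) satisfying the
Leibniz rule with respect to an anchor. -/
@[ext]
structure AnchoredBracket (R : Type*) [CommRing R] [Algebra ℝ R]
    (P : Type*) [AddCommGroup P] [Module R P] where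
  /-- the anchor -/
  anchor : P →ₗ[R] Derivation ℝ R R
  /-- the bracket -/
  bracket : P →+ P →+ P
  leibniz : ∀ (x y : P) (f : R), bracket x (f • y) = f • bracket x y + anchor x f • y

namespace AnchoredBracket

variable {P : Type*} [AddCommGroup P] [Module R P]

/-- Sum of two anchored brackets. -/
instance : Add (AnchoredBracket R P) where
  add S T :=
    { anchor := S.anchor + T.anchor
      bracket := S.bracket + T.bracket
      leibniz := fun x y f => by
        simp only [AddMonoidHom.add_apply, LinearMap.add_apply, Derivation.add_apply, S.leibniz,
          T.leibniz, smul_add, add_smul]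
        abel }

/-- The bracket deformed by an endomorphism `J`:
`[x, y]_J = [J x, y] + [x, J y] - J [x, y]`, with anchor `ρ ∘ J`. -/
def deform (S : AnchoredBracket R P) (J : Module.End R P) : AnchoredBracket R P where
  anchor := S.anchor ∘ₗ J
  bracket := AddMonoidHom.mk' (fun x => AddMonoidHom.mk'
      (fun y => S.bracket (J x) y + S.bracket x (J y) - J (S.bracket x y))
      (fun y z => by simp only [map_add]; abel))
    (fun x y => by
      ext z
      simp only [map_add, AddMonoidHom.add_apply, AddMonoidHom.mk'_apply]
      abel)
  leibniz x y f := by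
    simp only [AddMonoidHom.mk'_apply, map_smul, S.leibniz, map_add, LinearMap.comp_apply,
      smul_add, smul_sub]
    abel

/-- The Nijenhuis torsion `T_N(X, Y) = [NX, NY] - N([NX, Y] + [X, NY] - N[X, Y])`. -/
def torsion (S : AnchoredBracket R P) (N : Module.End R P) (X Y : P) : P :=
  S.bracket (N X) (N Y) - N ((S.deform N).bracket X Y)

/-- The differential of a `p`-form, as a function of `p + 1` sections:
`dw(X₀, …, X_p) = ∑ i, (-1)^i (ρ(X_i) w(…, X̂_i, …) - ∑ j > i, w(…, X̂_i, …, [X_i, X_j], …))`,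
where `[X_i, X_j]` stands in the place of `X_j`. -/
def d (S : AnchoredBracket R P) {p : ℕ} (w : (Fin p → P) → R) (v : Fin (p + 1) → P) : R :=
  ∑ i : Fin (p + 1), (-1) ^ (i : ℕ) *
    (S.anchor (v i) (w fun k => v (i.succAbove k)) -
      ∑ j ∈ Finset.Ioi i,
        w fun k => Function.update v j (S.bracket (v i) (v j)) (i.succAbove k))

/-- The differential `df ∈ Γ(A*)` of a function, `⟨df, X⟩ = ρ(X) f`. -/
def dFun (S : AnchoredBracket R P) (f : R) : Module.Dual R P where
  toFun X := S.anchor X f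
  map_add' X Y := by simp
  map_smul' g X := by simp

/-- The Lie derivative of a `1`-form, `(L_X α)(Y) = ρ(X)(α(Y)) - α([X, Y])`. -/
def lieDer (S : AnchoredBracket R P) (X : P) (α : Module.Dual R P) : Module.Dual R P where
  toFun Y := S.anchor X (α Y) - α (S.bracket X Y)
  map_add' Y Z := by simp only [map_add]; abel
  map_smul' f Y := by
    simp only [map_smul, smul_eq_mul, Derivation.leibniz, S.leibniz, map_add, RingHom.id_apply]
    ring

end AnchoredBracket

/-- A Lie algebroid: a Lie bracket on the sections and an anchor with values in vector fields,
satisfying the Leibniz rule; the anchor is a morphism of Lie algebras. -/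
structure LieAlgebroid (R : Type*) [CommRing R] [Algebra ℝ R]
    (L : Type*) [AddCommGroup L] [Module R L] extends AnchoredBracket R L where
  bracket_self : ∀ X, bracket X X = 0
  jacobi : ∀ X Y Z, bracket X (bracket Y Z) = bracket (bracket X Y) Z + bracket Y (bracket X Z)
  anchor_bracket : ∀ X Y, anchor (bracket X Y) = ⁅anchor X, anchor Y⁆

variable {L : Type*} [AddCommGroup L] [Module R L]

/-! ## Poisson quasi-Nijenhuis structures with background -/

namespace AnchoredBracket

/-- The bracket `[α, β]_π = L_{π♯α} β - L_{π♯β} α - d(π(α, β))` on `Γ(A*)`. -/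
def koszul (S : AnchoredBracket R L) (π : Bivector R L) (α β : Module.Dual R L) :
    Module.Dual R L :=
  S.lieDer (π.sharp α) β - S.lieDer (π.sharp β) α - S.dFun (π.eval α β)

/-- The Schouten-Nijenhuis square `[π, π]_SN ∈ Γ(⋀³ A)` of a bivector, as a function of three
`1`-forms:
`½ [π, π](α, β, γ) = ∑_{cyclic} (⟨α, [π♯β, π♯γ]⟩ - ρ(π♯α)(π(β, γ)))`. -/
def schoutenSq (S : AnchoredBracket R L) (π : Bivector R L) (α β γ : Module.Dual R L) : R :=
  2 * ((α (S.bracket (π.sharp β) (π.sharp γ)) - S.anchor (π.sharp α) (π.eval β γ)) +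
    (β (S.bracket (π.sharp γ) (π.sharp α)) - S.anchor (π.sharp β) (π.eval γ α)) +
    (γ (S.bracket (π.sharp α) (π.sharp β)) - S.anchor (π.sharp γ) (π.eval α β)))

/-- The concomitant `C_{π,N} = ([·,·]_N)_π - ([·,·]_π)_{ᵗN}` on `Γ(A*)`. -/
def concomitant (S : AnchoredBracket R L) (π : Bivector R L) (N : Module.End R L)
    (α β : Module.Dual R L) : Module.Dual R L :=
  (S.deform N).koszul π α β -
    (S.koszul π (N.dualMap α) β + S.koszul π α (N.dualMap β) - N.dualMap (S.koszul π α β))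

end AnchoredBracket

/-- `(π, N, ψ, H)` is a Poisson quasi-Nijenhuis structure with background on the Lie
algebroid `A`. -/
structure IsPoissonQuasiNijenhuis (A : LieAlgebroid R L) (π : Bivector R L) (N : Module.End R L)
    (ψ H : L [⋀^Fin 3]→ₗ[R] R) : Prop where
  comm : N ∘ₗ π.sharp = π.sharp ∘ₗ N.dualMap
  closed_psi : ∀ v, A.d ψ v = 0
  closed_H : ∀ v, A.d H v = 0
  poisson : ∀ α β γ, A.schoutenSq π α β γ = 0
  concomitant : ∀ α β, A.concomitant π N α β = 2 • contract₂ H (π.sharp α) (π.sharp β)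
  torsion : ∀ X Y, A.torsion N X Y =
    -π.sharp (contract₂ H (N X) Y - contract₂ H (N Y) X + contract₂ ψ X Y)
  d_psi : ∀ v, (A.deform N).d ψ v = A.d (calH N H) v

/-! ## Hamiltonians on `A ⊕ A*` and Courant algebroids

A function `S` of total shifted degree `1` on `T*ΠA` is represented by its anchor
`ρ(x) f = {{x, S}, f}` and its derived (Dorfman) bracket `[x, y] = {{x, S}, y}` on
`Γ(A ⊕ A*) = Γ(A) × Γ(A*)`; a function of degree `0` which is constant along `M`, such as
`π + N + σ`, by the skew-symmetric endomorphism `J x = {x, J}`. In these terms the big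
bracket `{J, S}` is the deformed bracket `S.deform J`. -/

/-- The canonical pairing `⟨X + α, Y + β⟩ = β(X) + α(Y)`. -/
def pairing (x y : L × Module.Dual R L) : R := y.2 x.1 + x.2 y.1

/-- `S` is a Courant algebroid structure on `A ⊕ A*` with its canonical pairing. The axioms
`pairing_invariant` and `bracket_symm` say that `S` is a function of total shifted degree `1` on
`T*ΠA`, and `jacobi` that `{S, S} = 0`. -/
structure IsCourant (S : AnchoredBracket R (L × Module.Dual R L)) : Prop where
  pairing_invariant : ∀ x y z,
    S.anchor x (pairing y z) = pairing (S.bracket x y) z + pairing y (S.bracket x z)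
  bracket_symm : ∀ x y z,
    pairing (S.bracket x y + S.bracket y x) z = S.anchor z (pairing x y)
  jacobi : ∀ x y z,
    S.bracket x (S.bracket y z) = S.bracket (S.bracket x y) z + S.bracket y (S.bracket x z)
  anchor_bracket : ∀ x y, S.anchor (S.bracket x y) = ⁅S.anchor x, S.anchor y⁆

namespace LieAlgebroid

theorem bracket_swap (A : LieAlgebroid R L) (X Y : L) : A.bracket Y X = -A.bracket X Y := by
  have h := A.bracket_self (X + Y)
  simp only [map_add, AddMonoidHom.add_apply, A.bracket_self, zero_add, add_zero] at h
  exact eq_neg_of_add_eq_zero_left h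

theorem lieDer_smul_left (A : LieAlgebroid R L) (f : R) (X : L) (α : Module.Dual R L) :
    A.lieDer (f • X) α = f • A.lieDer X α + α X • A.dFun f := by
  ext Z
  have h : A.bracket (f • X) Z = f • A.bracket X Z - A.anchor Z f • X := by
    rw [A.bracket_swap Z, A.leibniz, A.bracket_swap X Z, smul_neg, neg_add, neg_neg, sub_eq_add_neg]
  simp only [AnchoredBracket.lieDer, AnchoredBracket.dFun, LinearMap.coe_mk, AddHom.coe_mk,
    LinearMap.add_apply, LinearMap.smul_apply, h, map_sub, map_smul, smul_eq_mul,
    Derivation.smul_apply]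
  ring

/-- The Hamiltonian `μ` of the Lie algebroid, i.e. the Dorfman bracket
`[X + α, Y + β] = [X, Y] + L_X β - L_Y α + d⟨α, Y⟩` on `A ⊕ A*`
(note `- L_Y α + d⟨α, Y⟩ = - i_Y dα`). -/
def hamiltonian (A : LieAlgebroid R L) : AnchoredBracket R (L × Module.Dual R L) where
  anchor := A.anchor ∘ₗ LinearMap.fst R L (Module.Dual R L)
  bracket := AddMonoidHom.mk' (fun x => AddMonoidHom.mk'
      (fun y => (A.bracket x.1 y.1,
        A.lieDer x.1 y.2 - A.lieDer y.1 x.2 + A.dFun (x.2 y.1)))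
      (fun y z => by
        ext Z
        · simp
        · simp [AnchoredBracket.lieDer, AnchoredBracket.dFun]
          abel))
    (fun x y => by
      ext z Z
      · simp
      · simp [AnchoredBracket.lieDer, AnchoredBracket.dFun]
        abel)
  leibniz x y f := by
    ext Z
    · simp [A.leibniz]
    · simp [lieDer_smul_left]
      simp [AnchoredBracket.lieDer, AnchoredBracket.dFun]
      ring

end LieAlgebroid

/-- The Hamiltonian of a `3`-form `H`: zero anchor and bracket
`{{X + α, H}, Y + β} = -H(X, Y, ·)`, where `{X, ·} = i_X` on forms. -/
def backgroundHamiltonian (H : L [⋀^Fin 3]→ₗ[R] R) :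
    AnchoredBracket R (L × Module.Dual R L) where
  anchor := 0
  bracket := AddMonoidHom.mk' (fun x => AddMonoidHom.mk' (fun y => (0, -contract₂ H x.1 y.1))
      (fun y z => by
        ext Z
        · simp
        · simp only [Prod.fst_add, map_add, Prod.snd_add, LinearMap.add_apply, LinearMap.neg_apply]
          ring))
    (fun x y => by
      ext z Z
      · simp
      · simp only [Prod.fst_add, map_add, Prod.snd_add, LinearMap.add_apply, LinearMap.neg_apply,
          AddMonoidHom.mk'_apply, AddMonoidHom.add_apply]
        ring)
  leibniz x y f := by
    ext Z <;> simp

/-- The endomorphism `π : X + α ↦ π♯ α` of `A ⊕ A*`. -/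
def Bivector.toEnd (π : Bivector R L) : Module.End R (L × Module.Dual R L) :=
  (π.sharp ∘ₗ LinearMap.snd R L (Module.Dual R L)).prod 0

/-- The endomorphism `N : X + α ↦ N X - ᵗN α` of `A ⊕ A*`. -/
def tensorToEnd (N : Module.End R L) : Module.End R (L × Module.Dual R L) :=
  (N ∘ₗ LinearMap.fst R L (Module.Dual R L)).prod
    (-(N.dualMap ∘ₗ LinearMap.snd R L (Module.Dual R L)))

/-- The endomorphism `σ : X + α ↦ σ♭ X` of `A ⊕ A*`. -/
def twoFormToEnd (σ : L [⋀^Fin 2]→ₗ[R] R) : Module.End R (L × Module.Dual R L) :=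
  LinearMap.prod 0 (flat σ ∘ₗ LinearMap.fst R L (Module.Dual R L))

/-- The Hamiltonian `{J, S}`. -/
def bigBracket (J : Module.End R (L × Module.Dual R L))
    (S : AnchoredBracket R (L × Module.Dual R L)) : AnchoredBracket R (L × Module.Dual R L) :=
  S.deform J

/-! ## Lie quasi-bialgebroids on `(A*, A)` -/

/-- The graded module `Γ(⋀^• A*)`. -/
abbrev Forms (R : Type*) [CommRing R] (L : Type*) [AddCommGroup L] [Module R L] : Type _ :=
  DirectSum ℕ fun p => L [⋀^Fin p]→ₗ[R] R

namespace Forms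

/-- A `p`-form as an element of `Γ(⋀^• A*)`. -/
abbrev of {p : ℕ} (P : L [⋀^Fin p]→ₗ[R] R) : Forms R L :=
  DirectSum.of (fun p => L [⋀^Fin p]→ₗ[R] R) p P

/-- A function as a `0`-form. -/
abbrev zeroForm (f : R) : L [⋀^Fin 0]→ₗ[R] R := AlternatingMap.constOfIsEmpty R L (Fin 0) f

/-- A section of `A*` as a `1`-form. -/
abbrev oneForm (α : Module.Dual R L) : L [⋀^Fin 1]→ₗ[R] R :=
  AlternatingMap.ofSubsingleton R L R (0 : Fin 1) α

/-- The wedge product of a `p`-form and a `q`-form (sum over shuffles, so that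
`(α ∧ β)(X, Y) = α(X) β(Y) - α(Y) β(X)` for `1`-forms), as a bilinear map. -/
def wedgeHom (p q : ℕ) :
    (L [⋀^Fin p]→ₗ[R] R) →ₗ[R] (L [⋀^Fin q]→ₗ[R] R) →ₗ[R] (L [⋀^Fin (p + q)]→ₗ[R] R) :=
  TensorProduct.curry
    ((AlternatingMap.domDomCongrₗ R finSumFinEquiv).toLinearMap ∘ₗ
      LinearMap.compAlternatingMapₗ R (LinearMap.mul' R R) ∘ₗ
        AlternatingMap.domCoprod')

/-- The wedge product on `Γ(⋀^• A*)`. -/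
def wedge : Forms R L →ₗ[R] Forms R L →ₗ[R] Forms R L :=
  DirectSum.toModule R ℕ _ fun p =>
    LinearMap.flip <| DirectSum.toModule R ℕ _ fun q => LinearMap.flip <|
      (wedgeHom p q).compr₂ (DirectSum.lof R ℕ (fun p => L [⋀^Fin p]→ₗ[R] R) (p + q))

end Forms

open Forms in
/-- A Gerstenhaber bracket on `(Γ(⋀^• A*), ∧)`. -/
structure IsGerstenhaber (B : Forms R L →ₗ[ℝ] Forms R L →ₗ[ℝ] Forms R L) : Prop where
  degree_zero : ∀ P Q : L [⋀^Fin 0]→ₗ[R] R, B (of P) (of Q) = 0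
  degree : ∀ (p q n : ℕ) (P : L [⋀^Fin p]→ₗ[R] R) (Q : L [⋀^Fin q]→ₗ[R] R), p + q = n + 1 →
    ∃ T : L [⋀^Fin n]→ₗ[R] R, B (of P) (of Q) = of T
  skew : ∀ (p q : ℕ) (P : L [⋀^Fin p]→ₗ[R] R) (Q : L [⋀^Fin q]→ₗ[R] R),
    B (of P) (of Q) = -((-1 : ℝ) ^ ((p + 1) * (q + 1)) • B (of Q) (of P))
  leibniz : ∀ (p q : ℕ) (P : L [⋀^Fin p]→ₗ[R] R) (Q : L [⋀^Fin q]→ₗ[R] R) (T : Forms R L),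
    B (of P) (wedge (of Q) T) =
      wedge (B (of P) (of Q)) T + (-1 : ℝ) ^ ((p + 1) * q) • wedge (of Q) (B (of P) T)
  jacobi : ∀ (p q : ℕ) (P : L [⋀^Fin p]→ₗ[R] R) (Q : L [⋀^Fin q]→ₗ[R] R) (T : Forms R L),
    B (of P) (B (of Q) T) =
      B (B (of P) (of Q)) T + (-1 : ℝ) ^ ((p + 1) * (q + 1)) • B (of Q) (B (of P) T)

open Forms in
/-- A Lie quasi-bialgebroid structure on `(A*, A)`: a Lie algebroid structure on `A*`, a degree one
derivation `δ` of the Gerstenhaber algebra `(Γ(⋀^• A*), ∧, [·,·])` whose bracket extends the Lie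
algebroid bracket and anchor, and `φ ∈ Γ(⋀³ A*)` with `δ² = [φ, ·]` and `δ φ = 0`. -/
structure LieQuasiBialgebroid (R : Type*) [CommRing R] [Algebra ℝ R]
    (L : Type*) [AddCommGroup L] [Module R L] where
  /-- the Lie algebroid structure on `A*` -/
  lie : LieAlgebroid R (Module.Dual R L)
  /-- the Gerstenhaber bracket -/
  gerst : Forms R L →ₗ[ℝ] Forms R L →ₗ[ℝ] Forms R L
  /-- the derivation -/
  δ : Forms R L →ₗ[ℝ] Forms R L
  /-- the `3`-form -/
  φ : L [⋀^Fin 3]→ₗ[R] R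
  isGerstenhaber : IsGerstenhaber gerst
  gerst_fun : ∀ (α : Module.Dual R L) (f : R),
    gerst (of (oneForm α)) (of (zeroForm f)) = of (zeroForm (lie.anchor α f))
  gerst_one : ∀ α β : Module.Dual R L,
    gerst (of (oneForm α)) (of (oneForm β)) = of (oneForm (lie.bracket α β))
  δ_degree : ∀ (p : ℕ) (P : L [⋀^Fin p]→ₗ[R] R), ∃ T : L [⋀^Fin (p + 1)]→ₗ[R] R, δ (of P) = of T
  δ_wedge : ∀ (p : ℕ) (P : L [⋀^Fin p]→ₗ[R] R) (T : Forms R L),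
    δ (wedge (of P) T) = wedge (δ (of P)) T + (-1 : ℝ) ^ p • wedge (of P) (δ T)
  δ_gerst : ∀ (p : ℕ) (P : L [⋀^Fin p]→ₗ[R] R) (T : Forms R L),
    δ (gerst (of P) T) = gerst (δ (of P)) T + (-1 : ℝ) ^ (p + 1) • gerst (of P) (δ T)
  δ_sq : ∀ T : Forms R L, δ (δ T) = gerst (of φ) T
  δ_φ : δ (of φ) = 0

open Forms in
/-- The Hamiltonian `S` defines a Lie quasi-bialgebroid structure on `(A*, A)`: there is such a
structure of which `S` encodes the bracket and the anchor on `A*`, the derivation `δ` (on functions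
and `1`-forms, by the Cartan formulas for the anchor and the `A`-component of the bracket on `A`),
and the `3`-form `φ` (the `A*`-component of the bracket on `A`). -/
def DefinesLieQuasiBialgebroid (S : AnchoredBracket R (L × Module.Dual R L)) : Prop :=
  ∃ Q : LieQuasiBialgebroid R L,
    (∀ α, Q.lie.anchor α = S.anchor (0, α)) ∧
    (∀ α β, S.bracket (0, α) (0, β) = (0, Q.lie.bracket α β)) ∧
    (∀ f, ∃ w : L [⋀^Fin 1]→ₗ[R] R, Q.δ (of (zeroForm f)) = of w ∧
      ∀ X, w ![X] = S.anchor (X, 0) f) ∧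
    (∀ α : Module.Dual R L, ∃ w : L [⋀^Fin 2]→ₗ[R] R, Q.δ (of (oneForm α)) = of w ∧
      ∀ X Y, w ![X, Y] = S.anchor (X, 0) (α Y) - S.anchor (Y, 0) (α X) -
        α (S.bracket (X, 0) (Y, 0)).1) ∧
    (∀ X Y Z, Q.φ ![X, Y, Z] = (S.bracket (X, 0) (Y, 0)).2 Z)

end Algebra

end

/-!
Write `S = μ + H` and `S_J = {J, S}`. Since `{S, S} = 0`, the Jacobi identity of the big bracket
gives `{S_J, S_J} = -{S, {J, {J, S}}}`. The hypotheses on `(π, N, -dσ, H)` say that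
`{J, {J, S}} = {Q, S} + B` with `Q` skew, assembled from `N² + π♯ σ♭` and the `2`-form
`-(σ(NX, Y) + σ(X, NY))`, and `B` a closed `3`-form regarded as a background; both `{Q, S}` and
`B` are annihilated by `{S, ·}`, so `S_J` is a Courant structure. The big bracket of two structures
appears here as their polarised Jacobiator.

The structure `S_J` restricts to `A*` as the Koszul bracket of `π`. Its extension to all forms is
built from `d` and the biderivation `π`, and `δ` is the Cartan differential of the bracket
`[X, Y]_N + π♯ H(X, Y, ·)` with anchor `ρ ∘ N`. Graded derivations of the algebra of forms that
vanish on functions and `1`-forms vanish, because some functions, separating sections, cut every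
section down to a combination of finitely many. Hence the Gerstenhaber identities,
`δ[·,·] = [δ·,·] ± [·,δ·]`, `δ² = [φ, ·]` and `δφ = 0` need only be checked on functions and
`1`-forms, where they are components of the Courant identities of `S_J`.
-/

noncomputable section

section AlternatingSums

variable {L N : Type*} [AddCommGroup N]

/-- The signed sum of a function of `n` vectors over all orderings of its arguments; for products of
forms on consecutive blocks it is a multiple of their wedge product. -/
def permSum {n : ℕ} (F : (Fin n → L) → N) (v : Fin n → L) : N :=
  ∑ σ : Equiv.Perm (Fin n), Equiv.Perm.sign σ • F (v ∘ σ)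

theorem permSum_smul {n : ℕ} (c : ℤ) (F : (Fin n → L) → N) (v : Fin n → L) :
    permSum (fun u => c • F u) v = c • permSum F v := by
  simp only [permSum, Finset.smul_sum, Units.smul_def, smul_comm c]

theorem permSum_alternatingMap {R : Type*} [CommRing R] [AddCommGroup L] [Module R L]
    [Module R N] {n : ℕ} (P : L [⋀^Fin n]→ₗ[R] N) (v : Fin n → L) :
    permSum P v = n.factorial • P v := by
  simp [permSum, AlternatingMap.map_perm, smul_smul, Fintype.card_perm]

theorem bijective_decomposeFin_symm_mul_cycleRange (n : ℕ) :
    Function.Bijective fun x : Fin (n + 1) × Equiv.Perm (Fin n) =>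
      Equiv.Perm.decomposeFin.symm (0, x.2) * x.1.cycleRange := by
  have preimage_zero (x : Fin (n + 1) × Equiv.Perm (Fin n)) :
      (Equiv.Perm.decomposeFin.symm (0, x.2) * x.1.cycleRange).symm 0 = x.1 := by
    rw [Equiv.symm_apply_eq, Equiv.Perm.mul_apply, Fin.cycleRange_self,
      Equiv.Perm.decomposeFin_symm_apply_zero]
  refine (Fintype.bijective_iff_injective_and_card _).2 ⟨?_, ?_⟩
  · rintro ⟨k, τ⟩ ⟨k', τ'⟩ h
    obtain rfl : k = k' := (preimage_zero (k, τ)).symm.trans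
      ((congrArg (fun σ : Equiv.Perm (Fin (n + 1)) => σ.symm 0) h).trans (preimage_zero (k', τ')))
    simpa using mul_right_cancel h
  · simp only [Fintype.card_prod, Fintype.card_fin, Fintype.card_perm, Nat.factorial_succ]

theorem cons_comp_decomposeFin_symm_mul_cycleRange {n : ℕ} (X : L) (w : Fin n → L)
    (k : Fin (n + 1)) (τ : Equiv.Perm (Fin n)) :
    (Fin.cons X w : Fin (n + 1) → L) ∘ (Equiv.Perm.decomposeFin.symm (0, τ) * k.cycleRange) =
      k.insertNth (α := fun _ => L) X (w ∘ τ) := by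
  rw [← Fin.cons_comp_cycleRange, Equiv.Perm.coe_mul, ← Function.comp_assoc]
  congr 1
  funext j
  cases j using Fin.cases <;> simp [Equiv.Perm.decomposeFin_symm_apply_succ]

theorem permSum_cons {n : ℕ} (F : (Fin (n + 1) → L) → N) (X : L) (w : Fin n → L) :
    permSum F (Fin.cons X w : Fin (n + 1) → L) =
      ∑ k : Fin (n + 1), (-1 : ℤ) ^ (k : ℕ) •
        permSum (fun u => F (k.insertNth (α := fun _ => L) X u)) w := by
  rw [permSum, ← (bijective_decomposeFin_symm_mul_cycleRange n).sum_comp, Fintype.sum_prod_type]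
  refine Finset.sum_congr rfl fun k _ => ?_
  rw [permSum, Finset.smul_sum]
  refine Finset.sum_congr rfl fun τ _ => ?_
  rw [cons_comp_decomposeFin_symm_mul_cycleRange, map_mul, Equiv.Perm.decomposeFin.symm_sign,
    Fin.sign_cycleRange]
  rcases Nat.even_or_odd (k : ℕ) with hk | hk <;>
    simp [Units.smul_def, hk.neg_one_pow, Function.comp_def]

end AlternatingSums

section BlockProducts

variable {R : Type*} [CommRing R] {L : Type*} [AddCommGroup L] [Module R L]
  {N₁ N₂ N₃ : Type*} [AddCommGroup N₁] [AddCommGroup N₂] [AddCommGroup N₃]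
  [Module R N₁] [Module R N₂] [Module R N₃] {p q n : ℕ}

/-- The product, along a bilinear map `Φ`, of the value of a form on the first `p` arguments and the
value of a form on the last `q` arguments. -/
def blockProd (Φ : N₁ →ₗ[R] N₂ →ₗ[R] N₃) (h : p + q = n)
    (a : L [⋀^Fin p]→ₗ[R] N₁) (b : L [⋀^Fin q]→ₗ[R] N₂) (v : Fin n → L) : N₃ :=
  Φ (a fun i => v (Fin.cast h (Fin.castAdd q i))) (b fun j => v (Fin.cast h (Fin.natAdd p j)))

theorem blockProd_insertNth_castAdd (Φ : N₁ →ₗ[R] N₂ →ₗ[R] N₃) (h : p + 1 + q = n + 1)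
    (h' : p + q = n) (a : L [⋀^Fin (p + 1)]→ₗ[R] N₁) (b : L [⋀^Fin q]→ₗ[R] N₂) (X : L)
    (i : Fin (p + 1)) (u : Fin n → L) :
    blockProd Φ h a b ((Fin.cast h (Fin.castAdd q i)).insertNth (α := fun _ => L) X u) =
      (-1 : ℤ) ^ (i : ℕ) • blockProd Φ h' (a.curryLeft X) b u := by
  have first_block : (fun i' => (Fin.cast h (Fin.castAdd q i)).insertNth (α := fun _ => L) X u
      (Fin.cast h (Fin.castAdd q i'))) =
      i.insertNth (α := fun _ => L) X fun i' => u (Fin.cast h' (Fin.castAdd q i')) := by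
    funext i'
    cases i' using i.succAboveCases with
    | x => simp
    | p j =>
      have : Fin.cast h (Fin.castAdd q (i.succAbove j)) =
          (Fin.cast h (Fin.castAdd q i)).succAbove (Fin.cast h' (Fin.castAdd q j)) := by
        ext
        simp only [Fin.succAbove, Fin.lt_def, Fin.val_cast, Fin.val_castAdd, Fin.val_castSucc]
        split_ifs <;> simp
      rw [this, Fin.insertNth_apply_succAbove, Fin.insertNth_apply_succAbove]
  have last_block : (fun j => (Fin.cast h (Fin.castAdd q i)).insertNth (α := fun _ => L) X u
      (Fin.cast h (Fin.natAdd (p + 1) j))) = fun j => u (Fin.cast h' (Fin.natAdd p j)) := by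
    funext j
    have : Fin.cast h (Fin.natAdd (p + 1) j) =
        (Fin.cast h (Fin.castAdd q i)).succAbove (Fin.cast h' (Fin.natAdd p j)) := by
      ext
      simp only [Fin.succAbove, Fin.lt_def, Fin.val_cast, Fin.val_castAdd, Fin.val_castSucc,
        Fin.val_natAdd]
      grind
    rw [this, Fin.insertNth_apply_succAbove]
  rw [blockProd, first_block, last_block, AlternatingMap.map_insertNth, map_zsmul,
    LinearMap.smul_apply]
  rfl

theorem blockProd_insertNth_natAdd (Φ : N₁ →ₗ[R] N₂ →ₗ[R] N₃)
    (h : p + (q + 1) = n + 1) (h' : p + q = n) (a : L [⋀^Fin p]→ₗ[R] N₁)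
    (b : L [⋀^Fin (q + 1)]→ₗ[R] N₂) (X : L) (j : Fin (q + 1)) (u : Fin n → L) :
    blockProd Φ h a b ((Fin.cast h (Fin.natAdd p j)).insertNth (α := fun _ => L) X u) =
      (-1 : ℤ) ^ (j : ℕ) • blockProd Φ h' a (b.curryLeft X) u := by
  have first_block : (fun i => (Fin.cast h (Fin.natAdd p j)).insertNth (α := fun _ => L) X u
      (Fin.cast h (Fin.castAdd (q + 1) i))) = fun i => u (Fin.cast h' (Fin.castAdd q i)) := by
    funext i
    have : Fin.cast h (Fin.castAdd (q + 1) i) =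
        (Fin.cast h (Fin.natAdd p j)).succAbove (Fin.cast h' (Fin.castAdd q i)) := by
      ext
      simp only [Fin.succAbove, Fin.lt_def, Fin.val_cast, Fin.val_castAdd, Fin.val_castSucc,
        Fin.val_natAdd]
      grind
    rw [this, Fin.insertNth_apply_succAbove]
  have last_block : (fun j' => (Fin.cast h (Fin.natAdd p j)).insertNth (α := fun _ => L) X u
      (Fin.cast h (Fin.natAdd p j'))) =
      j.insertNth (α := fun _ => L) X fun j' => u (Fin.cast h' (Fin.natAdd p j')) := by
    funext j'
    cases j' using j.succAboveCases with
    | x => simp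
    | p i =>
      have : Fin.cast h (Fin.natAdd p (j.succAbove i)) =
          (Fin.cast h (Fin.natAdd p j)).succAbove (Fin.cast h' (Fin.natAdd p i)) := by
        ext
        simp only [Fin.succAbove, Fin.lt_def, Fin.val_cast, Fin.val_natAdd, Fin.val_castSucc]
        grind
      rw [this, Fin.insertNth_apply_succAbove, Fin.insertNth_apply_succAbove]
  rw [blockProd, first_block, last_block, AlternatingMap.map_insertNth, map_zsmul]
  rfl

theorem sum_permSum_blockProd_castAdd (Φ : N₁ →ₗ[R] N₂ →ₗ[R] N₃) (h : p + 1 + q = n + 1)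
    (h' : p + q = n) (a : L [⋀^Fin (p + 1)]→ₗ[R] N₁) (b : L [⋀^Fin q]→ₗ[R] N₂) (X : L)
    (w : Fin n → L) :
    ∑ i : Fin (p + 1), (-1 : ℤ) ^ ((Fin.cast h (Fin.castAdd q i) : Fin (n + 1)) : ℕ) •
      permSum (fun u => blockProd Φ h a b
        ((Fin.cast h (Fin.castAdd q i)).insertNth (α := fun _ => L) X u)) w =
      (p + 1) • permSum (blockProd Φ h' (a.curryLeft X) b) w := by
  simp_rw [blockProd_insertNth_castAdd Φ h h', permSum_smul, smul_smul]
  simp [← mul_pow]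

theorem sum_permSum_blockProd_natAdd (Φ : N₁ →ₗ[R] N₂ →ₗ[R] N₃) (h : p + (q + 1) = n + 1)
    (h' : p + q = n) (a : L [⋀^Fin p]→ₗ[R] N₁) (b : L [⋀^Fin (q + 1)]→ₗ[R] N₂) (X : L)
    (w : Fin n → L) :
    ∑ j : Fin (q + 1), (-1 : ℤ) ^ ((Fin.cast h (Fin.natAdd p j) : Fin (n + 1)) : ℕ) •
      permSum (fun u => blockProd Φ h a b
        ((Fin.cast h (Fin.natAdd p j)).insertNth (α := fun _ => L) X u)) w =
      (-1 : ℤ) ^ p • (q + 1) • permSum (blockProd Φ h' a (b.curryLeft X)) w := by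
  simp_rw [blockProd_insertNth_natAdd Φ h h', permSum_smul, smul_smul]
  simp [pow_add, mul_assoc, ← mul_pow, smul_comm ((-1 : ℤ) ^ p)]

theorem permSum_blockProd_zero_cons (Φ : N₁ →ₗ[R] N₂ →ₗ[R] N₃) (h : 0 + (q + 1) = n + 1)
    (h' : 0 + q = n) (a : L [⋀^Fin 0]→ₗ[R] N₁) (b : L [⋀^Fin (q + 1)]→ₗ[R] N₂) (X : L)
    (w : Fin n → L) :
    permSum (blockProd Φ h a b) (Fin.cons X w : Fin (n + 1) → L) =
      (q + 1) • permSum (blockProd Φ h' a (b.curryLeft X)) w := by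
  rw [permSum_cons, ← (finCongr h).sum_comp, Fin.sum_univ_add]
  simpa using sum_permSum_blockProd_natAdd Φ h h' a b X w

theorem permSum_blockProd_cons_zero (Φ : N₁ →ₗ[R] N₂ →ₗ[R] N₃) (h : p + 1 + 0 = n + 1)
    (h' : p + 0 = n) (a : L [⋀^Fin (p + 1)]→ₗ[R] N₁) (b : L [⋀^Fin 0]→ₗ[R] N₂) (X : L)
    (w : Fin n → L) :
    permSum (blockProd Φ h a b) (Fin.cons X w : Fin (n + 1) → L) =
      (p + 1) • permSum (blockProd Φ h' (a.curryLeft X) b) w := by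
  rw [permSum_cons, ← (finCongr h).sum_comp, Fin.sum_univ_add]
  simpa using sum_permSum_blockProd_castAdd Φ h h' a b X w

theorem permSum_blockProd_cons (Φ : N₁ →ₗ[R] N₂ →ₗ[R] N₃) (h : p + 1 + (q + 1) = n + 1)
    (hl : p + (q + 1) = n) (hr : p + 1 + q = n) (a : L [⋀^Fin (p + 1)]→ₗ[R] N₁)
    (b : L [⋀^Fin (q + 1)]→ₗ[R] N₂) (X : L) (w : Fin n → L) :
    permSum (blockProd Φ h a b) (Fin.cons X w : Fin (n + 1) → L) =
      (p + 1) • permSum (blockProd Φ hl (a.curryLeft X) b) w +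
        (-1 : ℤ) ^ (p + 1) • (q + 1) • permSum (blockProd Φ hr a (b.curryLeft X)) w := by
  rw [permSum_cons, ← (finCongr h).sum_comp, Fin.sum_univ_add]
  exact congrArg₂ (· + ·) (sum_permSum_blockProd_castAdd Φ h hl a b X w)
    (sum_permSum_blockProd_natAdd Φ h hr a b X w)

end BlockProducts

section WedgeAlong

variable {R : Type*} [CommRing R] {L : Type*} [AddCommGroup L] [Module R L]
  {N₁ N₂ N₃ : Type*} [AddCommGroup N₁] [AddCommGroup N₂] [AddCommGroup N₃]
  [Module R N₁] [Module R N₂] [Module R N₃] {p q n : ℕ}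

/-- The wedge product of vector valued forms along a bilinear map of the values, normalised as a sum
over shuffles. -/
def wedgeAlong (Φ : N₁ →ₗ[R] N₂ →ₗ[R] N₃) (p q : ℕ) :
    (L [⋀^Fin p]→ₗ[R] N₁) →ₗ[R] (L [⋀^Fin q]→ₗ[R] N₂) →ₗ[R] (L [⋀^Fin (p + q)]→ₗ[R] N₃) :=
  TensorProduct.curry
    ((AlternatingMap.domDomCongrₗ R finSumFinEquiv).toLinearMap ∘ₗ
      LinearMap.compAlternatingMapₗ R (TensorProduct.lift Φ) ∘ₗ
        AlternatingMap.domCoprod')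

/-- `wedgeAlong` with values in `n`-forms for a given proof of `p + q = n`; it avoids casts between
forms of the degrees `p + 1 + q` and `p + q + 1`. -/
def wedgeCast (Φ : N₁ →ₗ[R] N₂ →ₗ[R] N₃) (h : p + q = n) (a : L [⋀^Fin p]→ₗ[R] N₁)
    (b : L [⋀^Fin q]→ₗ[R] N₂) : L [⋀^Fin n]→ₗ[R] N₃ :=
  (wedgeAlong Φ p q a b).domDomCongr (finCongr h)

theorem factorial_smul_wedgeCast (Φ : N₁ →ₗ[R] N₂ →ₗ[R] N₃) (h : p + q = n)
    (a : L [⋀^Fin p]→ₗ[R] N₁) (b : L [⋀^Fin q]→ₗ[R] N₂) (v : Fin n → L) :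
    (p.factorial * q.factorial) • wedgeCast Φ h a b v = permSum (blockProd Φ h a b) v := by
  subst h
  have alternatization := congrArg (fun m => TensorProduct.lift Φ (m fun i => v (finSumFinEquiv i)))
    (MultilinearMap.domCoprod_alternization_eq a b)
  simp only [Fintype.card_fin, AlternatingMap.smul_apply, map_nsmul] at alternatization
  refine Eq.trans ?_ (alternatization.symm.trans ?_)
  · rfl
  · rw [MultilinearMap.alternatization_apply, map_sum, permSum,
      ← Equiv.sum_comp (finSumFinEquiv.permCongr)]
    refine Finset.sum_congr rfl fun σ _ => ?_
    simp only [MultilinearMap.domDomCongr_apply, MultilinearMap.domCoprod_apply,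
      Equiv.Perm.sign_permCongr, Units.smul_def, map_zsmul, TensorProduct.lift.tmul, blockProd,
      AlternatingMap.coe_multilinearMap]
    simp [Equiv.permCongr_apply]

variable [IsAddTorsionFree N₃]

theorem wedgeCast_eq_of_factorial_smul {Φ : N₁ →ₗ[R] N₂ →ₗ[R] N₃} {h : p + q = n}
    {a : L [⋀^Fin p]→ₗ[R] N₁} {b : L [⋀^Fin q]→ₗ[R] N₂} {v : Fin n → L} {z : N₃}
    (hz : permSum (blockProd Φ h a b) v = (p.factorial * q.factorial) • z) :
    wedgeCast Φ h a b v = z :=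
  nsmul_right_injective (Nat.mul_ne_zero p.factorial_ne_zero q.factorial_ne_zero)
    ((factorial_smul_wedgeCast Φ h a b v).trans hz)

theorem wedgeCast_zero_left (Φ : N₁ →ₗ[R] N₂ →ₗ[R] N₃) (a : L [⋀^Fin 0]→ₗ[R] N₁)
    (b : L [⋀^Fin q]→ₗ[R] N₂) (v : Fin q → L) :
    wedgeCast Φ (Nat.zero_add q) a b v = Φ (a 0) (b v) := by
  have blockProd_eq : blockProd Φ (Nat.zero_add q) a b = (Φ (a 0)).compAlternatingMap b := by
    funext u
    exact congrArg₂ (fun s t => Φ (a s) (b t)) (Subsingleton.elim _ _)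
      (funext fun j => congrArg u (Fin.ext (by simp)))
  refine wedgeCast_eq_of_factorial_smul ?_
  rw [blockProd_eq, permSum_alternatingMap, Nat.factorial_zero, one_mul]
  rfl

theorem curryLeft_wedgeCast_zero_succ (Φ : N₁ →ₗ[R] N₂ →ₗ[R] N₃) (h : 0 + (q + 1) = n + 1)
    (h' : 0 + q = n) (X : L) (a : L [⋀^Fin 0]→ₗ[R] N₁) (b : L [⋀^Fin (q + 1)]→ₗ[R] N₂) :
    (wedgeCast Φ h a b).curryLeft X = wedgeCast Φ h' a (b.curryLeft X) := by
  ext w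
  rw [AlternatingMap.curryLeft_apply_apply]
  refine wedgeCast_eq_of_factorial_smul (v := (Fin.cons X w : Fin (n + 1) → L)) ?_
  rw [permSum_blockProd_zero_cons Φ h h',
    ← factorial_smul_wedgeCast Φ h', smul_smul, Nat.factorial_succ]
  congr 1
  ring

theorem curryLeft_wedgeCast_succ_zero (Φ : N₁ →ₗ[R] N₂ →ₗ[R] N₃) (h : p + 1 + 0 = n + 1)
    (h' : p + 0 = n) (X : L) (a : L [⋀^Fin (p + 1)]→ₗ[R] N₁) (b : L [⋀^Fin 0]→ₗ[R] N₂) :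
    (wedgeCast Φ h a b).curryLeft X = wedgeCast Φ h' (a.curryLeft X) b := by
  ext w
  rw [AlternatingMap.curryLeft_apply_apply]
  refine wedgeCast_eq_of_factorial_smul (v := (Fin.cons X w : Fin (n + 1) → L)) ?_
  rw [permSum_blockProd_cons_zero Φ h h',
    ← factorial_smul_wedgeCast Φ h', smul_smul, Nat.factorial_succ, mul_assoc]

theorem curryLeft_wedgeCast_succ_succ (Φ : N₁ →ₗ[R] N₂ →ₗ[R] N₃) (h : p + 1 + (q + 1) = n + 1)
    (hl : p + (q + 1) = n) (hr : p + 1 + q = n) (X : L) (a : L [⋀^Fin (p + 1)]→ₗ[R] N₁)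
    (b : L [⋀^Fin (q + 1)]→ₗ[R] N₂) :
    (wedgeCast Φ h a b).curryLeft X = wedgeCast Φ hl (a.curryLeft X) b +
      (-1 : ℤ) ^ (p + 1) • wedgeCast Φ hr a (b.curryLeft X) := by
  ext w
  rw [AlternatingMap.curryLeft_apply_apply]
  refine wedgeCast_eq_of_factorial_smul (v := (Fin.cons X w : Fin (n + 1) → L)) ?_
  rw [permSum_blockProd_cons Φ h hl hr, ← factorial_smul_wedgeCast Φ hl,
    ← factorial_smul_wedgeCast Φ hr, AlternatingMap.add_apply, AlternatingMap.smul_apply,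
    Nat.factorial_succ p, Nat.factorial_succ q]
  module

end WedgeAlong

instance isAddTorsionFree_of_algebra_real {R : Type*} [CommRing R] [Algebra ℝ R] :
    IsAddTorsionFree R :=
  .of_isTorsionFree ℝ R

/-- The graded module of forms with values in a module. -/
abbrev ValuedForms (R : Type*) [CommRing R] (L : Type*) [AddCommGroup L] [Module R L]
    (N : Type*) [AddCommGroup N] [Module R N] : Type _ :=
  DirectSum ℕ fun p => L [⋀^Fin p]→ₗ[R] N

namespace ValuedForms

variable {R : Type*} [CommRing R] {L : Type*} [AddCommGroup L] [Module R L]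
  {N N₁ N₂ N₃ : Type*} [AddCommGroup N] [AddCommGroup N₁] [AddCommGroup N₂] [AddCommGroup N₃]
  [Module R N] [Module R N₁] [Module R N₂] [Module R N₃]

/-- A `p`-form as an element of the graded module. -/
abbrev of {p : ℕ} (P : L [⋀^Fin p]→ₗ[R] N) : ValuedForms R L N :=
  DirectSum.of (fun p => L [⋀^Fin p]→ₗ[R] N) p P

theorem of_eq_lof {p : ℕ} (P : L [⋀^Fin p]→ₗ[R] N) :
    of P = DirectSum.lof R ℕ (fun p => L [⋀^Fin p]→ₗ[R] N) p P := rfl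

@[simp]
theorem of_add {p : ℕ} (P Q : L [⋀^Fin p]→ₗ[R] N) : of (P + Q) = of P + of Q := map_add _ P Q

@[simp]
theorem of_neg {p : ℕ} (P : L [⋀^Fin p]→ₗ[R] N) : of (-P) = -of P := map_neg _ P

@[simp]
theorem of_zero {p : ℕ} : of (0 : L [⋀^Fin p]→ₗ[R] N) = 0 := map_zero _

@[simp]
theorem of_smul {p : ℕ} (f : R) (P : L [⋀^Fin p]→ₗ[R] N) : of (f • P) = f • of P :=
  map_smul (DirectSum.lof R ℕ (fun p => L [⋀^Fin p]→ₗ[R] N) p) f P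

@[simp]
theorem neg_smul_form (f : R) (ξ : ValuedForms R L N) : (-f) • ξ = -(f • ξ) := neg_smul f ξ

@[elab_as_elim]
theorem induction {motive : ValuedForms R L N → Prop} (ξ : ValuedForms R L N) (zero : motive 0)
    (of : ∀ (p : ℕ) (P : L [⋀^Fin p]→ₗ[R] N), motive (of P))
    (add : ∀ a b, motive a → motive b → motive (a + b)) : motive ξ :=
  DirectSum.induction_on ξ zero of add

@[simp]
theorem of_apply_same {p : ℕ} (P : L [⋀^Fin p]→ₗ[R] N) : of P p = P :=
  DirectSum.of_eq_same (β := fun p => L [⋀^Fin p]→ₗ[R] N) p P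

theorem of_apply_ne {p q : ℕ} (h : q ≠ p) (P : L [⋀^Fin p]→ₗ[R] N) : of P q = 0 :=
  DirectSum.of_eq_of_ne (β := fun p => L [⋀^Fin p]→ₗ[R] N) p q P h

theorem of_congr {p q : ℕ} (h : p = q) (P : L [⋀^Fin p]→ₗ[R] N) (Q : L [⋀^Fin q]→ₗ[R] N)
    (hPQ : ∀ v : Fin q → L, P (fun i => v (Fin.cast h i)) = Q v) : of P = of Q := by
  subst h
  exact congrArg of (AlternatingMap.ext hPQ)

theorem of_injective {p : ℕ} {P Q : L [⋀^Fin p]→ₗ[R] N} (h : of P = of Q) : P = Q :=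
  DirectSum.of_injective p h

/-- The interior product of a homogeneous form. -/
def interiorHom (X : L) : ∀ p : ℕ, (L [⋀^Fin p]→ₗ[R] N) →ₗ[R] ValuedForms R L N
  | 0 => 0
  | p + 1 => DirectSum.lof R ℕ (fun p => L [⋀^Fin p]→ₗ[R] N) p ∘ₗ
      AlternatingMap.curryLeftLinearMap.flip X

/-- The interior product. -/
def interior (X : L) : ValuedForms R L N →ₗ[R] ValuedForms R L N :=
  DirectSum.toModule R ℕ _ (interiorHom X)

@[simp]
theorem interior_of_zero (X : L) (P : L [⋀^Fin 0]→ₗ[R] N) : interior X (of P) = 0 := by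
  rw [interior, of_eq_lof, DirectSum.toModule_lof]
  rfl

@[simp]
theorem interior_of_succ (X : L) {p : ℕ} (P : L [⋀^Fin (p + 1)]→ₗ[R] N) :
    interior X (of P) = of (P.curryLeft X) := by
  rw [interior, of_eq_lof, DirectSum.toModule_lof]
  rfl

theorem interior_add_left (X Y : L) (ξ : ValuedForms R L N) :
    interior (X + Y) ξ = interior X ξ + interior Y ξ := by
  induction ξ using ValuedForms.induction with
  | zero => simp
  | of p P => cases p <;> simp
  | add a b ha hb => simp only [map_add, ha, hb]; abel

theorem interior_smul_left (f : R) (X : L) (ξ : ValuedForms R L N) :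
    interior (f • X) ξ = f • interior X ξ := by
  induction ξ using ValuedForms.induction with
  | zero => simp
  | of p P =>
    cases p
    · simp
    · simp only [interior_of_succ, map_smul, of_smul]
  | add a b ha hb => simp only [map_add, ha, hb, smul_add]

theorem interior_apply (X : L) (ξ : ValuedForms R L N) (p : ℕ) :
    interior X ξ p = (ξ (p + 1)).curryLeft X := by
  induction ξ using ValuedForms.induction with
  | zero => simp
  | of q P =>
    cases q with
    | zero => rw [interior_of_zero, of_apply_ne (by omega)]; simp
    | succ q =>
      rw [interior_of_succ]
      rcases eq_or_ne p q with rfl | h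
      · rw [of_apply_same, of_apply_same]
      · rw [of_apply_ne h, of_apply_ne (by omega)]; simp
  | add a b ha hb =>
    rw [map_add, DirectSum.add_apply, DirectSum.add_apply, ha, hb]; rfl

theorem ext_interior {ξ η : ValuedForms R L N} (h0 : ξ 0 = η 0)
    (h : ∀ X, interior X ξ = interior X η) : ξ = η := by
  refine DFinsupp.ext fun p => ?_
  cases p with
  | zero => exact h0
  | succ p =>
    ext v
    have := congrArg (fun ζ : ValuedForms R L N => ζ p (Fin.tail v)) (h (v 0))
    simp only [interior_apply, AlternatingMap.curryLeft_apply_apply] at this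
    rw [← Fin.cons_self_tail v]
    exact this

theorem interior_interior_self (X : L) (ξ : ValuedForms R L N) : interior X (interior X ξ) = 0 := by
  refine DFinsupp.ext fun p => ?_
  rw [interior_apply, interior_apply, AlternatingMap.curryLeft_same]
  rfl

theorem interior_interior (X Y : L) (ξ : ValuedForms R L N) :
    interior X (interior Y ξ) = -interior Y (interior X ξ) := by
  have h := interior_interior_self (X + Y) ξ
  simp only [interior_add_left, map_add, interior_interior_self, zero_add, add_zero] at h
  rw [eq_neg_iff_add_eq_zero, ← h, add_comm]

/-- The grading involution, multiplication by `(-1)^p` on `p`-forms. -/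
def invol : ValuedForms R L N →ₗ[R] ValuedForms R L N :=
  DirectSum.toModule R ℕ _ fun p =>
    (-1 : R) ^ p • DirectSum.lof R ℕ (fun p => L [⋀^Fin p]→ₗ[R] N) p

theorem invol_of {p : ℕ} (P : L [⋀^Fin p]→ₗ[R] N) : invol (of P) = (-1 : R) ^ p • of P := by
  rw [invol, of_eq_lof, DirectSum.toModule_lof]
  rfl

@[simp]
theorem invol_invol (ξ : ValuedForms R L N) : invol (invol ξ) = ξ := by
  induction ξ using ValuedForms.induction with
  | zero => simp
  | of p P => rw [invol_of, map_smul, invol_of, smul_smul, ← mul_pow]; simp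
  | add a b ha hb => simp only [map_add, ha, hb]

theorem interior_invol (X : L) (ξ : ValuedForms R L N) :
    interior X (invol ξ) = -invol (interior X ξ) := by
  induction ξ using ValuedForms.induction with
  | zero => simp
  | of p P =>
    cases p with
    | zero => simp [invol_of]
    | succ p =>
      rw [invol_of, map_smul, interior_of_succ, invol_of, pow_succ, mul_neg_one]
      exact neg_smul ((-1 : R) ^ p) (of (P.curryLeft X))
  | add a b ha hb => simp only [map_add, ha, hb]; abel

/-- Homogeneous elements of degree `p`. -/
def IsHom (p : ℕ) (ξ : ValuedForms R L N) : Prop := ∃ P : L [⋀^Fin p]→ₗ[R] N, ξ = of P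

theorem isHom_of {p : ℕ} (P : L [⋀^Fin p]→ₗ[R] N) : IsHom p (of P) := ⟨P, rfl⟩

theorem isHom_zero (p : ℕ) : IsHom p (0 : ValuedForms R L N) := ⟨0, by simp⟩

namespace IsHom

variable {p : ℕ} {ξ η : ValuedForms R L N}

theorem add (h : IsHom p ξ) (h' : IsHom p η) : IsHom p (ξ + η) := by
  obtain ⟨P, rfl⟩ := h
  obtain ⟨Q, rfl⟩ := h'
  exact ⟨P + Q, by simp⟩

theorem smul (f : R) (h : IsHom p ξ) : IsHom p (f • ξ) := by
  obtain ⟨P, rfl⟩ := h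
  exact ⟨f • P, by simp⟩

theorem neg (h : IsHom p ξ) : IsHom p (-ξ) := by
  obtain ⟨P, rfl⟩ := h
  exact ⟨-P, by simp⟩

theorem sub (h : IsHom p ξ) (h' : IsHom p η) : IsHom p (ξ - η) := by
  rw [sub_eq_add_neg]; exact h.add h'.neg

theorem interior (h : IsHom p ξ) (X : L) : IsHom (p - 1) (interior X ξ) := by
  obtain ⟨P, rfl⟩ := h
  cases p with
  | zero => simpa using isHom_zero 0
  | succ p => exact ⟨_, interior_of_succ X P⟩

theorem invol_eq (h : IsHom p ξ) : invol ξ = (-1 : R) ^ p • ξ := by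
  obtain ⟨P, rfl⟩ := h
  exact invol_of P

theorem invol (h : IsHom p ξ) : IsHom p (invol ξ) := by
  rw [h.invol_eq]
  exact h.smul _

theorem apply_ne (h : IsHom p ξ) {q : ℕ} (hq : q ≠ p) : ξ q = 0 := by
  obtain ⟨P, rfl⟩ := h
  exact DirectSum.of_eq_of_ne _ _ _ hq

theorem interior_eq_zero (h : IsHom 0 ξ) (X : L) : ValuedForms.interior X ξ = 0 := by
  obtain ⟨P, rfl⟩ := h
  simp

end IsHom

@[elab_as_elim]
theorem induction₂ {motive : ValuedForms R L N₁ → ValuedForms R L N₂ → Prop}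
    (P : ValuedForms R L N₁) (Q : ValuedForms R L N₂)
    (isHom : ∀ p q P Q, IsHom p P → IsHom q Q → motive P Q)
    (add_left : ∀ P P' Q, motive P Q → motive P' Q → motive (P + P') Q)
    (add_right : ∀ P Q Q', motive P Q → motive P Q' → motive P (Q + Q')) : motive P Q := by
  have isHom_left : ∀ p P, IsHom p P → motive P Q := fun p P hP => by
    induction Q using ValuedForms.induction with
    | zero => exact isHom p 0 P 0 hP (isHom_zero 0)
    | of q Q => exact isHom p q P _ hP (isHom_of Q)
    | add Q Q' hQ hQ' => exact add_right P Q Q' hQ hQ'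
  induction P using ValuedForms.induction with
  | zero => exact isHom_left 0 0 (isHom_zero 0)
  | of p P => exact isHom_left p _ (isHom_of P)
  | add P P' hP hP' => exact add_left P P' Q hP hP'

namespace IsHom

theorem interior_induction₂ {motive : ℕ → ℕ → ValuedForms R L N₁ → ValuedForms R L N₂ → Prop}
    (zero_left : ∀ p q Q, motive p q 0 Q) (zero_right : ∀ p q P, motive p q P 0)
    (step : ∀ p q P Q, IsHom p P → IsHom q Q →
      (∀ X Q', IsHom q Q' → motive (p - 1) q (ValuedForms.interior X P) Q') →
      (∀ X P', IsHom p P' → motive p (q - 1) P' (ValuedForms.interior X Q)) → motive p q P Q)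
    {p q : ℕ} {P : ValuedForms R L N₁} {Q : ValuedForms R L N₂} (hP : IsHom p P) (hQ : IsHom q Q) :
    motive p q P Q := by
  induction hn : p + q using Nat.strong_induction_on generalizing p q P Q with
  | _ n ih =>
    refine step p q P Q hP hQ (fun X Q' hQ' => ?_) (fun X P' hP' => ?_)
    · rcases Nat.eq_zero_or_pos p with rfl | hp
      · rw [hP.interior_eq_zero]
        exact zero_left _ _ _
      · exact ih (p - 1 + q) (by omega) (hP.interior X) hQ' rfl
    · rcases Nat.eq_zero_or_pos q with rfl | hq
      · rw [hQ.interior_eq_zero]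
        exact zero_right _ _ _
      · exact ih (p + (q - 1)) (by omega) hP' (hQ.interior X) rfl

theorem interior_induction₃
    {motive : ℕ → ValuedForms R L N₁ → ValuedForms R L N₂ → ValuedForms R L N₃ → Prop}
    (zero_left : ∀ p Q T, motive p 0 Q T) (zero_mid : ∀ p P T, motive p P 0 T)
    (zero_right : ∀ p P Q, motive p P Q 0)
    (step : ∀ p q t P Q T, IsHom p P → IsHom q Q → IsHom t T →
      (∀ X Q' T', IsHom q Q' → IsHom t T' → motive (p - 1) (ValuedForms.interior X P) Q' T') →
      (∀ X P' T', IsHom p P' → IsHom t T' → motive p P' (ValuedForms.interior X Q) T') →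
      (∀ X P' Q', IsHom p P' → IsHom q Q' → motive p P' Q' (ValuedForms.interior X T)) →
      motive p P Q T)
    {p q t : ℕ} {P : ValuedForms R L N₁} {Q : ValuedForms R L N₂} {T : ValuedForms R L N₃}
    (hP : IsHom p P) (hQ : IsHom q Q) (hT : IsHom t T) : motive p P Q T := by
  induction hn : p + q + t using Nat.strong_induction_on generalizing p q t P Q T with
  | _ n ih =>
    refine step p q t P Q T hP hQ hT (fun X Q' T' hQ' hT' => ?_) (fun X P' T' hP' hT' => ?_)
      (fun X P' Q' hP' hQ' => ?_)
    · rcases Nat.eq_zero_or_pos p with rfl | hp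
      · rw [hP.interior_eq_zero]
        exact zero_left _ _ _
      · exact ih (p - 1 + q + t) (by omega) (hP.interior X) hQ' hT' rfl
    · rcases Nat.eq_zero_or_pos q with rfl | hq
      · rw [hQ.interior_eq_zero]
        exact zero_mid _ _ _
      · exact ih (p + (q - 1) + t) (by omega) hP' (hQ.interior X) hT' rfl
    · rcases Nat.eq_zero_or_pos t with rfl | ht
      · rw [hT.interior_eq_zero]
        exact zero_right _ _ _
      · exact ih (p + q + (t - 1)) (by omega) hP' hQ' (hT.interior X) rfl

end IsHom

/-- The wedge product along a bilinear map of the values, on the graded modules. -/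
def wedge (Φ : N₁ →ₗ[R] N₂ →ₗ[R] N₃) :
    ValuedForms R L N₁ →ₗ[R] ValuedForms R L N₂ →ₗ[R] ValuedForms R L N₃ :=
  DirectSum.toModule R ℕ _ fun p =>
    LinearMap.flip <| DirectSum.toModule R ℕ _ fun q => LinearMap.flip <|
      (wedgeAlong Φ p q).compr₂ (DirectSum.lof R ℕ (fun p => L [⋀^Fin p]→ₗ[R] N₃) (p + q))

theorem wedge_of (Φ : N₁ →ₗ[R] N₂ →ₗ[R] N₃) {p q : ℕ} (P : L [⋀^Fin p]→ₗ[R] N₁)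
    (Q : L [⋀^Fin q]→ₗ[R] N₂) : wedge Φ (of P) (of Q) = of (wedgeAlong Φ p q P Q) := by
  simp only [wedge, of_eq_lof, DirectSum.toModule_lof, LinearMap.flip_apply,
    LinearMap.compr₂_apply]

theorem IsHom.wedge (Φ : N₁ →ₗ[R] N₂ →ₗ[R] N₃) {p q : ℕ} {P : ValuedForms R L N₁}
    {Q : ValuedForms R L N₂} (hP : IsHom p P) (hQ : IsHom q Q) : IsHom (p + q) (wedge Φ P Q) := by
  obtain ⟨P, rfl⟩ := hP
  obtain ⟨Q, rfl⟩ := hQ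
  exact ⟨_, wedge_of Φ P Q⟩

theorem invol_wedge (Φ : N₁ →ₗ[R] N₂ →ₗ[R] N₃) (P : ValuedForms R L N₁) (Q : ValuedForms R L N₂) :
    invol (wedge Φ P Q) = wedge Φ (invol P) (invol Q) := by
  induction P, Q using induction₂ with
  | isHom p q P Q hP hQ =>
    rw [(hP.wedge Φ hQ).invol_eq, hP.invol_eq, hQ.invol_eq]
    simp only [map_smul, LinearMap.smul_apply, smul_smul, pow_add, mul_comm]
  | add_left P P' Q h h' => simp only [map_add, LinearMap.add_apply, h, h']
  | add_right P Q Q' h h' => simp only [map_add, h, h']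

theorem wedge_of_cast {p q n : ℕ} (Φ : N₁ →ₗ[R] N₂ →ₗ[R] N₃) (h : p + q = n)
    (a : L [⋀^Fin p]→ₗ[R] N₁) (b : L [⋀^Fin q]→ₗ[R] N₂) :
    wedge Φ (of a) (of b) = of (wedgeCast Φ h a b) := by
  rw [wedge_of]
  exact of_congr h _ _ fun v => rfl

theorem interior_wedge [IsAddTorsionFree N₃] (Φ : N₁ →ₗ[R] N₂ →ₗ[R] N₃) (X : L)
    (P : ValuedForms R L N₁) (Q : ValuedForms R L N₂) :
    interior X (wedge Φ P Q) = wedge Φ (interior X P) Q + wedge Φ (invol P) (interior X Q) := by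
  induction P using ValuedForms.induction with
  | zero => simp
  | add a b ha hb => simp only [map_add, LinearMap.add_apply, ha, hb]; abel
  | of p a =>
    induction Q using ValuedForms.induction with
    | zero => simp
    | add a b ha hb => simp only [map_add, ha, hb]; abel
    | of q b =>
      cases p with
      | zero =>
        cases q with
        | zero => simp [wedge_of_cast Φ (Nat.add_zero 0)]
        | succ q =>
          simp [invol_of, wedge_of_cast Φ (Nat.zero_add q), wedge_of_cast Φ (Nat.zero_add (q + 1)),
            curryLeft_wedgeCast_zero_succ Φ (Nat.zero_add (q + 1)) (Nat.zero_add q)]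
      | succ p =>
        cases q with
        | zero =>
          simp [wedge_of_cast Φ (Nat.add_zero p), wedge_of_cast Φ (Nat.add_zero (p + 1)),
            curryLeft_wedgeCast_succ_zero Φ (Nat.add_zero (p + 1)) (Nat.add_zero p)]
        | succ q =>
          have h : p + 1 + (q + 1) = p + 1 + q + 1 := rfl
          have hl : p + (q + 1) = p + 1 + q := by omega
          rw [invol_of, map_smul, LinearMap.smul_apply, wedge_of_cast Φ h, interior_of_succ,
            interior_of_succ, interior_of_succ, curryLeft_wedgeCast_succ_succ Φ h hl rfl,
            wedge_of_cast Φ hl, wedge_of_cast Φ rfl, of_add, ← of_smul,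
            ← Int.cast_smul_eq_zsmul R, Int.cast_pow, Int.cast_neg, Int.cast_one]

end ValuedForms

section Uncurry

variable {R : Type*} [CommRing R] {L : Type*} [AddCommGroup L] [Module R L]
  {N : Type*} [AddCommGroup N] [Module R N]

/-- The form of degree `p + 1` obtained from a linear family of `p`-forms, if it alternates. -/
def alternatingUncurryLeft {p : ℕ} (T : L →ₗ[R] L [⋀^Fin p]→ₗ[R] N)
    (h : ∀ X w, (∃ i, w i = X) → T X w = 0) : L [⋀^Fin (p + 1)]→ₗ[R] N :=
  { LinearMap.uncurryLeft (M := fun _ => L) (AlternatingMap.toMultilinearMapLM ∘ₗ T) with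
    map_eq_zero_of_eq' := fun v i j hv hij => by
      change T (v 0) (Fin.tail v) = 0
      rcases Fin.eq_zero_or_eq_succ i with rfl | ⟨i, rfl⟩
      · rcases Fin.eq_zero_or_eq_succ j with rfl | ⟨j, rfl⟩
        · exact absurd rfl hij
        · exact h _ _ ⟨j, hv.symm⟩
      · rcases Fin.eq_zero_or_eq_succ j with rfl | ⟨j, rfl⟩
        · exact h _ _ ⟨i, hv⟩
        · exact (T (v 0)).map_eq_zero_of_eq _ (i := i) (j := j) hv fun e => hij (by rw [e]) }

theorem curryLeft_alternatingUncurryLeft {p : ℕ} (T : L →ₗ[R] L [⋀^Fin p]→ₗ[R] N)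
    (h : ∀ X w, (∃ i, w i = X) → T X w = 0) (X : L) :
    (alternatingUncurryLeft T h).curryLeft X = T X := by
  ext w
  rfl

theorem map_update_eq_curryLeft {p : ℕ} (P : L [⋀^Fin (p + 1)]→ₗ[R] N)
    (v : Fin (p + 1) → L) (i : Fin (p + 1)) (X : L) :
    P (Function.update v i X) = (-1 : ℤ) ^ (i : ℕ) • P.curryLeft X (i.removeNth v) := by
  rw [← Fin.insertNth_removeNth, P.map_insertNth]
  rfl

theorem map_eq_zero_of_curryLeft_eq_zero {p : ℕ} {P : L [⋀^Fin (p + 1)]→ₗ[R] N} {X : L}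
    (hP : P.curryLeft X = 0) {v : Fin (p + 1) → L} (hv : ∃ i, v i = X) : P v = 0 := by
  obtain ⟨i, rfl⟩ := hv
  rw [← Function.update_eq_self i v, map_update_eq_curryLeft, hP, AlternatingMap.zero_apply,
    smul_zero]

theorem alternatingMap_ext_curryLeft {p : ℕ} {P Q : L [⋀^Fin (p + 1)]→ₗ[R] N}
    (h : ∀ X, P.curryLeft X = Q.curryLeft X) : P = Q := by
  ext v
  rw [← Fin.cons_self_tail v]
  exact DFunLike.congr_fun (h (v 0)) (Fin.tail v)

/-- The exterior product of a section of `A*` with a form. -/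
def covectorWedge {p : ℕ} (α : Module.Dual R L) (P : L [⋀^Fin p]→ₗ[R] N) :
    L [⋀^Fin (p + 1)]→ₗ[R] N :=
  AlternatingMap.alternatizeUncurryFin (α.smulRight P)

theorem covectorWedge_apply {p : ℕ} (α : Module.Dual R L) (P : L [⋀^Fin p]→ₗ[R] N)
    (v : Fin (p + 1) → L) :
    covectorWedge α P v = ∑ i : Fin (p + 1), (-1 : ℤ) ^ (i : ℕ) • α (v i) • P (i.removeNth v) := by
  rw [covectorWedge, AlternatingMap.alternatizeUncurryFin_apply]
  rfl

theorem curryLeft_covectorWedge {p : ℕ} (α : Module.Dual R L) (P : L [⋀^Fin (p + 1)]→ₗ[R] N)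
    (X : L) : (covectorWedge α P).curryLeft X = α X • P - covectorWedge α (P.curryLeft X) := by
  ext w
  rw [AlternatingMap.curryLeft_apply_apply, covectorWedge_apply, Fin.sum_univ_succ,
    AlternatingMap.sub_apply, covectorWedge_apply, sub_eq_add_neg, ← Finset.sum_neg_distrib]
  congr 1
  · simp
  · refine Finset.sum_congr rfl fun i _ => ?_
    rw [Fin.val_succ, pow_succ, mul_neg_one, neg_smul]
    congr 3
    rw [AlternatingMap.curryLeft_apply_apply]
    congr 1
    funext j
    refine Fin.cases ?_ (fun j => ?_) j
    · simp [Fin.removeNth]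
    · simp [Fin.removeNth]

theorem sum_update_update {p : ℕ} (P : L [⋀^Fin p]→ₗ[R] N) (g : L → L) (v : Fin p → L)
    (j : Fin p) (z : L) :
    ∑ i, P (Function.update (Function.update v j z) i (g (Function.update v j z i))) =
      P (Function.update v j (g z)) + ∑ i ∈ Finset.univ.erase j,
        P (Function.update (Function.update v i (g (v i))) j z) := by
  rw [← Finset.add_sum_erase _ _ (Finset.mem_univ j)]
  congr 1
  · simp
  · refine Finset.sum_congr rfl fun i hi => ?_
    have hij := Finset.ne_of_mem_erase hi
    rw [Function.update_of_ne hij, Function.update_comm hij]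

theorem sum_map_update_eq_zero {p : ℕ} (P : L [⋀^Fin p]→ₗ[R] N) (g : L → L) {v : Fin p → L}
    {i j : Fin p} (hv : v i = v j) (hij : i ≠ j) :
    ∑ k, P (Function.update v k (g (v k))) = 0 := by
  rw [Fintype.sum_eq_add i j hij]
  · have h_swap : Function.update v i (g (v i)) ∘ Equiv.swap i j =
        Function.update v j (g (v j)) := by
      funext k
      rcases eq_or_ne k i with rfl | hki
      · simp [hij, hij.symm, hv]
      · rcases eq_or_ne k j with rfl | hkj
        · simp [hv]
        · simp [Equiv.swap_apply_of_ne_of_ne hki hkj, hki, hkj]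
    rw [← h_swap, P.map_swap _ hij, add_neg_cancel]
  · rintro k ⟨hki, hkj⟩
    exact P.map_eq_zero_of_eq _ (i := i) (j := j) (by simp [hki.symm, hkj.symm, hv]) hij

end Uncurry

section LieDerivative

variable {R : Type*} [CommRing R] [Algebra ℝ R] {L : Type*} [AddCommGroup L] [Module R L]

/-- The Lie derivative of a form along a section. -/
def lieForm (S : AnchoredBracket R L) (X : L) {p : ℕ} (P : L [⋀^Fin p]→ₗ[R] R) :
    L [⋀^Fin p]→ₗ[R] R where
  toFun v := S.anchor X (P v) - ∑ i, P (Function.update v i (S.bracket X (v i)))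
  map_update_add' {inst} v j x y := by
    rw [Subsingleton.elim inst (instDecidableEqFin p)]
    simp only [sum_update_update, map_add, P.map_update_add, Finset.sum_add_distrib]
    abel
  map_update_smul' {inst} v j f x := by
    rw [Subsingleton.elim inst (instDecidableEqFin p)]
    simp only [sum_update_update, P.map_update_add, P.map_update_smul, S.leibniz,
      Derivation.leibniz, smul_eq_mul, ← Finset.mul_sum]
    ring
  map_eq_zero_of_eq' v i j hv hij := by
    rw [P.map_eq_zero_of_eq v hv hij, map_zero, sum_map_update_eq_zero P _ hv hij, sub_zero]

theorem lieForm_apply (S : AnchoredBracket R L) (X : L) {p : ℕ} (P : L [⋀^Fin p]→ₗ[R] R)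
    (v : Fin p → L) :
    lieForm S X P v = S.anchor X (P v) - ∑ i, P (Function.update v i (S.bracket X (v i))) := rfl

variable {S : AnchoredBracket R L}

theorem curryLeft_lieForm (X Y : L) {p : ℕ} (P : L [⋀^Fin (p + 1)]→ₗ[R] R) :
    (lieForm S X P).curryLeft Y = lieForm S X (P.curryLeft Y) - P.curryLeft (S.bracket X Y) := by
  ext w
  simp only [AlternatingMap.curryLeft_apply_apply, lieForm_apply, Fin.sum_univ_succ,
    AlternatingMap.sub_apply]
  simp only [Matrix.vecCons, Fin.cons_zero,
    Fin.cons_succ, Fin.update_cons_zero, ← Fin.cons_update]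
  ring

theorem lieForm_add (X : L) {p : ℕ} (P Q : L [⋀^Fin p]→ₗ[R] R) :
    lieForm S X (P + Q) = lieForm S X P + lieForm S X Q := by
  ext v
  simp only [lieForm_apply, AlternatingMap.add_apply, map_add, Finset.sum_add_distrib]
  ring

theorem lieForm_smul (X : L) (f : R) {p : ℕ} (P : L [⋀^Fin p]→ₗ[R] R) :
    lieForm S X (f • P) = f • lieForm S X P + S.anchor X f • P := by
  ext v
  simp only [lieForm_apply, AlternatingMap.smul_apply, AlternatingMap.add_apply, smul_eq_mul,
    Derivation.leibniz, ← Finset.mul_sum]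
  ring

theorem lieForm_add_left (X Y : L) {p : ℕ} (P : L [⋀^Fin p]→ₗ[R] R) :
    lieForm S (X + Y) P = lieForm S X P + lieForm S Y P := by
  ext v
  simp only [lieForm_apply, AlternatingMap.add_apply, map_add, Derivation.add_apply,
    AddMonoidHom.add_apply, P.map_update_add, Finset.sum_add_distrib]
  ring

namespace AnchoredBracket

theorem bracket_skew (hS : ∀ X, S.bracket X X = 0) (X Y : L) : S.bracket Y X = -S.bracket X Y := by
  have h := hS (X + Y)
  simp only [map_add, AddMonoidHom.add_apply, hS, zero_add, add_zero] at h
  exact eq_neg_of_add_eq_zero_left h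

theorem bracket_smul_left (hS : ∀ X, S.bracket X X = 0) (f : R) (X Y : L) :
    S.bracket (f • X) Y = f • S.bracket X Y - S.anchor Y f • X := by
  rw [bracket_skew hS Y, S.leibniz, bracket_skew hS X Y]
  simp only [smul_neg, neg_add, neg_neg, sub_eq_add_neg]

end AnchoredBracket

theorem lieForm_smul_left (hS : ∀ X, S.bracket X X = 0) (f : R) (X : L) {p : ℕ}
    (P : L [⋀^Fin (p + 1)]→ₗ[R] R) :
    lieForm S (f • X) P = f • lieForm S X P + covectorWedge (S.dFun f) (P.curryLeft X) := by
  ext v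
  simp only [lieForm_apply, AlternatingMap.add_apply, AlternatingMap.smul_apply, map_smul,
    Derivation.smul_apply, smul_eq_mul, AnchoredBracket.bracket_smul_left hS, sub_eq_add_neg,
    P.map_update_add, P.map_update_smul, ← neg_smul, Finset.sum_add_distrib, ← Finset.mul_sum,
    covectorWedge_apply, map_update_eq_curryLeft P v _ X]
  rw [mul_add, neg_add, add_assoc, mul_neg]
  congr 2
  rw [← Finset.sum_neg_distrib]
  refine Finset.sum_congr rfl fun i _ => ?_
  simp only [AnchoredBracket.dFun, LinearMap.coe_mk, AddHom.coe_mk, zsmul_eq_mul, Int.cast_pow,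
    Int.cast_neg, Int.cast_one, AlternatingMap.curryLeft_apply_apply]
  ring

/-- The differential on `p`-forms, characterized by `i_X d = L_X - d i_X`. -/
structure DifferentialOn (S : AnchoredBracket R L) (p : ℕ) where
  toFun : (L [⋀^Fin p]→ₗ[R] R) → (L [⋀^Fin (p + 1)]→ₗ[R] R)
  add : ∀ P Q, toFun (P + Q) = toFun P + toFun Q
  smul : ∀ (f : R) P, toFun (f • P) = f • toFun P + covectorWedge (S.dFun f) P
  contract : ∀ X P, (∀ w, (∃ i, w i = X) → P w = 0) →
    (toFun P).curryLeft X = lieForm S X P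

/-- The differential on functions. -/
def DifferentialOn.zero (S : AnchoredBracket R L) : DifferentialOn S 0 where
  toFun P := Forms.oneForm (S.dFun (P 0))
  add P Q := by
    ext v
    simp [AnchoredBracket.dFun]
  smul f P := by
    ext v
    have h : P (Fin.tail v) = P 0 := congrArg P (Subsingleton.elim _ _)
    have h' : P ![] = P 0 := congrArg P (Subsingleton.elim _ _)
    simp [AnchoredBracket.dFun, covectorWedge_apply, h, h', mul_comm]
  contract X P _ := by
    ext v
    rw [lieForm_apply, Subsingleton.elim v 0]
    simp [AnchoredBracket.dFun]

/-- The differential on forms of the next degree. -/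
def DifferentialOn.succ (hS : ∀ X, S.bracket X X = 0) {p : ℕ} (D : DifferentialOn S p) :
    DifferentialOn S (p + 1) where
  toFun P := alternatingUncurryLeft
    { toFun := fun X => lieForm S X P - D.toFun (P.curryLeft X)
      map_add' := fun X Y => by
        rw [map_add, D.add, lieForm_add_left]
        abel
      map_smul' := fun f X => by
        rw [map_smul, D.smul, lieForm_smul_left hS, RingHom.id_apply, smul_sub]
        abel }
    (fun X w hw => by
      refine map_eq_zero_of_curryLeft_eq_zero ?_ hw
      have h_contract := D.contract X (P.curryLeft X) fun u ⟨i, hi⟩ =>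
        P.map_eq_zero_of_eq _ (i := i.succ) (j := 0) (by simpa using hi) (Fin.succ_ne_zero i)
      have h_lie := curryLeft_lieForm (S := S) X X P
      rw [hS, map_zero, sub_zero, ← h_contract] at h_lie
      exact sub_eq_zero_of_eq h_lie)
  add P Q := by
    refine alternatingMap_ext_curryLeft fun X => ?_
    change lieForm S X (P + Q) - D.toFun (P.curryLeft X + Q.curryLeft X) =
      (lieForm S X P - D.toFun (P.curryLeft X)) + (lieForm S X Q - D.toFun (Q.curryLeft X))
    rw [D.add, lieForm_add]
    abel
  smul f P := by
    refine alternatingMap_ext_curryLeft fun X => ?_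
    change lieForm S X (f • P) - D.toFun (f • P.curryLeft X) =
      f • (lieForm S X P - D.toFun (P.curryLeft X)) + (covectorWedge (S.dFun f) P).curryLeft X
    rw [D.smul, lieForm_smul, curryLeft_covectorWedge, smul_sub]
    change _ = _ + (S.anchor X f • P - _)
    abel
  contract X P hP := by
    rw [curryLeft_alternatingUncurryLeft]
    have hPX : P.curryLeft X = 0 := AlternatingMap.ext fun w => hP _ ⟨0, rfl⟩
    have hD : D.toFun 0 = 0 := by simpa using D.add 0 0
    change lieForm S X P - D.toFun (P.curryLeft X) = _
    rw [hPX, hD, sub_zero]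

end LieDerivative

namespace ValuedForms

section Generators

variable {R : Type*} [CommRing R] {L : Type*} [AddCommGroup L] [Module R L]

/-- A function as a form of degree zero. -/
abbrev fn (f : R) : ValuedForms R L R := of (Forms.zeroForm f)

/-- A section of `A*` as a form of degree one. -/
abbrev cov (α : Module.Dual R L) : ValuedForms R L R := of (Forms.oneForm α)

theorem exists_fn {ξ : ValuedForms R L R} (h : IsHom 0 ξ) : ∃ f : R, ξ = fn f := by
  obtain ⟨P, rfl⟩ := h
  refine ⟨P 0, ?_⟩
  congr 1
  ext v
  exact congrArg P (Subsingleton.elim _ _)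

theorem exists_cov {ξ : ValuedForms R L R} (h : IsHom 1 ξ) : ∃ α : Module.Dual R L, ξ = cov α := by
  obtain ⟨P, rfl⟩ := h
  exact ⟨(AlternatingMap.ofSubsingleton R L R (0 : Fin 1)).symm P,
    congrArg of ((AlternatingMap.ofSubsingleton R L R (0 : Fin 1)).apply_symm_apply P).symm⟩

theorem fn_add (f g : R) : fn (f + g) = (fn f + fn g : ValuedForms R L R) := by
  rw [← of_add]; rfl

theorem fn_neg (f : R) : fn (-f) = (-fn f : ValuedForms R L R) := by
  rw [← of_neg]; rfl

theorem fn_sub (f g : R) : fn (f - g) = (fn f - fn g : ValuedForms R L R) := by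
  rw [sub_eq_add_neg, sub_eq_add_neg, fn_add, fn_neg]

theorem cov_add (α β : Module.Dual R L) : cov (α + β) = cov α + cov β := by
  rw [← of_add]; rfl

theorem cov_neg (α : Module.Dual R L) : cov (-α) = -cov α := by
  rw [← of_neg]; rfl

theorem cov_sub (α β : Module.Dual R L) : cov (α - β) = cov α - cov β := by
  rw [sub_eq_add_neg, sub_eq_add_neg, cov_add, cov_neg]

theorem cov_zero : (cov 0 : ValuedForms R L R) = 0 := by
  rw [← sub_self (0 : Module.Dual R L), cov_sub, sub_self]

theorem interior_cov (X : L) (α : Module.Dual R L) : interior X (cov α) = fn (α X) := by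
  rw [interior_of_succ]
  congr 1

/-- The wedge product of scalar forms. -/
abbrev mul : ValuedForms R L R →ₗ[R] ValuedForms R L R →ₗ[R] ValuedForms R L R :=
  wedge (LinearMap.mul R R)

theorem fn_mul [IsAddTorsionFree R] (f : R) (ξ : ValuedForms R L R) : mul (fn f) ξ = f • ξ := by
  induction ξ using ValuedForms.induction with
  | zero => simp
  | add a b ha hb => simp only [map_add, smul_add, ha, hb]
  | of p P =>
    rw [mul, wedge_of_cast _ (Nat.zero_add p), ← of_smul]
    congr 1
    ext v
    rw [wedgeCast_zero_left]
    rfl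

end Generators

section Differential

variable {R : Type*} [CommRing R] [Algebra ℝ R] {L : Type*} [AddCommGroup L] [Module R L]

theorem real_smul_alternatingMap {p : ℕ} (c : ℝ) (P : L [⋀^Fin p]→ₗ[R] R) :
    c • P = algebraMap ℝ R c • P := by
  ext v
  simp [Algebra.smul_def]

theorem real_smul_eq (c : ℝ) (ξ : ValuedForms R L R) : c • ξ = algebraMap ℝ R c • ξ := by
  induction ξ using ValuedForms.induction with
  | zero => simp
  | add a b ha hb => simp only [smul_add, ha, hb]
  | of p P =>
    rw [← of_smul]
    refine (map_smul (DirectSum.lof ℝ ℕ (fun p => L [⋀^Fin p]→ₗ[R] R) p) c P).symm.trans ?_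
    exact congrArg of (real_smul_alternatingMap c P)

theorem real_neg_one_pow_smul (k : ℕ) (ξ : ValuedForms R L R) :
    (-1 : ℝ) ^ k • ξ = (-1 : R) ^ k • ξ := by
  rw [real_smul_eq, map_pow, map_neg, map_one]

/-- The Lie derivative of forms. -/
def lie (S : AnchoredBracket R L) (X : L) : ValuedForms R L R →ₗ[ℝ] ValuedForms R L R :=
  DirectSum.toModule ℝ ℕ _ fun p =>
    { toFun := fun P => of (lieForm S X P)
      map_add' := fun P Q => by rw [lieForm_add, of_add]
      map_smul' := fun c P => by
        rw [RingHom.id_apply, real_smul_eq, ← of_smul, real_smul_alternatingMap, lieForm_smul,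
          Derivation.map_algebraMap, zero_smul, add_zero] }

variable {S : AnchoredBracket R L}

theorem lie_of (X : L) {p : ℕ} (P : L [⋀^Fin p]→ₗ[R] R) :
    lie S X (of P) = of (lieForm S X P) := by
  rw [lie, of_eq_lof]
  exact DirectSum.toModule_lof (M := fun p => L [⋀^Fin p]→ₗ[R] R) ℝ p P

theorem interior_lie (X Y : L) (ξ : ValuedForms R L R) :
    interior Y (lie S X ξ) = lie S X (interior Y ξ) - interior (S.bracket X Y) ξ := by
  induction ξ using ValuedForms.induction with
  | zero => simp
  | add a b ha hb => simp only [map_add, ha, hb]; abel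
  | of p P =>
    rw [lie_of]
    cases p with
    | zero => simp
    | succ p =>
      rw [interior_of_succ, interior_of_succ, interior_of_succ, lie_of, curryLeft_lieForm,
        sub_eq_add_neg, of_add, of_neg, sub_eq_add_neg]

theorem lie_fn (X : L) (f : R) : lie S X (fn f) = fn (S.anchor X f) := by
  rw [lie_of]
  congr 1
  ext v
  simp [lieForm_apply]

theorem IsHom.lie {p : ℕ} {ξ : ValuedForms R L R} (h : IsHom p ξ) (X : L) :
    IsHom p (lie S X ξ) := by
  obtain ⟨P, rfl⟩ := h
  exact ⟨_, lie_of X P⟩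

theorem invol_lie (X : L) (ξ : ValuedForms R L R) : lie S X (invol ξ) = invol (lie S X ξ) := by
  induction ξ using ValuedForms.induction with
  | zero => simp
  | add a b ha hb => simp only [map_add, ha, hb]
  | of p P =>
    rw [((isHom_of P).lie X).invol_eq, invol_of, ← real_neg_one_pow_smul, map_smul,
      real_neg_one_pow_smul]

theorem lie_fn_mul_fn (X : L) (f g : R) :
    lie S X (mul (fn f) (fn g)) = mul (lie S X (fn f)) (fn g) + mul (fn f) (lie S X (fn g)) := by
  rw [lie_fn, lie_fn, fn_mul, fn_mul, fn_mul, ← of_smul, ← of_smul, ← of_smul, lie_of, ← of_add]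
  congr 1
  ext v
  simp [lieForm_apply, mul_comm, add_comm]

theorem IsHom.lie_mul (X : L) {p q : ℕ} {P Q : ValuedForms R L R} (hP : IsHom p P)
    (hQ : IsHom q Q) :
    ValuedForms.lie S X (mul P Q) =
      mul (ValuedForms.lie S X P) Q + mul P (ValuedForms.lie S X Q) := by
  refine interior_induction₂ (motive := fun _ _ P Q => ValuedForms.lie S X (mul P Q) =
    mul (ValuedForms.lie S X P) Q + mul P (ValuedForms.lie S X Q)) ?_ ?_ ?_ hP hQ
  · simp
  · simp
  intro p q P Q hP hQ ih_left ih_right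
  refine ext_interior ?_ fun Y => ?_
  · rcases Nat.eq_zero_or_pos (p + q) with h | h
    · obtain ⟨rfl, rfl⟩ : p = 0 ∧ q = 0 := by omega
      obtain ⟨f, rfl⟩ := exists_fn hP
      obtain ⟨g, rfl⟩ := exists_fn hQ
      rw [lie_fn_mul_fn]
    · rw [((hP.wedge _ hQ).lie X).apply_ne h.ne,
        (((hP.lie X).wedge _ hQ).add (hP.wedge _ (hQ.lie X))).apply_ne h.ne]
  · simp only [map_sub, map_add, interior_lie, interior_wedge, LinearMap.sub_apply, invol_lie,
      ih_left Y Q hQ, ih_right Y _ hP.invol]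
    abel

theorem lie_mul (X : L) (P Q : ValuedForms R L R) :
    lie S X (mul P Q) = mul (lie S X P) Q + mul P (lie S X Q) := by
  induction P, Q using induction₂ with
  | isHom p q P Q hP hQ => exact hP.lie_mul X hQ
  | add_left P P' Q h h' => simp only [map_add, LinearMap.add_apply, h, h']; abel
  | add_right P Q Q' h h' => simp only [map_add, h, h']; abel

/-- The differential on forms of degree `p` of an anchored bracket. -/
def differentialOn (hS : ∀ X, S.bracket X X = 0) : ∀ p, DifferentialOn S p
  | 0 => DifferentialOn.zero S
  | p + 1 => DifferentialOn.succ hS (differentialOn hS p)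

/-- The differential of an anchored bracket. -/
def diff (hS : ∀ X, S.bracket X X = 0) : ValuedForms R L R →ₗ[ℝ] ValuedForms R L R :=
  DirectSum.toModule ℝ ℕ _ fun p =>
    { toFun := fun P => of ((differentialOn hS p).toFun P)
      map_add' := fun P Q => by rw [(differentialOn hS p).add, of_add]
      map_smul' := fun c P => by
        rw [RingHom.id_apply, real_smul_eq, ← of_smul]
        have h' : S.dFun (algebraMap ℝ R c) = 0 := by
          ext X
          exact (S.anchor X).map_algebraMap c
        rw [real_smul_alternatingMap, (differentialOn hS p).smul, h']
        congr 1
        ext v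
        simp [covectorWedge_apply] }

variable (hS : ∀ X, S.bracket X X = 0)

theorem diff_of {p : ℕ} (P : L [⋀^Fin p]→ₗ[R] R) :
    diff hS (of P) = of ((differentialOn hS p).toFun P) := by
  rw [diff, of_eq_lof]
  exact DirectSum.toModule_lof (M := fun p => L [⋀^Fin p]→ₗ[R] R) ℝ p P

theorem interior_diff (X : L) (ξ : ValuedForms R L R) :
    interior X (diff hS ξ) = lie S X ξ - diff hS (interior X ξ) := by
  induction ξ using ValuedForms.induction with
  | zero => simp
  | add a b ha hb => simp only [map_add, ha, hb]; abel
  | of p P =>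
    rw [diff_of, interior_of_succ, lie_of]
    cases p with
    | zero =>
      rw [interior_of_zero, map_zero, sub_zero]
      congr 1
      exact (differentialOn hS 0).contract X P fun w ⟨i, _⟩ => i.elim0
    | succ p =>
      rw [interior_of_succ, diff_of, sub_eq_add_neg, ← of_neg, ← of_add, ← sub_eq_add_neg]
      congr 1

theorem diff_fn (f : R) : diff hS (fn f) = cov (S.dFun f) := by
  rw [diff_of]
  congr 1

theorem IsHom.diff {p : ℕ} {ξ : ValuedForms R L R} (h : IsHom p ξ) :
    IsHom (p + 1) (diff hS ξ) := by
  obtain ⟨P, rfl⟩ := h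
  exact ⟨_, diff_of hS P⟩

theorem invol_diff (ξ : ValuedForms R L R) : diff hS (invol ξ) = -invol (diff hS ξ) := by
  induction ξ using ValuedForms.induction with
  | zero => simp
  | add a b ha hb => simp only [map_add, ha, hb]; abel
  | of p P =>
    rw [((isHom_of P).diff hS).invol_eq, invol_of, ← real_neg_one_pow_smul, map_smul,
      real_neg_one_pow_smul, pow_succ, mul_neg_one]
    exact (neg_eq_iff_eq_neg.mp (neg_smul ((-1 : R) ^ p) (diff hS (of P))).symm)

theorem IsHom.diff_mul {p q : ℕ} {P Q : ValuedForms R L R} (hP : IsHom p P) (hQ : IsHom q Q) :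
    ValuedForms.diff hS (mul P Q) =
      mul (ValuedForms.diff hS P) Q + mul (ValuedForms.invol P) (ValuedForms.diff hS Q) := by
  refine interior_induction₂ (motive := fun _ _ P Q => ValuedForms.diff hS (mul P Q) =
    mul (ValuedForms.diff hS P) Q + mul (ValuedForms.invol P) (ValuedForms.diff hS Q))
    ?_ ?_ ?_ hP hQ
  · simp
  · simp
  intro p q P Q hP hQ ih_left ih_right
  refine ext_interior ?_ fun Y => ?_
  · rw [DirectSum.add_apply, ((hP.wedge _ hQ).diff hS).apply_ne (by omega),
      ((hP.diff hS).wedge _ hQ).apply_ne (by omega),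
      (hP.invol.wedge _ (hQ.diff hS)).apply_ne (by omega), add_zero]
  · simp only [map_sub, map_add, map_neg, interior_diff, interior_wedge, LinearMap.sub_apply,
      LinearMap.neg_apply, ValuedForms.lie_mul, invol_diff, interior_invol, invol_invol,
      ih_left Y Q hQ, ih_right Y _ hP.invol]
    abel

theorem diff_mul (P Q : ValuedForms R L R) :
    diff hS (mul P Q) = mul (diff hS P) Q + mul (invol P) (diff hS Q) := by
  induction P, Q using induction₂ with
  | isHom p q P Q hP hQ => exact hP.diff_mul hS hQ
  | add_left P P' Q h h' => simp only [map_add, LinearMap.add_apply, h, h']; abel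
  | add_right P Q Q' h h' => simp only [map_add, h, h']; abel

end Differential

section Pairing

variable {R : Type*} [CommRing R] {L : Type*} [AddCommGroup L] [Module R L]

/-- A scalar form of degree `p + 1` as a form of degree `p` with values in `Γ(A*)`. -/
def dualizeForm {p : ℕ} (P : L [⋀^Fin (p + 1)]→ₗ[R] R) : L [⋀^Fin p]→ₗ[R] Module.Dual R L where
  toFun v :=
    { toFun := fun Y => P.curryLeft Y v
      map_add' := fun Y Z => by rw [map_add]; rfl
      map_smul' := fun f Y => by rw [map_smul]; rfl }
  map_update_add' v i x y := by
    ext Y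
    exact (P.curryLeft Y).map_update_add v i x y
  map_update_smul' v i f x := by
    ext Y
    exact (P.curryLeft Y).map_update_smul v i f x
  map_eq_zero_of_eq' v i j hv hij := by
    ext Y
    exact (P.curryLeft Y).map_eq_zero_of_eq v hv hij

/-- The linear map underlying `dualizeForm`. -/
def dualizeHom : ∀ p : ℕ, (L [⋀^Fin p]→ₗ[R] R) →ₗ[R] ValuedForms R L (Module.Dual R L)
  | 0 => 0
  | p + 1 => DirectSum.lof R ℕ (fun p => L [⋀^Fin p]→ₗ[R] Module.Dual R L) p ∘ₗ
      { toFun := dualizeForm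
        map_add' := fun _ _ => rfl
        map_smul' := fun _ _ => rfl }

/-- Scalar forms as forms with values in `Γ(A*)`. -/
def dualize : ValuedForms R L R →ₗ[R] ValuedForms R L (Module.Dual R L) :=
  DirectSum.toModule R ℕ _ dualizeHom

@[simp]
theorem dualize_of_zero (P : L [⋀^Fin 0]→ₗ[R] R) : dualize (of P) = 0 := by
  rw [dualize, of_eq_lof, DirectSum.toModule_lof]
  rfl

@[simp]
theorem dualize_of_succ {p : ℕ} (P : L [⋀^Fin (p + 1)]→ₗ[R] R) :
    dualize (of P) = of (dualizeForm P) := by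
  rw [dualize, of_eq_lof, DirectSum.toModule_lof]
  rfl

theorem interior_dualize (X : L) (ξ : ValuedForms R L R) :
    interior X (dualize ξ) = -dualize (interior X ξ) := by
  induction ξ using ValuedForms.induction with
  | zero => simp
  | add a b ha hb => simp only [map_add, ha, hb]; abel
  | of p P =>
    match p with
    | 0 => simp
    | 1 => simp
    | p + 2 =>
      rw [dualize_of_succ, interior_of_succ, interior_of_succ, dualize_of_succ, ← of_neg]
      congr 1
      ext w Y
      have h := P.map_swap (Fin.cons X (Fin.cons Y w : Fin (p + 1) → L) : Fin (p + 2) → L)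
        (Fin.zero_ne_one)
      refine Eq.trans (congrArg P ?_) h
      funext i
      refine Fin.cases ?_ (fun i => ?_) i
      · simp
      · refine Fin.cases ?_ (fun i => ?_) i
        · simp
        · have h2 : Equiv.swap (0 : Fin (p + 2)) 1 i.succ.succ = i.succ.succ :=
            Equiv.swap_apply_of_ne_of_ne (Fin.succ_ne_zero _)
              (fun h => Fin.succ_ne_zero i (Fin.succ_injective _ h))
          simp [h2]

theorem invol_dualize (ξ : ValuedForms R L R) : invol (dualize ξ) = -dualize (invol ξ) := by
  induction ξ using ValuedForms.induction with
  | zero => simp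
  | add a b ha hb => simp only [map_add, ha, hb]; abel
  | of p P =>
    cases p with
    | zero => simp [invol_of]
    | succ p =>
      rw [dualize_of_succ, invol_of, invol_of, map_smul, dualize_of_succ, pow_succ, mul_neg_one]
      exact (neg_eq_iff_eq_neg.mp (neg_smul ((-1 : R) ^ p) (of (dualizeForm P))).symm)

variable (π : Bivector R L)

/-- The pairing of sections of `A*` defined by a bivector. -/
def bivectorForm : Module.Dual R L →ₗ[R] Module.Dual R L →ₗ[R] R := LinearMap.applyₗ ∘ₗ π.sharp

theorem _root_.Bivector.skew (α β : Module.Dual R L) : β (π.sharp α) = -α (π.sharp β) := by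
  have h := π.alt (α + β)
  simp only [map_add, LinearMap.add_apply, π.alt, zero_add, add_zero] at h
  exact eq_neg_of_add_eq_zero_left h

/-- The contraction of two forms by a bivector. -/
def pair : ValuedForms R L R →ₗ[R] ValuedForms R L R →ₗ[R] ValuedForms R L R :=
  (wedge (bivectorForm π)).compl₁₂ dualize dualize

theorem pair_apply (P Q : ValuedForms R L R) :
    pair π P Q = wedge (bivectorForm π) (dualize P) (dualize Q) := rfl

theorem IsHom.dualize {p : ℕ} {ξ : ValuedForms R L R} (h : IsHom p ξ) :
    IsHom (p - 1) (dualize ξ) := by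
  obtain ⟨P, rfl⟩ := h
  cases p with
  | zero => simpa using isHom_zero 0
  | succ p => exact ⟨_, dualize_of_succ P⟩

theorem IsHom.pair {p q : ℕ} {P Q : ValuedForms R L R} (hP : IsHom p P) (hQ : IsHom q Q) :
    IsHom (p - 1 + (q - 1)) (pair π P Q) := by
  rw [pair_apply]
  exact hP.dualize.wedge (bivectorForm π) hQ.dualize

theorem pair_zero_left {P : ValuedForms R L R} (hP : IsHom 0 P) (Q : ValuedForms R L R) :
    pair π P Q = 0 := by
  obtain ⟨P, rfl⟩ := hP
  simp [pair_apply]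

theorem pair_zero_right (P : ValuedForms R L R) {Q : ValuedForms R L R} (hQ : IsHom 0 Q) :
    pair π P Q = 0 := by
  obtain ⟨Q, rfl⟩ := hQ
  simp [pair_apply]

theorem invol_pair (P Q : ValuedForms R L R) : invol (pair π P Q) = pair π (invol P) (invol Q) := by
  rw [pair_apply, invol_wedge, invol_dualize, invol_dualize, pair_apply]
  simp only [map_neg, LinearMap.neg_apply, neg_neg]

theorem IsHom.invol_pow_eq {p : ℕ} {ξ : ValuedForms R L R} (h : IsHom p ξ) (k : ℕ) :
    (ValuedForms.invol ^ k : Module.End R (ValuedForms R L R)) ξ = (-1 : R) ^ (k * p) • ξ := by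
  induction k with
  | zero => simp
  | succ k ih =>
    rw [pow_succ, Module.End.mul_apply, h.invol_eq, map_smul, ih, smul_smul, ← pow_add]
    congr 2
    ring

theorem IsHom.invol_pow {p : ℕ} {ξ : ValuedForms R L R} (h : IsHom p ξ) (k : ℕ) :
    IsHom p ((ValuedForms.invol ^ k : Module.End R (ValuedForms R L R)) ξ) := by
  induction k with
  | zero => exact h
  | succ k ih => rw [pow_succ', Module.End.mul_apply]; exact ih.invol

theorem interior_invol_pow (k : ℕ) (X : L) (ξ : ValuedForms R L R) :
    interior X ((invol ^ k : Module.End R (ValuedForms R L R)) ξ) =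
      (-1 : R) ^ k • (invol ^ k : Module.End R (ValuedForms R L R)) (interior X ξ) := by
  induction k generalizing ξ with
  | zero => simp
  | succ k ih =>
    simp only [pow_succ, Module.End.mul_apply, ih, interior_invol, map_neg, mul_neg_one,
      smul_neg, neg_smul_form]

theorem invol_pow_fn (k : ℕ) (f : R) :
    (invol ^ k : Module.End R (ValuedForms R L R)) (fn f) = fn f := by
  rw [(isHom_of (Forms.zeroForm f)).invol_pow_eq, mul_zero, pow_zero, one_smul]

end Pairing

section Contractions

variable {R : Type*} [CommRing R] [IsAddTorsionFree R] {L : Type*} [AddCommGroup L] [Module R L]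

theorem interior_pair (π : Bivector R L) (X : L) (P Q : ValuedForms R L R) :
    interior X (pair π P Q) = pair π (invol P) (interior X Q) - pair π (interior X P) Q := by
  simp only [pair_apply, interior_wedge, interior_dualize, invol_dualize, map_neg,
    LinearMap.neg_apply, neg_neg]
  abel

theorem pair_cov_cov (π : Bivector R L) (α β : Module.Dual R L) :
    pair π (cov α) (cov β) = fn (β (π.sharp α)) := by
  rw [pair_apply, dualize_of_succ, dualize_of_succ, wedge_of_cast _ (Nat.zero_add 0)]
  congr 1
  ext v
  rw [wedgeCast_zero_left]
  have h : ∀ (γ : Module.Dual R L) (u : Fin 0 → L), dualizeForm (Forms.oneForm γ) u = γ :=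
    fun γ u => LinearMap.ext fun Y => rfl
  rw [h, h]
  rfl

theorem pair_skew_apply_zero (π : Bivector R L) {p q : ℕ} {P Q : ValuedForms R L R}
    (hP : IsHom p P) (hQ : IsHom q Q) :
    pair π Q P 0 = (-((-1 : R) ^ ((p + 1) * (q + 1)) • pair π P Q)) 0 := by
  rcases Nat.eq_zero_or_pos p with rfl | hp
  · simp only [pair_zero_left π hP, pair_zero_right π _ hP, smul_zero, neg_zero]
  rcases Nat.eq_zero_or_pos q with rfl | hq
  · simp only [pair_zero_left π hQ, pair_zero_right π _ hQ, smul_zero, neg_zero]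
  by_cases h : p = 1 ∧ q = 1
  · obtain ⟨rfl, rfl⟩ := h
    obtain ⟨α, rfl⟩ := exists_cov hP
    obtain ⟨β, rfl⟩ := exists_cov hQ
    have fn_eq_neg : (fn (α (π.sharp β)) : ValuedForms R L R) = -fn (β (π.sharp α)) := by
      rw [← of_neg]
      exact congrArg of (by ext v; simp [π.skew β α])
    rw [pair_cov_cov, pair_cov_cov, Even.neg_one_pow ⟨2, rfl⟩, one_smul, fn_eq_neg]
  · rw [(hQ.pair π hP).apply_ne (by omega), ((hP.pair π hQ).smul _).neg.apply_ne (by omega)]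

theorem pair_skew (π : Bivector R L) {p q : ℕ} {P Q : ValuedForms R L R} (hP : IsHom p P)
    (hQ : IsHom q Q) : pair π Q P = -((-1 : R) ^ ((p + 1) * (q + 1)) • pair π P Q) := by
  refine IsHom.interior_induction₂ (motive := fun p q P Q =>
    pair π Q P = -((-1 : R) ^ ((p + 1) * (q + 1)) • pair π P Q)) ?_ ?_ ?_ hP hQ
  · simp
  · simp
  intro p q P Q hP hQ ih_left ih_right
  refine ext_interior (pair_skew_apply_zero π hP hQ) fun X => ?_
  rw [map_neg, map_smul, interior_pair, interior_pair, hP.invol_eq, hQ.invol_eq]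
  simp only [map_smul, LinearMap.smul_apply, ih_left X Q hQ, ih_right X P hP]
  cases p with
  | zero =>
    rw [hP.interior_eq_zero]
    cases q with
    | zero => rw [hQ.interior_eq_zero]; simp
    | succ q => rcases Nat.even_or_odd q with hq | hq <;> simp [hq.neg_one_pow, pow_succ]
  | succ p =>
    cases q with
    | zero =>
      rw [hQ.interior_eq_zero]
      rcases Nat.even_or_odd p with hp | hp <;> simp [hp.neg_one_pow, pow_succ]
    | succ q =>
      simp only [Nat.add_sub_cancel]
      rcases Nat.even_or_odd p with hp | hp <;> rcases Nat.even_or_odd q with hq | hq <;>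
        simp [hp.neg_one_pow, hq.neg_one_pow, pow_succ, pow_mul, pow_add, mul_add, add_mul]
      abel

theorem fn_mul_right (ξ : ValuedForms R L R) (f : R) : mul ξ (fn f) = f • ξ := by
  induction ξ using ValuedForms.induction with
  | zero => simp
  | add a b ha hb => simp only [map_add, LinearMap.add_apply, smul_add, ha, hb]
  | of p P =>
    induction p with
    | zero =>
      obtain ⟨g, hg⟩ := exists_fn (isHom_of P)
      rw [hg, fn_mul, ← of_smul, ← of_smul]
      congr 1
      ext v
      simp [mul_comm]
    | succ p ih =>
      refine ext_interior ?_ fun X => ?_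
      · have h1 := (isHom_of P).wedge (LinearMap.mul R R) (isHom_of (Forms.zeroForm f))
        rw [h1.apply_ne (by omega), ((isHom_of P).smul f).apply_ne (by omega)]
      · rw [interior_wedge, interior_of_zero, map_zero, add_zero, interior_of_succ, map_smul,
          interior_of_succ]
        exact ih _

theorem pair_mul_apply_zero (π : Bivector R L) {p q t : ℕ} {P Q T : ValuedForms R L R}
    (hP : IsHom p P) (hQ : IsHom q Q) (hT : IsHom t T) :
    pair π P (mul Q T) 0 = (mul (pair π P Q) T +
      mul ((invol ^ p : Module.End R (ValuedForms R L R)) Q) (pair π P T)) 0 := by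
  rcases Nat.eq_zero_or_pos p with rfl | _
  · simp only [pair_zero_left π hP, map_zero, LinearMap.zero_apply, add_zero]
  rcases Nat.eq_zero_or_pos q with rfl | hq
  · obtain ⟨f, rfl⟩ := exists_fn hQ
    simp only [fn_mul, invol_pow_fn, map_smul, pair_zero_right π _ hQ, map_zero,
      LinearMap.zero_apply, zero_add]
  rcases Nat.eq_zero_or_pos t with rfl | ht
  · obtain ⟨f, rfl⟩ := exists_fn hT
    simp only [fn_mul_right, map_smul, pair_zero_right π _ hT, map_zero, add_zero]
  rw [DirectSum.add_apply, (hP.pair π (hQ.wedge _ hT)).apply_ne (by omega),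
    ((hP.pair π hQ).wedge _ hT).apply_ne (by omega),
    ((hQ.invol_pow p).wedge _ (hP.pair π hT)).apply_ne (by omega), add_zero]

theorem IsHom.pair_mul (π : Bivector R L) {p q t : ℕ} {P Q T : ValuedForms R L R}
    (hP : IsHom p P) (hQ : IsHom q Q) (hT : IsHom t T) :
    ValuedForms.pair π P (mul Q T) = mul (ValuedForms.pair π P Q) T +
      mul ((ValuedForms.invol ^ p : Module.End R (ValuedForms R L R)) Q)
        (ValuedForms.pair π P T) := by
  refine interior_induction₃ (motive := fun p P Q T => ValuedForms.pair π P (mul Q T) =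
    mul (ValuedForms.pair π P Q) T +
      mul ((ValuedForms.invol ^ p : Module.End R (ValuedForms R L R)) Q)
        (ValuedForms.pair π P T)) ?_ ?_ ?_ ?_ hP hQ hT
  · simp
  · simp
  · simp
  intro p q t P Q T hP hQ hT ih_left ih_mid ih_right
  refine ext_interior (pair_mul_apply_zero π hP hQ hT) fun X => ?_
  simp only [map_add, map_sub, interior_pair, interior_wedge, interior_invol_pow, invol_pair,
    hP.invol_eq, map_smul, LinearMap.smul_apply, LinearMap.sub_apply, ih_mid X P T hP hT,
    ih_right X P _ hP hQ.invol]
  cases p with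
  | zero =>
    simp only [hP.interior_eq_zero, pow_zero, one_smul, Module.End.one_apply, map_zero,
      LinearMap.zero_apply, sub_zero]
    abel
  | succ p =>
    have invol_invol_pow : ValuedForms.invol ((ValuedForms.invol ^ (p + 1) :
        Module.End R (ValuedForms R L R)) Q) =
        (ValuedForms.invol ^ p : Module.End R (ValuedForms R L R)) Q := by
      rw [pow_succ', Module.End.mul_apply, invol_invol]
    have invol_pow_invol : (ValuedForms.invol ^ (p + 1) : Module.End R (ValuedForms R L R))
        (ValuedForms.invol Q) =
        (ValuedForms.invol ^ p : Module.End R (ValuedForms R L R)) Q := by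
      rw [pow_succ, Module.End.mul_apply, invol_invol]
    rw [ih_left X Q T hQ hT, Nat.add_sub_cancel, invol_invol_pow, invol_pow_invol]
    simp only [smul_add]
    abel

theorem pair_mul (π : Bivector R L) {p : ℕ} {P : ValuedForms R L R} (hP : IsHom p P)
    (Q T : ValuedForms R L R) :
    pair π P (mul Q T) = mul (pair π P Q) T +
      mul ((invol ^ p : Module.End R (ValuedForms R L R)) Q) (pair π P T) := by
  induction Q, T using induction₂ with
  | isHom q t Q T hQ hT => exact hP.pair_mul π hQ hT
  | add_left Q Q' T h h' => simp only [map_add, LinearMap.add_apply, h, h']; abel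
  | add_right Q T T' h h' => simp only [map_add, h, h']; abel

end Contractions

end ValuedForms

section Framed

variable {R : Type*} [CommRing R] {L : Type*} [AddCommGroup L] [Module R L]

/-- A function `χ` such that `χ X` is a combination of finitely many sections, with coefficients
depending linearly on `X`: for sections of a bundle, a function supported in the domain of a
frame. -/
def IsFraming (L : Type*) [AddCommGroup L] [Module R L] (χ : R) : Prop :=
  ∃ (n : ℕ) (e : Fin n → L) (ε : Fin n → Module.Dual R L), ∀ X : L, χ • X = ∑ i, ε i X • e i

/-- The module of sections of a bundle with local frames, seen through cutoff functions: a function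
or a section annihilated by all framings is zero. -/
structure LocallyFramed (R : Type*) [CommRing R] (L : Type*) [AddCommGroup L] [Module R L] :
    Prop where
  eq_zero : ∀ a : R, (∀ χ : R, IsFraming L χ → χ * a = 0) → a = 0
  section_eq_zero : ∀ X : L, (∀ χ : R, IsFraming L χ → χ • X = 0) → X = 0

theorem LocallyFramed.eq_zero_of_forall_dual (hL : LocallyFramed R L) (X : L)
    (hX : ∀ α : Module.Dual R L, α X = 0) : X = 0 := by
  refine hL.section_eq_zero X fun χ ⟨n, e, ε, hχ⟩ => ?_
  simp only [hχ, hX, zero_smul, Finset.sum_const_zero]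

end Framed

namespace ValuedForms

section GradedDerivation

variable {R : Type*} [CommRing R] {L : Type*} [AddCommGroup L] [Module R L]

theorem map_neg_one_pow_smul {D : ValuedForms R L R → ValuedForms R L R}
    (hD : ∀ P Q, D (P + Q) = D P + D Q) (k : ℕ) (ξ : ValuedForms R L R) :
    D ((-1 : R) ^ k • ξ) = (-1 : R) ^ k • D ξ := by
  have map_neg : D (-ξ) = -D ξ := (AddMonoidHom.mk' D hD).map_neg ξ
  rcases Nat.even_or_odd k with hk | hk
  · simp only [hk.neg_one_pow, one_smul]
  · simpa [hk.neg_one_pow] using map_neg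

/-- A graded derivation of the algebra of forms. Only the parity of its degree `k` enters. -/
structure IsGradedDerivation (k : ℕ) (D : ValuedForms R L R → ValuedForms R L R) : Prop where
  map_add : ∀ P Q, D (P + Q) = D P + D Q
  map_mul : ∀ P Q, D (mul P Q) =
    mul (D P) Q + mul ((invol ^ k : Module.End R (ValuedForms R L R)) P) (D Q)
  map_invol : ∀ P, D (invol P) = (-1 : R) ^ k • invol (D P)

theorem invol_pow_even {k : ℕ} (hk : Even k) :
    (invol ^ k : Module.End R (ValuedForms R L R)) = 1 := by
  obtain ⟨c, rfl⟩ := hk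
  have invol_mul_invol : (invol : Module.End R (ValuedForms R L R)) * invol = 1 :=
    LinearMap.ext invol_invol
  rw [← two_mul, pow_mul, pow_two, invol_mul_invol, one_pow]

theorem invol_pow_odd {k : ℕ} (hk : Odd k) :
    (invol ^ k : Module.End R (ValuedForms R L R)) = invol := by
  obtain ⟨c, rfl⟩ := hk
  rw [pow_succ, invol_pow_even (even_two_mul c), one_mul]

theorem invol_pow_congr {k l : ℕ} (hkl : Even k ↔ Even l) :
    (invol ^ k : Module.End R (ValuedForms R L R)) = invol ^ l := by
  rcases Nat.even_or_odd k with hk | hk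
  · rw [invol_pow_even hk, invol_pow_even (hkl.mp hk)]
  · rw [invol_pow_odd hk, invol_pow_odd (by
      rw [← Nat.not_even_iff_odd] at hk ⊢
      exact fun hl => hk (hkl.mpr hl))]

namespace IsGradedDerivation

variable {k l : ℕ} {D D' : ValuedForms R L R → ValuedForms R L R}

theorem map_zero (h : IsGradedDerivation k D) : D 0 = 0 := by simpa using h.map_add 0 0

theorem map_neg (h : IsGradedDerivation k D) (P : ValuedForms R L R) : D (-P) = -D P :=
  (AddMonoidHom.mk' D h.map_add).map_neg P

theorem congr_parity (h : IsGradedDerivation k D) (hkl : Even (k + l)) :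
    IsGradedDerivation l D where
  map_add := h.map_add
  map_mul P Q := by rw [h.map_mul, invol_pow_congr (Nat.even_add.mp hkl)]
  map_invol P := by rw [h.map_invol, neg_one_pow_congr (Nat.even_add.mp hkl)]

theorem add (h : IsGradedDerivation k D) (h' : IsGradedDerivation k D') :
    IsGradedDerivation k fun P => D P + D' P where
  map_add P Q := by rw [h.map_add, h'.map_add]; abel
  map_mul P Q := by
    rw [h.map_mul, h'.map_mul]
    simp only [_root_.map_add, LinearMap.add_apply]
    abel
  map_invol P := by rw [h.map_invol, h'.map_invol, _root_.map_add, smul_add]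

theorem neg (h : IsGradedDerivation k D) : IsGradedDerivation k fun P => -D P where
  map_add P Q := by rw [h.map_add]; abel
  map_mul P Q := by
    rw [h.map_mul]
    simp only [_root_.map_neg, LinearMap.neg_apply]
    abel
  map_invol P := by rw [h.map_invol, _root_.map_neg, smul_neg]

theorem sub (h : IsGradedDerivation k D) (h' : IsGradedDerivation k D') :
    IsGradedDerivation k fun P => D P - D' P := by
  simpa only [sub_eq_add_neg] using h.add h'.neg

theorem commutator (h : IsGradedDerivation k D) (h' : IsGradedDerivation l D') :
    IsGradedDerivation (k + l) fun P => D (D' P) - (-1 : R) ^ (k * l) • D' (D P) where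
  map_add P Q := by
    rw [h.map_add, h'.map_add, h.map_add, h'.map_add, smul_add]
    abel
  map_mul P Q := by
    rcases Nat.even_or_odd k with hk | hk <;> rcases Nat.even_or_odd l with hl | hl <;>
      simp [h.map_mul, h'.map_mul, h.map_add, h'.map_add, invol_pow_even, invol_pow_odd, hk, hl,
        h.map_invol, h'.map_invol, pow_add, pow_mul, hk.neg_one_pow, hl.neg_one_pow] <;>
      abel
  map_invol P := by
    rw [h'.map_invol, map_neg_one_pow_smul h.map_add, h.map_invol, h.map_invol,
      map_neg_one_pow_smul h'.map_add, h'.map_invol]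
    simp only [map_sub, map_smul, smul_sub, smul_smul]
    congr 2 <;> ring

theorem sq (h : IsGradedDerivation 1 D) : IsGradedDerivation 2 fun P => D (D P) where
  map_add P Q := by rw [h.map_add, h.map_add]
  map_mul P Q := by
    simp only [h.map_mul, h.map_add, pow_one, h.map_invol, pow_two, Module.End.mul_apply,
      invol_invol, map_smul, LinearMap.smul_apply, neg_smul, one_smul]
    abel
  map_invol P := by
    rw [h.map_invol, map_neg_one_pow_smul h.map_add, h.map_invol, smul_smul, ← pow_add]

end IsGradedDerivation

end GradedDerivation

section Framing

variable {R : Type*} [CommRing R] {L : Type*} [AddCommGroup L] [Module R L]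

theorem sum_smul_interior {n : ℕ} {χ : R} {e : Fin n → L} {ε : Fin n → Module.Dual R L}
    (hχ : ∀ X : L, χ • X = ∑ i, ε i X • e i) (X : L) (P : ValuedForms R L R) :
    ∑ i, ε i X • interior (e i) P = χ • interior X P := by
  let interiorₗ : L →ₗ[R] ValuedForms R L R :=
    { toFun := fun Y => interior Y P
      map_add' := fun Y Z => interior_add_left Y Z P
      map_smul' := fun f Y => interior_smul_left f Y P }
  change ∑ i, ε i X • interiorₗ (e i) = χ • interiorₗ X
  simp only [← map_smul, hχ, map_sum]

theorem eq_zero_of_forall_isFraming_smul (hL : LocallyFramed R L) {ξ : ValuedForms R L R}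
    (hξ : ∀ χ : R, IsFraming L χ → χ • ξ = 0) : ξ = 0 := by
  refine DFinsupp.ext fun q => ?_
  ext v
  exact hL.eq_zero _ fun χ hχ => congrArg (fun ξ : ValuedForms R L R => ξ q v) (hξ χ hχ)

end Framing

section Vanishing

variable {R : Type*} [CommRing R] [IsAddTorsionFree R] {L : Type*} [AddCommGroup L] [Module R L]

theorem interior_cov_mul_interior (X Y : L) (α : Module.Dual R L) (P : ValuedForms R L R) :
    interior X (mul (cov α) (interior Y P)) =
      α X • interior Y P + mul (cov α) (interior Y (interior X P)) := by
  rw [interior_wedge, interior_cov, fn_mul, interior_interior X, invol_of, pow_one,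
    neg_smul_form, one_smul, map_neg, map_neg, LinearMap.neg_apply, neg_neg]

theorem sum_cov_mul_interior {n : ℕ} {χ : R} {e : Fin n → L} {ε : Fin n → Module.Dual R L}
    (hχ : ∀ X : L, χ • X = ∑ i, ε i X • e i) {p : ℕ} {P : ValuedForms R L R} (hP : IsHom p P) :
    ∑ i, mul (cov (ε i)) (interior (e i) P) = (p * χ) • P := by
  induction p generalizing P with
  | zero =>
    simp only [hP.interior_eq_zero, map_zero, Finset.sum_const_zero, Nat.cast_zero, zero_mul,
      zero_smul]
  | succ p ih =>
    refine ext_interior ?_ fun X => ?_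
    · have isHom_sum : IsHom (1 + p) (∑ i, mul (cov (ε i)) (interior (e i) P)) :=
        Finset.sum_induction _ (IsHom (1 + p)) (fun _ _ => IsHom.add) (isHom_zero _)
          fun i _ => (isHom_of _).wedge _ (hP.interior (e i))
      rw [(hP.smul _).apply_ne (by omega), isHom_sum.apply_ne (by omega)]
    · simp only [map_sum, interior_cov_mul_interior, Finset.sum_add_distrib]
      rw [sum_smul_interior hχ, ih (hP.interior X), map_smul, ← add_smul]
      congr 1
      push_cast
      ring

theorem eq_zero_of_natCast_smul_eq_zero {n : ℕ} (hn : n ≠ 0) {ξ : ValuedForms R L R}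
    (hξ : (n : R) • ξ = 0) : ξ = 0 := by
  refine DFinsupp.ext fun q => ?_
  ext v
  refine nsmul_right_injective hn ?_
  change n • ξ q v = n • 0
  rw [smul_zero, nsmul_eq_mul]
  exact congrArg (fun ξ : ValuedForms R L R => ξ q v) hξ

namespace IsGradedDerivation

variable {k : ℕ} {D : ValuedForms R L R → ValuedForms R L R}

theorem map_smul (h : IsGradedDerivation k D) (h_fn : ∀ f, D (fn f) = 0) (f : R)
    (P : ValuedForms R L R) : D (f • P) = f • D P := by
  rw [← fn_mul, h.map_mul, h_fn, invol_pow_fn, fn_mul, _root_.map_zero, LinearMap.zero_apply,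
    zero_add]

theorem smul_eq_zero (h : IsGradedDerivation k D) (h_fn : ∀ f, D (fn f) = 0)
    (h_cov : ∀ α, D (cov α) = 0) {p : ℕ} (hp : p ≠ 0)
    (h_interior : ∀ Q, IsHom (p - 1) Q → D Q = 0) {P : ValuedForms R L R} (hP : IsHom p P)
    {χ : R} (hχ : IsFraming L χ) : χ • D P = 0 := by
  obtain ⟨n, e, ε, he⟩ := hχ
  have map_mul_eq_zero (i : Fin n) : D (ValuedForms.mul (cov (ε i)) (interior (e i) P)) = 0 := by
    rw [h.map_mul, h_cov, h_interior _ (hP.interior (e i)), _root_.map_zero, _root_.map_zero,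
      LinearMap.zero_apply, add_zero]
  have map_sum_eq_zero : D (∑ i, ValuedForms.mul (cov (ε i)) (interior (e i) P)) = 0 :=
    (map_sum (AddMonoidHom.mk' D h.map_add) _ _).trans
      (Finset.sum_eq_zero fun i _ => map_mul_eq_zero i)
  rw [sum_cov_mul_interior he hP, h.map_smul h_fn, mul_smul] at map_sum_eq_zero
  exact eq_zero_of_natCast_smul_eq_zero hp map_sum_eq_zero

theorem eq_zero (hL : LocallyFramed R L) (h : IsGradedDerivation k D)
    (h_fn : ∀ f, D (fn f) = 0) (h_cov : ∀ α, D (cov α) = 0) (ξ : ValuedForms R L R) :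
    D ξ = 0 := by
  have isHom_eq_zero (p : ℕ) : ∀ P, IsHom p P → D P = 0 := by
    induction p with
    | zero =>
      intro P hP
      obtain ⟨f, rfl⟩ := exists_fn hP
      exact h_fn f
    | succ p ih =>
      exact fun P hP => eq_zero_of_forall_isFraming_smul hL fun χ hχ =>
        h.smul_eq_zero h_fn h_cov p.succ_ne_zero ih hP hχ
  induction ξ using ValuedForms.induction with
  | zero => exact h.map_zero
  | add a b ha hb => rw [h.map_add, ha, hb, add_zero]
  | of p P => exact isHom_eq_zero p _ (isHom_of P)

theorem eq_zero_of_degree_le_one (hL : LocallyFramed R L) (h : IsGradedDerivation k D)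
    (h_le_one : ∀ t T, t ≤ 1 → IsHom t T → D T = 0) (ξ : ValuedForms R L R) : D ξ = 0 :=
  h.eq_zero hL (fun _ => h_le_one 0 _ zero_le_one (isHom_of _))
    (fun _ => h_le_one 1 _ le_rfl (isHom_of _)) ξ

end IsGradedDerivation

end Vanishing

end ValuedForms

namespace AnchoredBracket

variable {R : Type*} [CommRing R] [Algebra ℝ R] {L : Type*} [AddCommGroup L] [Module R L]
  (S : AnchoredBracket R L)

theorem dFun_apply (f : R) (X : L) : S.dFun f X = S.anchor X f := rfl

theorem lieDer_apply (X Y : L) (α : Module.Dual R L) :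
    S.lieDer X α Y = S.anchor X (α Y) - α (S.bracket X Y) := rfl

theorem koszul_apply (π : Bivector R L) (α β : Module.Dual R L) (X : L) :
    S.koszul π α β X = S.anchor (π.sharp α) (β X) - β (S.bracket (π.sharp α) X) -
      (S.anchor (π.sharp β) (α X) - α (S.bracket (π.sharp β) X)) - S.anchor X (β (π.sharp α)) :=
  rfl

theorem deform_bracket (N : Module.End R L) (X Y : L) : (S.deform N).bracket X Y =
    S.bracket (N X) Y + S.bracket X (N Y) - N (S.bracket X Y) := rfl

theorem deform_anchor (N : Module.End R L) (X : L) : (S.deform N).anchor X = S.anchor (N X) := rfl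

end AnchoredBracket

namespace ValuedForms

section PairCov

variable {R : Type*} [CommRing R] [IsAddTorsionFree R] {L : Type*} [AddCommGroup L] [Module R L]

theorem pair_cov (π : Bivector R L) (α : Module.Dual R L) (ξ : ValuedForms R L R) :
    pair π (cov α) ξ = interior (π.sharp α) ξ := by
  induction ξ using ValuedForms.induction with
  | zero => simp only [map_zero]
  | add a b ha hb => simp only [map_add, ha, hb]
  | of p P =>
    cases p with
    | zero => rw [pair_zero_right π _ (isHom_of P), interior_of_zero]
    | succ p =>
      rw [pair_apply, dualize_of_succ, dualize_of_succ, wedge_of_cast _ (Nat.zero_add p),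
        interior_of_succ]
      congr 1
      ext v
      rw [wedgeCast_zero_left, show dualizeForm (Forms.oneForm α) 0 = α from rfl]
      rfl

end PairCov

section Koszul

variable {R : Type*} [CommRing R] [Algebra ℝ R] {L : Type*} [AddCommGroup L] [Module R L]
  {S : AnchoredBracket R L} (hS : ∀ X, S.bracket X X = 0) (π : Bivector R L)

/-- The Koszul bracket of forms, generated by the differential and the pairing by `π`. -/
def koszulBracket : ValuedForms R L R →ₗ[ℝ] ValuedForms R L R →ₗ[ℝ] ValuedForms R L R :=
  LinearMap.mk₂ ℝ
    (fun P Q => diff hS (pair π P Q) + pair π (diff hS P) Q - pair π (invol P) (diff hS Q))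
    (fun P P' Q => by
      simp only [map_add, LinearMap.add_apply]
      abel)
    (fun c P Q => by
      simp only [map_smul]
      simp only [real_smul_eq, map_smul, LinearMap.smul_apply]
      simp only [← real_smul_eq, map_smul, smul_add, smul_sub])
    (fun P Q Q' => by
      simp only [map_add]
      abel)
    (fun c P Q => by
      simp only [map_smul]
      simp only [real_smul_eq, map_smul]
      simp only [← real_smul_eq, map_smul, smul_add, smul_sub])

theorem koszulBracket_apply (P Q : ValuedForms R L R) : koszulBracket hS π P Q =
    diff hS (pair π P Q) + pair π (diff hS P) Q - pair π (invol P) (diff hS Q) := rfl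

theorem diff_neg_one_pow_smul (k : ℕ) (ξ : ValuedForms R L R) :
    diff hS ((-1 : R) ^ k • ξ) = (-1 : R) ^ k • diff hS ξ :=
  map_neg_one_pow_smul (fun P Q => map_add _ P Q) k ξ

theorem isGradedDerivation_diff : IsGradedDerivation 1 (diff hS) where
  map_add P Q := map_add _ P Q
  map_mul P Q := by rw [diff_mul, pow_one]
  map_invol P := by rw [invol_diff, pow_one, neg_smul_form, one_smul]

theorem isGradedDerivation_pair {p : ℕ} {P : ValuedForms R L R} (hP : IsHom p P) :
    IsGradedDerivation p (pair π P) where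
  map_add Q T := map_add _ Q T
  map_mul Q T := pair_mul π hP Q T
  map_invol Q := by
    rw [invol_pair, hP.invol_eq, map_smul, LinearMap.smul_apply, smul_smul, ← mul_pow, neg_one_mul,
      neg_neg, one_pow, one_smul]

theorem isGradedDerivation_koszulBracket {p : ℕ} {P : ValuedForms R L R} (hP : IsHom p P) :
    IsGradedDerivation (p + 1) (koszulBracket hS π P) := by
  have commutator_diff_pair :=
    (isGradedDerivation_diff hS).commutator (isGradedDerivation_pair π hP)
  rw [add_comm 1 p] at commutator_diff_pair
  refine (congrArg (IsGradedDerivation (p + 1)) (funext fun Q => ?_)).mp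
    (commutator_diff_pair.add (isGradedDerivation_pair π (hP.diff hS)))
  rw [koszulBracket_apply, hP.invol_eq, map_smul, LinearMap.smul_apply, one_mul]
  abel

theorem koszulBracket_neg_one_pow_smul (P : ValuedForms R L R) (k : ℕ) (ξ : ValuedForms R L R) :
    koszulBracket hS π P ((-1 : R) ^ k • ξ) = (-1 : R) ^ k • koszulBracket hS π P ξ :=
  map_neg_one_pow_smul (fun _ _ => map_add _ _ _) k ξ

theorem koszulBracket_neg_one_pow_smul_left (P : ValuedForms R L R) (k : ℕ)
    (ξ : ValuedForms R L R) :
    koszulBracket hS π ((-1 : R) ^ k • ξ) P = (-1 : R) ^ k • koszulBracket hS π ξ P :=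
  map_neg_one_pow_smul (D := fun ξ => koszulBracket hS π ξ P)
    (fun _ _ => by simp only [map_add, LinearMap.add_apply]) k ξ

theorem koszulBracket_skew {p q : ℕ} {P Q : ValuedForms R L R} (hP : IsHom p P) (hQ : IsHom q Q) :
    koszulBracket hS π P Q = -((-1 : R) ^ ((p + 1) * (q + 1)) • koszulBracket hS π Q P) := by
  rw [koszulBracket_apply, koszulBracket_apply, hP.invol_eq, hQ.invol_eq, pair_skew π hQ hP,
    pair_skew π hQ (hP.diff hS), map_neg, diff_neg_one_pow_smul, map_smul, map_smul,
    LinearMap.smul_apply, LinearMap.smul_apply, pair_skew π (hQ.diff hS) hP]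
  rcases Nat.even_or_odd p with hp | hp <;> rcases Nat.even_or_odd q with hq | hq <;>
  simp [hp.neg_one_pow, hq.neg_one_pow, pow_succ, pow_mul, pow_add, mul_add, add_mul] <;> abel

theorem IsHom.koszulBracket {p q n : ℕ} {P Q : ValuedForms R L R} (hP : IsHom p P)
    (hQ : IsHom q Q) (hn : p + q = n + 1) : IsHom n (koszulBracket hS π P Q) := by
  rw [koszulBracket_apply]
  have diff_left := (hP.diff hS).pair π hQ
  have diff_right := hP.invol.pair π (hQ.diff hS)
  rcases Nat.eq_zero_or_pos p with rfl | _
  · obtain rfl : q = n + 1 := by omega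
    rw [pair_zero_left π hP, pair_zero_left π hP.invol]
    simpa using diff_left
  rcases Nat.eq_zero_or_pos q with rfl | _
  · obtain rfl : p = n + 1 := by omega
    rw [pair_zero_right π _ hQ, pair_zero_right π _ hQ]
    simpa using diff_right.neg
  have diff_pair := (hP.pair π hQ).diff hS
  rw [show p - 1 + (q - 1) + 1 = n by omega] at diff_pair
  rw [show p + 1 - 1 + (q - 1) = n by omega] at diff_left
  rw [show p - 1 + (q + 1 - 1) = n by omega] at diff_right
  exact (diff_pair.add diff_left).sub diff_right

theorem koszulBracket_cov_fn (α : Module.Dual R L) (f : R) :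
    koszulBracket hS π (cov α) (fn f) = fn (S.anchor (π.sharp α) f) := by
  rw [koszulBracket_apply, pair_zero_right π _ (isHom_of _), pair_zero_right π _ (isHom_of _),
    diff_fn, invol_of, map_smul, LinearMap.smul_apply, pair_cov_cov]
  simp [AnchoredBracket.dFun]

theorem koszulBracket_fn_fn (f g : R) : koszulBracket hS π (fn f) (fn g) = 0 := by
  rw [koszulBracket_apply, pair_zero_right π _ (isHom_of _), pair_zero_right π _ (isHom_of _),
    invol_of, map_smul, LinearMap.smul_apply, pair_zero_left π (isHom_of _)]
  simp

theorem koszulBracket_fn_cov (f : R) (α : Module.Dual R L) :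
    koszulBracket hS π (fn f) (cov α) = -fn (S.anchor (π.sharp α) f) := by
  rw [koszulBracket_skew hS π (isHom_of _) (isHom_of _), koszulBracket_cov_fn]
  simp

/-- The derivative of a section of `A` along a section of `A*`, dual to the Koszul bracket. -/
def dualLie (α : Module.Dual R L) (X : L) : L :=
  S.bracket (π.sharp α) X + π.sharp (S.lieDer X α - S.dFun (α X))

theorem koszulBracket_cov (α : Module.Dual R L) (ξ : ValuedForms R L R) :
    koszulBracket hS π (cov α) ξ = lie S (π.sharp α) ξ + pair π (diff hS (cov α)) ξ := by
  rw [koszulBracket_apply, pair_cov, invol_of, map_smul, LinearMap.smul_apply, pair_cov,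
    interior_diff, pow_one, neg_smul_form, one_smul]
  abel

theorem lie_cov (X : L) (α : Module.Dual R L) : lie S X (cov α) = cov (S.lieDer X α) := by
  rw [lie_of]
  congr 1
  ext v
  simp [lieForm_apply, AnchoredBracket.lieDer_apply]

theorem interior_diff_cov (X : L) (α : Module.Dual R L) :
    interior X (diff hS (cov α)) = cov (S.lieDer X α - S.dFun (α X)) := by
  rw [interior_diff, interior_cov, diff_fn, lie_cov, cov_sub]

theorem interior_koszulBracket_cov (α : Module.Dual R L) (X : L) (ξ : ValuedForms R L R) :
    interior X (koszulBracket hS π (cov α) ξ) = koszulBracket hS π (cov α) (interior X ξ) -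
      interior (dualLie (S := S) π α X) ξ := by
  rw [koszulBracket_cov, koszulBracket_cov, map_add, interior_lie, interior_pair,
    interior_diff_cov, pair_cov, ((isHom_of (Forms.oneForm α)).diff hS).invol_eq, dualLie,
    interior_add_left, Even.neg_one_pow ⟨1, rfl⟩, one_smul]
  abel

theorem koszulBracket_cov_cov (hS : ∀ X, S.bracket X X = 0) (α β : Module.Dual R L) :
    koszulBracket hS π (cov α) (cov β) = cov (S.koszul π α β) := by
  refine ext_interior ?_ fun X => ?_
  · have isHom_one := (isHom_of (Forms.oneForm α)).koszulBracket hS π (isHom_of (Forms.oneForm β))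
      (n := 1) rfl
    rw [isHom_one.apply_ne (by omega), of_apply_ne (by omega)]
  · rw [interior_koszulBracket_cov, interior_cov, interior_cov, interior_cov, koszulBracket_cov_fn,
      sub_eq_add_neg, ← of_neg, ← of_add]
    congr 1
    ext v
    simp only [AlternatingMap.add_apply, AlternatingMap.neg_apply,
      AlternatingMap.constOfIsEmpty_apply, Function.const_apply, dualLie, map_add,
      π.skew (S.lieDer X α - S.dFun (α X)) β, LinearMap.sub_apply, AnchoredBracket.lieDer_apply,
      AnchoredBracket.dFun_apply, AnchoredBracket.koszul_apply, π.skew β α, map_neg,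
      AnchoredBracket.bracket_skew hS X (π.sharp β)]
    ring

end Koszul

section DegreeLeOne

variable {R : Type*} [CommRing R] {L : Type*} [AddCommGroup L] [Module R L]

theorem IsHom.eq_fn_or_eq_cov {p : ℕ} (hp : p ≤ 1) {P : ValuedForms R L R} (hP : IsHom p P) :
    (p = 0 ∧ ∃ f, P = fn f) ∨ (p = 1 ∧ ∃ α, P = cov α) := by
  rcases Nat.le_one_iff_eq_zero_or_eq_one.mp hp with rfl | rfl
  · exact Or.inl ⟨rfl, exists_fn hP⟩
  · exact Or.inr ⟨rfl, exists_cov hP⟩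

end DegreeLeOne

theorem eq_zero_of_skew_of_degree_le_one {R : Type*} [CommRing R] [IsAddTorsionFree R]
    {L : Type*} [AddCommGroup L] [Module R L] (hL : LocallyFramed R L) {k : ℕ → ℕ}
    {G : ℕ → ValuedForms R L R → ValuedForms R L R → ValuedForms R L R}
    (derivation : ∀ {p P}, IsHom p P → IsGradedDerivation (k p) (G p P))
    (skew : ∀ {p q P Q}, IsHom p P → IsHom q Q →
      G q Q P = -((-1 : R) ^ ((p + 1) * (q + 1)) • G p P Q))
    (degree_le_one : ∀ {p q P Q}, p ≤ 1 → q ≤ 1 → IsHom p P → IsHom q Q → G p P Q = 0)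
    {p : ℕ} {P : ValuedForms R L R} (hP : IsHom p P) (T : ValuedForms R L R) : G p P T = 0 := by
  have left_degree_le_one {t : ℕ} {T : ValuedForms R L R} (ht : t ≤ 1) (hT : IsHom t T) :
      ∀ P, G t T P = 0 :=
    (derivation hT).eq_zero_of_degree_le_one hL fun _ _ hp hP => degree_le_one ht hp hT hP
  refine (derivation hP).eq_zero_of_degree_le_one hL (fun t T ht hT => ?_) T
  rw [skew hT hP, left_degree_le_one ht hT, smul_zero, neg_zero]

section Jacobi

variable {R : Type*} [CommRing R] [Algebra ℝ R] {L : Type*} [AddCommGroup L] [Module R L]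
  {S : AnchoredBracket R L} (hS : ∀ X, S.bracket X X = 0) (π : Bivector R L)

theorem exists_isHom_koszulBracket {p q : ℕ} {P Q : ValuedForms R L R} (hP : IsHom p P)
    (hQ : IsHom q Q) : ∃ n, IsHom n (koszulBracket hS π P Q) ∧ Even (n + 1 + (p + q)) := by
  rcases Nat.eq_zero_or_pos (p + q) with h | h
  · obtain ⟨rfl, rfl⟩ : p = 0 ∧ q = 0 := by omega
    obtain ⟨f, rfl⟩ := exists_fn hP
    obtain ⟨g, rfl⟩ := exists_fn hQ
    exact ⟨1, by rw [koszulBracket_fn_fn]; exact isHom_zero 1, ⟨1, rfl⟩⟩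
  · exact ⟨p + q - 1, hP.koszulBracket hS π hQ (by omega), ⟨p + q, by omega⟩⟩

theorem koszulBracket_koszulBracket_skew {p q t : ℕ} {P Q T : ValuedForms R L R}
    (hP : IsHom p P) (hQ : IsHom q Q) (hT : IsHom t T) :
    koszulBracket hS π (koszulBracket hS π P Q) T =
      -((-1 : R) ^ ((p + q) * (t + 1)) • koszulBracket hS π T (koszulBracket hS π P Q)) := by
  obtain ⟨n, isHom_bracket, parity⟩ := exists_isHom_koszulBracket hS π hP hQ
  rw [koszulBracket_skew hS π isHom_bracket hT, pow_mul,
    neg_one_pow_congr (Nat.even_add.mp parity), ← pow_mul]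

/-- The Jacobiator of the Koszul bracket, on forms of degrees `p`, `q` and of any degree. -/
def jacobiator (p q : ℕ) (P Q T : ValuedForms R L R) : ValuedForms R L R :=
  koszulBracket hS π P (koszulBracket hS π Q T) - koszulBracket hS π (koszulBracket hS π P Q) T -
    (-1 : R) ^ ((p + 1) * (q + 1)) • koszulBracket hS π Q (koszulBracket hS π P T)

theorem isGradedDerivation_jacobiator {p q : ℕ} {P Q : ValuedForms R L R} (hP : IsHom p P)
    (hQ : IsHom q Q) : IsGradedDerivation (p + q) (jacobiator hS π p q P Q) := by
  obtain ⟨n, isHom_bracket, parity⟩ := exists_isHom_koszulBracket hS π hP hQ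
  have commutator := (isGradedDerivation_koszulBracket hS π hP).commutator
    (isGradedDerivation_koszulBracket hS π hQ)
  have inner := (isGradedDerivation_koszulBracket hS π isHom_bracket).congr_parity parity
  refine (congrArg (IsGradedDerivation (p + q)) (funext fun T => ?_)).mp
    ((commutator.congr_parity (l := p + q) ⟨p + q + 1, by omega⟩).sub inner)
  rw [jacobiator]
  abel

theorem jacobiator_swap_left {p q : ℕ} {P Q : ValuedForms R L R} (hP : IsHom p P)
    (hQ : IsHom q Q) (T : ValuedForms R L R) : jacobiator hS π q p Q P T =
      -((-1 : R) ^ ((p + 1) * (q + 1)) • jacobiator hS π p q P Q T) := by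
  rw [jacobiator, jacobiator, koszulBracket_skew hS π hQ hP, map_neg, LinearMap.neg_apply,
    koszulBracket_neg_one_pow_smul_left]
  rcases Nat.even_or_odd p with hp | hp <;> rcases Nat.even_or_odd q with hq | hq <;>
    simp [hp.neg_one_pow, hq.neg_one_pow, pow_succ, pow_mul, pow_add, mul_add, add_mul] <;> abel

theorem jacobiator_swap_right {p q t : ℕ} {P Q T : ValuedForms R L R} (hP : IsHom p P)
    (hQ : IsHom q Q) (hT : IsHom t T) : jacobiator hS π p t P T Q =
      -((-1 : R) ^ ((q + 1) * (t + 1)) • jacobiator hS π p q P Q T) := by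
  rw [jacobiator, jacobiator, koszulBracket_skew hS π hT hQ, map_neg,
    koszulBracket_neg_one_pow_smul, koszulBracket_koszulBracket_skew hS π hP hT hQ,
    koszulBracket_koszulBracket_skew hS π hP hQ hT]
  rcases Nat.even_or_odd p with hp | hp <;> rcases Nat.even_or_odd q with hq | hq <;>
    rcases Nat.even_or_odd t with ht | ht <;>
    simp [hp.neg_one_pow, hq.neg_one_pow, ht.neg_one_pow, pow_succ, pow_mul, pow_add, mul_add,
      add_mul] <;>
    abel

variable {hS π}

theorem jacobiator_eq_zero_of_degree_le_one
    (hanchor : ∀ α β f, S.anchor (π.sharp (S.koszul π α β)) f =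
      S.anchor (π.sharp α) (S.anchor (π.sharp β) f) - S.anchor (π.sharp β) (S.anchor (π.sharp α) f))
    (hjacobi : ∀ α β γ, S.koszul π α (S.koszul π β γ) =
      S.koszul π (S.koszul π α β) γ + S.koszul π β (S.koszul π α γ))
    {p q t : ℕ} (hp : p ≤ 1) (hq : q ≤ 1) (ht : t ≤ 1) {P Q T : ValuedForms R L R}
    (hP : IsHom p P) (hQ : IsHom q Q) (hT : IsHom t T) : jacobiator hS π p q P Q T = 0 := by
  rcases hP.eq_fn_or_eq_cov hp with ⟨rfl, f, rfl⟩ | ⟨rfl, α, rfl⟩ <;>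
    rcases hQ.eq_fn_or_eq_cov hq with ⟨rfl, g, rfl⟩ | ⟨rfl, β, rfl⟩ <;>
    rcases hT.eq_fn_or_eq_cov ht with ⟨rfl, h, rfl⟩ | ⟨rfl, γ, rfl⟩ <;>
    simp only [jacobiator, koszulBracket_fn_fn, koszulBracket_cov_fn, koszulBracket_fn_cov,
      koszulBracket_cov_cov, map_neg, LinearMap.neg_apply, map_zero, LinearMap.zero_apply,
      hanchor, fn_sub]
  case inr.inr.inr => rw [hjacobi α β γ, cov_add]; simp [show (-1 : R) ^ 4 = 1 by norm_num]
  case inr.inl.inr => simp; abel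
  all_goals simp [show (-1 : R) ^ 4 = 1 by norm_num]

theorem jacobiator_eq_zero (hL : LocallyFramed R L)
    (hanchor : ∀ α β f, S.anchor (π.sharp (S.koszul π α β)) f =
      S.anchor (π.sharp α) (S.anchor (π.sharp β) f) - S.anchor (π.sharp β) (S.anchor (π.sharp α) f))
    (hjacobi : ∀ α β γ, S.koszul π α (S.koszul π β γ) =
      S.koszul π (S.koszul π α β) γ + S.koszul π β (S.koszul π α γ))
    {p q : ℕ} {P Q : ValuedForms R L R} (hP : IsHom p P) (hQ : IsHom q Q)
    (T : ValuedForms R L R) : jacobiator hS π p q P Q T = 0 := by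
  have first_degree_le_one {p q : ℕ} {P Q : ValuedForms R L R} (hp : p ≤ 1) (hP : IsHom p P)
      (hQ : IsHom q Q) (T) : jacobiator hS π p q P Q T = 0 :=
    eq_zero_of_skew_of_degree_le_one (k := fun q => p + q)
      (G := fun q Q T => jacobiator hS π p q P Q T) hL (isGradedDerivation_jacobiator hS π hP)
      (jacobiator_swap_right hS π hP)
      (jacobiator_eq_zero_of_degree_le_one hanchor hjacobi hp · · hP · ·) hQ T
  refine (isGradedDerivation_jacobiator hS π hP hQ).eq_zero_of_degree_le_one hL
    (fun t T ht hT => ?_) T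
  rw [jacobiator_swap_right hS π hP hT hQ, jacobiator_swap_left hS π hT hP,
    first_degree_le_one ht hT hP, smul_zero, neg_zero, smul_zero, neg_zero]

theorem koszulBracket_jacobi (hL : LocallyFramed R L)
    (hanchor : ∀ α β f, S.anchor (π.sharp (S.koszul π α β)) f =
      S.anchor (π.sharp α) (S.anchor (π.sharp β) f) - S.anchor (π.sharp β) (S.anchor (π.sharp α) f))
    (hjacobi : ∀ α β γ, S.koszul π α (S.koszul π β γ) =
      S.koszul π (S.koszul π α β) γ + S.koszul π β (S.koszul π α γ))
    {p q : ℕ} {P Q : ValuedForms R L R} (hP : IsHom p P) (hQ : IsHom q Q)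
    (T : ValuedForms R L R) : koszulBracket hS π P (koszulBracket hS π Q T) =
      koszulBracket hS π (koszulBracket hS π P Q) T +
        (-1 : R) ^ ((p + 1) * (q + 1)) • koszulBracket hS π Q (koszulBracket hS π P T) := by
  have jacobiator_zero := jacobiator_eq_zero (hS := hS) hL hanchor hjacobi hP hQ T
  rw [jacobiator, sub_sub] at jacobiator_zero
  exact sub_eq_zero.mp jacobiator_zero

end Jacobi

section DerivationOfBracket

variable {R : Type*} [CommRing R] [Algebra ℝ R] {L : Type*} [AddCommGroup L] [Module R L]
  {S : AnchoredBracket R L} {hS : ∀ X, S.bracket X X = 0} {π : Bivector R L}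
  {δ : ValuedForms R L R → ValuedForms R L R}

/-- The failure of `δ` to be a derivation of degree one of the Koszul bracket, the first argument
having degree `p`. -/
def derivationDefect (hS : ∀ X, S.bracket X X = 0) (π : Bivector R L)
    (δ : ValuedForms R L R → ValuedForms R L R) (p : ℕ) (P T : ValuedForms R L R) :
    ValuedForms R L R :=
  δ (koszulBracket hS π P T) - koszulBracket hS π (δ P) T -
    (-1 : R) ^ (p + 1) • koszulBracket hS π P (δ T)

theorem isGradedDerivation_derivationDefect (hδ : IsGradedDerivation 1 δ)
    (isHom_δ : ∀ p P, IsHom p P → IsHom (p + 1) (δ P)) {p : ℕ} {P : ValuedForms R L R}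
    (hP : IsHom p P) : IsGradedDerivation (p + 1 + 1) (derivationDefect hS π δ p P) := by
  have commutator := hδ.commutator (isGradedDerivation_koszulBracket hS π hP)
  rw [add_comm 1] at commutator
  refine (congrArg (IsGradedDerivation (p + 1 + 1)) (funext fun T => ?_)).mp
    (commutator.sub (isGradedDerivation_koszulBracket hS π (isHom_δ p P hP)))
  simp only [derivationDefect, one_mul]
  abel

theorem derivationDefect_skew (hδ : IsGradedDerivation 1 δ)
    (isHom_δ : ∀ p P, IsHom p P → IsHom (p + 1) (δ P)) {p q : ℕ} {P Q : ValuedForms R L R}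
    (hP : IsHom p P) (hQ : IsHom q Q) : derivationDefect hS π δ q Q P =
      -((-1 : R) ^ ((p + 1) * (q + 1)) • derivationDefect hS π δ p P Q) := by
  simp only [derivationDefect]
  rw [koszulBracket_skew hS π hQ hP, koszulBracket_skew hS π (isHom_δ q Q hQ) hP,
    koszulBracket_skew hS π hQ (isHom_δ p P hP), hδ.map_neg, map_neg_one_pow_smul hδ.map_add]
  rcases Nat.even_or_odd p with hp | hp <;> rcases Nat.even_or_odd q with hq | hq <;>
    simp [hp.neg_one_pow, hq.neg_one_pow, pow_succ, pow_mul, pow_add, mul_add, add_mul] <;> abel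

theorem derivation_koszulBracket (hL : LocallyFramed R L) (hδ : IsGradedDerivation 1 δ)
    (isHom_δ : ∀ p P, IsHom p P → IsHom (p + 1) (δ P))
    (fn_fn : ∀ f g, koszulBracket hS π (δ (fn f)) (fn g) = koszulBracket hS π (fn f) (δ (fn g)))
    (cov_fn : ∀ α f, δ (koszulBracket hS π (cov α) (fn f)) =
      koszulBracket hS π (δ (cov α)) (fn f) + koszulBracket hS π (cov α) (δ (fn f)))
    (cov_cov : ∀ α β, δ (koszulBracket hS π (cov α) (cov β)) =
      koszulBracket hS π (δ (cov α)) (cov β) + koszulBracket hS π (cov α) (δ (cov β)))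
    {p : ℕ} {P : ValuedForms R L R} (hP : IsHom p P) (T : ValuedForms R L R) :
    δ (koszulBracket hS π P T) =
      koszulBracket hS π (δ P) T + (-1 : R) ^ (p + 1) • koszulBracket hS π P (δ T) := by
  have defect_cov_fn (α f) : derivationDefect hS π δ 1 (cov α) (fn f) = 0 := by
    simp [derivationDefect, cov_fn]
  have defect_degree_le_one {p q : ℕ} {P Q : ValuedForms R L R} (hp : p ≤ 1) (hq : q ≤ 1)
      (hP : IsHom p P) (hQ : IsHom q Q) : derivationDefect hS π δ p P Q = 0 := by
    rcases hP.eq_fn_or_eq_cov hp with ⟨rfl, f, rfl⟩ | ⟨rfl, α, rfl⟩ <;>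
      rcases hQ.eq_fn_or_eq_cov hq with ⟨rfl, g, rfl⟩ | ⟨rfl, β, rfl⟩
    · simp [derivationDefect, koszulBracket_fn_fn, hδ.map_zero, fn_fn]
    · rw [derivationDefect_skew hδ isHom_δ (isHom_of _) (isHom_of _), defect_cov_fn, smul_zero,
        neg_zero]
    · exact defect_cov_fn α g
    · simp [derivationDefect, cov_cov]
  have defect_eq_zero : derivationDefect hS π δ p P T = 0 :=
    eq_zero_of_skew_of_degree_le_one hL (isGradedDerivation_derivationDefect hδ isHom_δ)
      (derivationDefect_skew hδ isHom_δ) defect_degree_le_one hP T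
  rw [← sub_eq_zero, ← defect_eq_zero, derivationDefect]
  abel

theorem derivation_sq (hL : LocallyFramed R L) (hδ : IsGradedDerivation 1 δ)
    {φ : ValuedForms R L R} (hφ : IsHom 3 φ)
    (sq_fn : ∀ f, δ (δ (fn f)) = koszulBracket hS π φ (fn f))
    (sq_cov : ∀ α, δ (δ (cov α)) = koszulBracket hS π φ (cov α)) (T : ValuedForms R L R) :
    δ (δ T) = koszulBracket hS π φ T := by
  have derivation_sub :=
    hδ.sq.sub ((isGradedDerivation_koszulBracket hS π hφ).congr_parity (l := 2) ⟨3, rfl⟩)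
  exact sub_eq_zero.mp (derivation_sub.eq_zero hL (fun f => sub_eq_zero.mpr (sq_fn f))
    (fun α => sub_eq_zero.mpr (sq_cov α)) T)

end DerivationOfBracket

end ValuedForms

namespace AnchoredBracket

section Commute

variable {R : Type*} [CommRing R] [Algebra ℝ R] {P : Type*} [AddCommGroup P] [Module R P]

theorem add_anchor (S T : AnchoredBracket R P) (x : P) :
    (S + T).anchor x = S.anchor x + T.anchor x := rfl

theorem add_bracket (S T : AnchoredBracket R P) (x y : P) :
    (S + T).bracket x y = S.bracket x y + T.bracket x y := rfl

/-- The polarization of the Jacobiator of a bracket. -/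
def mixedJacobiator (U V : AnchoredBracket R P) (x y z : P) : P :=
  U.bracket x (V.bracket y z) + V.bracket x (U.bracket y z) -
    U.bracket (V.bracket x y) z - V.bracket (U.bracket x y) z -
    U.bracket y (V.bracket x z) - V.bracket y (U.bracket x z)

/-- The polarization of the failure of the anchor to preserve brackets. -/
def anchorDefect (U V : AnchoredBracket R P) (x y : P) : Derivation ℝ R R :=
  U.anchor (V.bracket x y) + V.anchor (U.bracket x y) - ⁅U.anchor x, V.anchor y⁆ -
    ⁅V.anchor x, U.anchor y⁆

/-- The vanishing of the big bracket `{U, V}` of two brackets, expressed by the polarizations of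
the Jacobi identity and of the compatibility with the anchor. -/
structure Commutes (U V : AnchoredBracket R P) : Prop where
  jacobiator : ∀ x y z, mixedJacobiator U V x y z = 0
  anchor : ∀ x y, anchorDefect U V x y = 0

theorem mixedJacobiator_comm (U V : AnchoredBracket R P) (x y z : P) :
    mixedJacobiator U V x y z = mixedJacobiator V U x y z := by
  simp only [mixedJacobiator]; abel

theorem anchorDefect_comm (U V : AnchoredBracket R P) (x y : P) :
    anchorDefect U V x y = anchorDefect V U x y := by
  simp only [anchorDefect]; abel

theorem Commutes.symm {U V : AnchoredBracket R P} (h : Commutes U V) : Commutes V U where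
  jacobiator x y z := by rw [mixedJacobiator_comm, h.jacobiator]
  anchor x y := by rw [anchorDefect_comm, h.anchor]

theorem mixedJacobiator_add_left (U U' V : AnchoredBracket R P) (x y z : P) :
    mixedJacobiator (U + U') V x y z = mixedJacobiator U V x y z + mixedJacobiator U' V x y z := by
  simp only [mixedJacobiator, add_bracket, map_add, AddMonoidHom.add_apply]; abel

theorem anchorDefect_add_left (U U' V : AnchoredBracket R P) (x y : P) :
    anchorDefect (U + U') V x y = anchorDefect U V x y + anchorDefect U' V x y := by
  simp only [anchorDefect, add_bracket, add_anchor, map_add, add_lie, lie_add]; abel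

theorem Commutes.add_left {U U' V : AnchoredBracket R P} (h : Commutes U V) (h' : Commutes U' V) :
    Commutes (U + U') V where
  jacobiator x y z := by rw [mixedJacobiator_add_left, h.jacobiator, h'.jacobiator, add_zero]
  anchor x y := by rw [anchorDefect_add_left, h.anchor, h'.anchor, add_zero]

theorem Commutes.add_right {U V V' : AnchoredBracket R P} (h : Commutes U V)
    (h' : Commutes U V') : Commutes U (V + V') :=
  (h.symm.add_left h'.symm).symm

theorem mixedJacobiator_deform (U V : AnchoredBracket R P) (J : Module.End R P) (x y z : P) :
    mixedJacobiator (U.deform J) V x y z + mixedJacobiator U (V.deform J) x y z =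
      mixedJacobiator U V (J x) y z + mixedJacobiator U V x (J y) z +
        mixedJacobiator U V x y (J z) - J (mixedJacobiator U V x y z) := by
  simp only [mixedJacobiator, deform_bracket, map_add, map_sub, AddMonoidHom.add_apply,
    AddMonoidHom.sub_apply]
  abel

theorem anchorDefect_deform (U V : AnchoredBracket R P) (J : Module.End R P) (x y : P) :
    anchorDefect (U.deform J) V x y + anchorDefect U (V.deform J) x y =
      anchorDefect U V (J x) y + anchorDefect U V x (J y) := by
  simp only [anchorDefect, deform_bracket, deform_anchor, map_add, map_sub]
  abel

theorem eq_zero_of_add_self_eq_zero (R : Type*) [CommRing R] [Algebra ℝ R] {P : Type*}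
    [AddCommGroup P] [Module R P] {x : P} (hx : x + x = 0) : x = 0 := by
  have half_mul_two : (algebraMap ℝ R 2⁻¹) * 2 = 1 := by
    rw [← map_ofNat (algebraMap ℝ R) 2, ← map_mul]; norm_num
  rw [← one_smul R x, ← half_mul_two, mul_smul, two_smul, hx, smul_zero]

theorem Commutes.deform_self {S : AnchoredBracket R P} (h : Commutes S S) (J : Module.End R P) :
    Commutes (S.deform J) S where
  jacobiator x y z := by
    have double := mixedJacobiator_deform S S J x y z
    rw [mixedJacobiator_comm S (S.deform J)] at double
    simp only [h.jacobiator, map_zero, add_zero, sub_zero] at double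
    exact eq_zero_of_add_self_eq_zero R double
  anchor x y := by
    have double := anchorDefect_deform S S J x y
    rw [anchorDefect_comm S (S.deform J)] at double
    simp only [h.anchor, add_zero] at double
    exact eq_zero_of_add_self_eq_zero R double

-- By the Jacobi identity for the big bracket, `{S_J, S_J} = -{S, {J, {J, S}}}` when `{S, S} = 0`.
theorem Commutes.deform_deform {S : AnchoredBracket R P} {J : Module.End R P} (h : Commutes S S)
    (h' : Commutes ((S.deform J).deform J) S) : Commutes (S.deform J) (S.deform J) where
  jacobiator x y z := by
    simpa only [(h.deform_self J).jacobiator, h'.jacobiator, map_zero, add_zero, zero_add, sub_zero]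
      using mixedJacobiator_deform (S.deform J) S J x y z
  anchor x y := by
    simpa only [(h.deform_self J).anchor, h'.anchor, add_zero, zero_add]
      using anchorDefect_deform (S.deform J) S J x y

theorem Commutes.jacobi {S : AnchoredBracket R P} (h : Commutes S S) (x y z : P) :
    S.bracket x (S.bracket y z) = S.bracket (S.bracket x y) z + S.bracket y (S.bracket x z) := by
  refine sub_eq_zero.mp (eq_zero_of_add_self_eq_zero R ?_)
  rw [← h.jacobiator x y z, mixedJacobiator]
  abel

theorem Commutes.anchor_bracket {S : AnchoredBracket R P} (h : Commutes S S) (x y : P) :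
    S.anchor (S.bracket x y) = ⁅S.anchor x, S.anchor y⁆ := by
  refine sub_eq_zero.mp (eq_zero_of_add_self_eq_zero R ?_)
  rw [← h.anchor x y, anchorDefect]
  abel

end Commute

section Pairing

variable {R : Type*} [CommRing R] {L : Type*} [AddCommGroup L] [Module R L]

theorem pairing_comm (x y : L × Module.Dual R L) : pairing x y = pairing y x := by
  simp only [pairing]; ring

theorem pairing_add_left (x y z : L × Module.Dual R L) :
    pairing (x + y) z = pairing x z + pairing y z := by
  simp [pairing]; ring

theorem pairing_sub_left (x y z : L × Module.Dual R L) :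
    pairing (x - y) z = pairing x z - pairing y z := by
  simp [pairing]; ring

theorem pairing_add_right (x y z : L × Module.Dual R L) :
    pairing x (y + z) = pairing x y + pairing x z := by
  simp [pairing]; ring

theorem pairing_sub_right (x y z : L × Module.Dual R L) :
    pairing x (y - z) = pairing x y - pairing x z := by
  simp [pairing]; ring

theorem pairing_ext (hsep : ∀ X : L, (∀ α : Module.Dual R L, α X = 0) → X = 0)
    {x y : L × Module.Dual R L} (h : ∀ z, pairing x z = pairing y z) : x = y := by
  refine Prod.ext (sub_eq_zero.mp (hsep _ fun α => ?_)) (LinearMap.ext fun X => ?_)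
  · have eval_eq := h (0, α)
    simp only [pairing, map_zero, add_zero] at eval_eq
    rw [map_sub, eval_eq, sub_self]
  · simpa [pairing] using h (X, 0)

end Pairing

section PairingCompatible

variable {R : Type*} [CommRing R] [Algebra ℝ R] {L : Type*} [AddCommGroup L] [Module R L]

/-- The compatibility of an anchored bracket on `A ⊕ A*` with the canonical pairing. -/
structure IsPairingCompatible (S : AnchoredBracket R (L × Module.Dual R L)) : Prop where
  pairing_invariant : ∀ x y z,
    S.anchor x (pairing y z) = pairing (S.bracket x y) z + pairing y (S.bracket x z)
  bracket_symm : ∀ x y z,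
    pairing (S.bracket x y + S.bracket y x) z = S.anchor z (pairing x y)

variable {S T : AnchoredBracket R (L × Module.Dual R L)}

theorem IsPairingCompatible.add (hS : S.IsPairingCompatible) (hT : T.IsPairingCompatible) :
    (S + T).IsPairingCompatible where
  pairing_invariant x y z := by
    simp only [add_anchor, add_bracket, Derivation.add_apply, hS.pairing_invariant,
      hT.pairing_invariant, pairing_add_left, pairing_add_right]
    ring
  bracket_symm x y z := by
    simp only [add_anchor, add_bracket, Derivation.add_apply, ← hS.bracket_symm,
      ← hT.bracket_symm, pairing_add_left]
    ring

theorem IsPairingCompatible.deform (hS : S.IsPairingCompatible)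
    {J : Module.End R (L × Module.Dual R L)} (hJ : ∀ x y, pairing (J x) y = -pairing x (J y)) :
    (S.deform J).IsPairingCompatible where
  pairing_invariant x y z := by
    have invariant_y := hS.pairing_invariant x (J y) z
    have invariant_z := hS.pairing_invariant x y (J z)
    rw [hJ, map_neg] at invariant_y
    simp only [deform_anchor, deform_bracket, hS.pairing_invariant, pairing_add_left,
      pairing_add_right, pairing_sub_left, pairing_sub_right, hJ (S.bracket x y)]
    rw [pairing_comm y (J _), hJ, pairing_comm _ (J y)]
    linear_combination invariant_y + invariant_z
  bracket_symm x y z := by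
    have symm_x := hS.bracket_symm (J x) y z
    have symm_y := hS.bracket_symm x (J y) z
    have symm_z := hS.bracket_symm x y (J z)
    rw [hJ, map_neg] at symm_x
    simp only [pairing_add_left] at symm_x symm_y symm_z
    simp only [deform_anchor, deform_bracket, pairing_add_left, pairing_sub_left,
      hJ (S.bracket _ _)]
    linear_combination symm_x + symm_y + symm_z

theorem IsPairingCompatible.bracket_swap_congr
    (hsep : ∀ X : L, (∀ α : Module.Dual R L, α X = 0) → X = 0) (hS : S.IsPairingCompatible)
    (hT : T.IsPairingCompatible) (hanchor : S.anchor = T.anchor) {x y : L × Module.Dual R L}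
    (hxy : S.bracket x y = T.bracket x y) : S.bracket y x = T.bracket y x := by
  refine pairing_ext hsep fun z => ?_
  have symm_S := hS.bracket_symm x y z
  have symm_T := hT.bracket_symm x y z
  rw [hanchor, ← symm_T, pairing_add_left, pairing_add_left, hxy] at symm_S
  linear_combination symm_S

theorem IsPairingCompatible.bracket_left_dual_congr
    (hsep : ∀ X : L, (∀ α : Module.Dual R L, α X = 0) → X = 0) (hS : S.IsPairingCompatible)
    (hT : T.IsPairingCompatible) (hanchor : S.anchor = T.anchor)
    (hleft : ∀ X Y : L, S.bracket (X, 0) (Y, 0) = T.bracket (X, 0) (Y, 0))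
    (hdual : ∀ α β : Module.Dual R L, S.bracket (0, α) (0, β) = T.bracket (0, α) (0, β))
    (X : L) (β : Module.Dual R L) : S.bracket (X, 0) (0, β) = T.bracket (X, 0) (0, β) := by
  have pairing_left (Z : L) :
      pairing (S.bracket (X, 0) (0, β)) (Z, 0) = pairing (T.bracket (X, 0) (0, β)) (Z, 0) := by
    have invariant_S := hS.pairing_invariant (X, 0) (0, β) (Z, 0)
    rw [hanchor, hT.pairing_invariant (X, 0) (0, β) (Z, 0), hleft] at invariant_S
    linear_combination -invariant_S
  have pairing_dual (γ : Module.Dual R L) :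
      pairing (S.bracket (X, 0) (0, β)) (0, γ) = pairing (T.bracket (X, 0) (0, β)) (0, γ) := by
    have invariant_S := hS.pairing_invariant (0, β) (X, 0) (0, γ)
    have symm_S := hS.bracket_symm (X, 0) (0, β) (0, γ)
    rw [hanchor, hT.pairing_invariant (0, β) (X, 0) (0, γ), hdual] at invariant_S
    rw [hanchor, ← hT.bracket_symm (X, 0) (0, β) (0, γ), pairing_add_left,
      pairing_add_left] at symm_S
    linear_combination symm_S + invariant_S
  refine pairing_ext hsep fun z => ?_
  rw [← Prod.fst_add_snd z, pairing_add_right, pairing_add_right, pairing_left, pairing_dual]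

theorem IsPairingCompatible.ext (hsep : ∀ X : L, (∀ α : Module.Dual R L, α X = 0) → X = 0)
    (hS : S.IsPairingCompatible) (hT : T.IsPairingCompatible) (hanchor : S.anchor = T.anchor)
    (hleft : ∀ X Y : L, S.bracket (X, 0) (Y, 0) = T.bracket (X, 0) (Y, 0))
    (hdual : ∀ α β : Module.Dual R L, S.bracket (0, α) (0, β) = T.bracket (0, α) (0, β)) :
    S = T := by
  have left_dual := hS.bracket_left_dual_congr hsep hT hanchor hleft hdual
  have dual_left (β : Module.Dual R L) (X : L) :
      S.bracket (0, β) (X, 0) = T.bracket (0, β) (X, 0) :=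
    hS.bracket_swap_congr hsep hT hanchor (left_dual X β)
  refine AnchoredBracket.ext hanchor (AddMonoidHom.ext fun x => AddMonoidHom.ext fun y => ?_)
  rw [← Prod.fst_add_snd x, ← Prod.fst_add_snd y]
  simp only [map_add, AddMonoidHom.add_apply, hleft, hdual, left_dual, dual_left]

end PairingCompatible

section Differentials

variable {R : Type*} [CommRing R] [Algebra ℝ R] {L : Type*} [AddCommGroup L] [Module R L]

theorem d_two_form (S : AnchoredBracket R L) (w : (Fin 2 → L) → R) (X Y Z : L) :
    S.d w ![X, Y, Z] = S.anchor X (w ![Y, Z]) - w ![S.bracket X Y, Z] - w ![Y, S.bracket X Z] -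
      (S.anchor Y (w ![X, Z]) - w ![X, S.bracket Y Z]) + S.anchor Z (w ![X, Y]) := by
  have ioi_zero : Finset.Ioi (0 : Fin 3) = {1, 2} := by decide
  have ioi_one : Finset.Ioi (1 : Fin 3) = {2} := by decide
  have ioi_two : Finset.Ioi (2 : Fin 3) = ∅ := by decide
  rw [d, Fin.sum_univ_three, ioi_zero, ioi_one, ioi_two, Finset.sum_pair (by decide),
    Finset.sum_singleton, Finset.sum_empty]
  have omit_zero : ∀ u : Fin 3 → L, (fun k => u (Fin.succAbove 0 k)) = ![u 1, u 2] :=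
    fun u => by ext i; fin_cases i <;> rfl
  have omit_one : ∀ u : Fin 3 → L, (fun k => u (Fin.succAbove 1 k)) = ![u 0, u 2] :=
    fun u => by ext i; fin_cases i <;> rfl
  have omit_two : ∀ u : Fin 3 → L, (fun k => u (Fin.succAbove 2 k)) = ![u 0, u 1] :=
    fun u => by ext i; fin_cases i <;> rfl
  simp only [omit_zero, omit_one, omit_two]
  simp only [Function.update]
  simp
  ring

theorem d_three_form (S : AnchoredBracket R L) (w : (Fin 3 → L) → R) (X Y Z W : L) :
    S.d w ![X, Y, Z, W] =
      S.anchor X (w ![Y, Z, W]) - w ![S.bracket X Y, Z, W] - w ![Y, S.bracket X Z, W] -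
        w ![Y, Z, S.bracket X W] -
      (S.anchor Y (w ![X, Z, W]) - w ![X, S.bracket Y Z, W] - w ![X, Z, S.bracket Y W]) +
      (S.anchor Z (w ![X, Y, W]) - w ![X, Y, S.bracket Z W]) - S.anchor W (w ![X, Y, Z]) := by
  have ioi_zero : Finset.Ioi (0 : Fin 4) = {1, 2, 3} := by decide
  have ioi_one : Finset.Ioi (1 : Fin 4) = {2, 3} := by decide
  have ioi_two : Finset.Ioi (2 : Fin 4) = {3} := by decide
  have ioi_three : Finset.Ioi (3 : Fin 4) = ∅ := by decide
  rw [d, Fin.sum_univ_four, ioi_zero, ioi_one, ioi_two, ioi_three, Finset.sum_pair (by decide),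
    Finset.sum_singleton, Finset.sum_empty, Finset.sum_insert (by decide),
    Finset.sum_pair (by decide)]
  have omit_zero : ∀ u : Fin 4 → L, (fun k => u (Fin.succAbove 0 k)) = ![u 1, u 2, u 3] :=
    fun u => by ext i; fin_cases i <;> rfl
  have omit_one : ∀ u : Fin 4 → L, (fun k => u (Fin.succAbove 1 k)) = ![u 0, u 2, u 3] :=
    fun u => by ext i; fin_cases i <;> rfl
  have omit_two : ∀ u : Fin 4 → L, (fun k => u (Fin.succAbove 2 k)) = ![u 0, u 1, u 3] :=
    fun u => by ext i; fin_cases i <;> rfl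
  have omit_three : ∀ u : Fin 4 → L, (fun k => u (Fin.succAbove 3 k)) = ![u 0, u 1, u 2] :=
    fun u => by ext i; fin_cases i <;> rfl
  simp only [omit_zero, omit_one, omit_two, omit_three]
  simp only [Function.update]
  simp
  ring

end Differentials

section Swap

variable {R : Type*} [CommRing R] {L : Type*} [AddCommGroup L] [Module R L]

theorem contract₂_swap_left (H : L [⋀^Fin 3]→ₗ[R] R) (X Y Z : L) :
    contract₂ H Y X Z = -contract₂ H X Y Z := by
  rw [contract₂_apply, contract₂_apply,
    ← H.map_swap ![X, Y, Z] (i := 0) (j := 1) (by decide)]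
  congr 1; ext i; fin_cases i <;> rfl

theorem contract₂_swap_right (H : L [⋀^Fin 3]→ₗ[R] R) (X Y Z : L) :
    contract₂ H X Z Y = -contract₂ H X Y Z := by
  rw [contract₂_apply, contract₂_apply,
    ← H.map_swap ![X, Y, Z] (i := 1) (j := 2) (by decide)]
  congr 1; ext i; fin_cases i <;> rfl

theorem flat_swap (σ : L [⋀^Fin 2]→ₗ[R] R) (X Y : L) : flat σ Y X = -flat σ X Y := by
  rw [flat_apply, flat_apply, ← σ.map_swap ![X, Y] (i := 0) (j := 1) (by decide)]
  congr 1; ext i; fin_cases i <;> rfl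

end Swap

section Hamiltonians

variable {R : Type*} [CommRing R] [Algebra ℝ R] {L : Type*} [AddCommGroup L] [Module R L]

/-- The bracket `(X + α, Y + β) ↦ -t(X, Y)` with zero anchor. -/
def background (t : L →ₗ[R] L →ₗ[R] Module.Dual R L) :
    AnchoredBracket R (L × Module.Dual R L) where
  anchor := 0
  bracket := AddMonoidHom.mk' (fun x => AddMonoidHom.mk' (fun y => (0, -t x.1 y.1))
      (fun y z => by
        ext Z
        · simp
        · simp only [Prod.fst_add, map_add, Prod.snd_add, LinearMap.add_apply, LinearMap.neg_apply]
          ring))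
    (fun x y => by
      ext z Z
      · simp
      · simp only [Prod.fst_add, map_add, Prod.snd_add, LinearMap.add_apply, LinearMap.neg_apply,
          AddMonoidHom.mk'_apply, AddMonoidHom.add_apply]
        ring)
  leibniz x y f := by ext Z <;> simp

theorem background_bracket (t : L →ₗ[R] L →ₗ[R] Module.Dual R L) (x y : L × Module.Dual R L) :
    (background t).bracket x y = (0, -t x.1 y.1) := rfl

theorem background_anchor (t : L →ₗ[R] L →ₗ[R] Module.Dual R L) (x : L × Module.Dual R L) :
    (background t).anchor x = 0 := rfl

theorem backgroundHamiltonian_eq (H : L [⋀^Fin 3]→ₗ[R] R) :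
    backgroundHamiltonian H = background (contract₂ H) := rfl

theorem isPairingCompatible_background {t : L →ₗ[R] L →ₗ[R] Module.Dual R L}
    (hl : ∀ X Y Z, t Y X Z = -t X Y Z) (hr : ∀ X Y Z, t X Z Y = -t X Y Z) :
    (background t).IsPairingCompatible where
  pairing_invariant x y z := by
    simp [background_bracket, background_anchor, pairing, hr x.1 y.1 z.1]
  bracket_symm x y z := by
    simp [background_bracket, background_anchor, pairing, hl x.1 y.1]

theorem hamiltonian_bracket (A : LieAlgebroid R L) (x y : L × Module.Dual R L) :
    A.hamiltonian.bracket x y = (A.bracket x.1 y.1,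
        A.lieDer x.1 y.2 - A.lieDer y.1 x.2 + A.dFun (x.2 y.1)) := rfl

theorem hamiltonian_anchor (A : LieAlgebroid R L) (x : L × Module.Dual R L) :
    A.hamiltonian.anchor x = A.anchor x.1 := rfl

theorem isPairingCompatible_hamiltonian (A : LieAlgebroid R L) :
    A.hamiltonian.IsPairingCompatible where
  pairing_invariant x y z := by
    simp only [hamiltonian_bracket, hamiltonian_anchor, pairing, LinearMap.add_apply,
      LinearMap.sub_apply, lieDer_apply, dFun_apply, map_add, A.bracket_swap y.1 x.1,
      A.bracket_swap z.1 x.1, A.bracket_swap z.1 y.1, map_neg]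
    ring
  bracket_symm x y z := by
    simp only [hamiltonian_bracket, hamiltonian_anchor, pairing, LinearMap.add_apply,
      LinearMap.sub_apply, lieDer_apply, dFun_apply, map_add, A.bracket_swap y.1 x.1,
      Prod.fst_add, Prod.snd_add, map_neg]
    ring

theorem hamiltonian_jacobi (A : LieAlgebroid R L) (x y z : L × Module.Dual R L) :
    A.hamiltonian.bracket x (A.hamiltonian.bracket y z) =
      A.hamiltonian.bracket (A.hamiltonian.bracket x y) z +
        A.hamiltonian.bracket y (A.hamiltonian.bracket x z) := by
  ext W
  · exact A.jacobi _ _ _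
  · simp only [hamiltonian_bracket, LinearMap.add_apply, Prod.snd_add,
      LinearMap.sub_apply, lieDer_apply, dFun_apply, map_add, map_sub, A.anchor_bracket,
      Derivation.commutator_apply]
    have jacobi_xy := congrArg z.2 (A.jacobi x.1 y.1 W)
    have jacobi_xz := congrArg y.2 (A.jacobi x.1 z.1 W)
    have jacobi_yz := congrArg x.2 (A.jacobi y.1 z.1 W)
    simp only [map_add] at jacobi_xy jacobi_xz jacobi_yz
    linear_combination -jacobi_xy + jacobi_xz - jacobi_yz

theorem commutes_hamiltonian (A : LieAlgebroid R L) : Commutes A.hamiltonian A.hamiltonian where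
  jacobiator x y z := by
    rw [mixedJacobiator, hamiltonian_jacobi A x y z]
    abel
  anchor x y := by
    simp only [anchorDefect, hamiltonian_anchor, hamiltonian_bracket, A.anchor_bracket]
    abel

theorem commutes_background (t t' : L →ₗ[R] L →ₗ[R] Module.Dual R L) :
    Commutes (background t) (background t') where
  jacobiator x y z := by
    simp [mixedJacobiator, background_bracket, Prod.ext_iff]
  anchor x y := by
    simp [anchorDefect, background_anchor]

theorem commutes_background_hamiltonian (A : LieAlgebroid R L)
    {t : L →ₗ[R] L →ₗ[R] Module.Dual R L}
    (hd : ∀ v, A.d (fun u : Fin 3 → L => t (u 0) (u 1) (u 2)) v = 0) :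
    Commutes (background t) A.hamiltonian where
  jacobiator x y z := by
    ext W
    · simp [mixedJacobiator, background_bracket, hamiltonian_bracket]
    · have d_eq_zero := hd ![x.1, y.1, z.1, W]
      rw [d_three_form] at d_eq_zero
      simp only [mixedJacobiator, background_bracket, hamiltonian_bracket, LinearMap.add_apply,
        Prod.snd_add, Prod.snd_sub, LinearMap.sub_apply, lieDer_apply, dFun_apply, map_zero,
        LinearMap.zero_apply, AddMonoidHom.zero_apply, Prod.snd_zero, LinearMap.neg_apply, map_neg,
        Derivation.coe_zero, Pi.zero_apply]
      simp only [Matrix.cons_val] at d_eq_zero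
      linear_combination -d_eq_zero
  anchor x y := by
    simp [anchorDefect, background_anchor, background_bracket, hamiltonian_anchor]

end Hamiltonians

section Endomorphisms

variable {R : Type*} [CommRing R] {L : Type*} [AddCommGroup L] [Module R L]
  (π : Bivector R L) (N : Module.End R L) (σ : L [⋀^Fin 2]→ₗ[R] R)

/-- The endomorphism `J = π + N + σ` of `A ⊕ A*`. -/
def quasiEnd : Module.End R (L × Module.Dual R L) :=
  π.toEnd + tensorToEnd N + twoFormToEnd σ

theorem quasiEnd_apply (x : L × Module.Dual R L) :
    quasiEnd π N σ x = (N x.1 + π.sharp x.2, flat σ x.1 - N.dualMap x.2) := by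
  ext Z
  · simp [quasiEnd, Bivector.toEnd, tensorToEnd, twoFormToEnd, add_comm]
  · simp only [quasiEnd, Bivector.toEnd, tensorToEnd, twoFormToEnd, LinearMap.add_apply,
      LinearMap.prod_apply, Function.prod_apply, LinearMap.zero_apply, LinearMap.neg_apply,
      LinearMap.comp_apply, LinearMap.fst_apply, LinearMap.snd_apply, Prod.snd_add,
      LinearMap.sub_apply]
    ring

theorem pairing_quasiEnd (x y : L × Module.Dual R L) :
    pairing (quasiEnd π N σ x) y = -pairing x (quasiEnd π N σ y) := by
  simp only [pairing, quasiEnd_apply, map_add, LinearMap.sub_apply, LinearMap.dualMap_apply,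
    π.skew x.2 y.2, flat_swap σ x.1 y.1]
  ring

/-- The endomorphism `N² + π♯ σ♭` of `A`. -/
def squareEnd : Module.End R L := N ∘ₗ N + π.sharp ∘ₗ flat σ

theorem squareEnd_apply (X : L) : squareEnd π N σ X = N (N X) + π.sharp (flat σ X) := rfl

/-- The skew endomorphism of `A ⊕ A*` given by `N² + π♯ σ♭` and the 2-form
`-(σ(NX, Y) + σ(X, NY))`. For a Poisson quasi-Nijenhuis structure with background, `S_J` deformed
by `J` differs from `μ + H` deformed by this endomorphism only by a closed background. -/
def quasiSquare : Module.End R (L × Module.Dual R L) :=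
  (squareEnd π N σ ∘ₗ LinearMap.fst R L (Module.Dual R L)).prod
    (-((squareEnd π N σ).dualMap ∘ₗ LinearMap.snd R L (Module.Dual R L)) -
      (flat σ ∘ₗ N + N.dualMap ∘ₗ flat σ) ∘ₗ LinearMap.fst R L (Module.Dual R L))

theorem quasiSquare_apply (x : L × Module.Dual R L) : quasiSquare π N σ x =
    (squareEnd π N σ x.1, -(squareEnd π N σ).dualMap x.2 -
      (flat σ (N x.1) + N.dualMap (flat σ x.1))) := rfl

theorem pairing_quasiSquare (x y : L × Module.Dual R L) :
    pairing (quasiSquare π N σ x) y = -pairing x (quasiSquare π N σ y) := by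
  simp only [pairing, quasiSquare_apply, LinearMap.sub_apply, LinearMap.dualMap_apply,
    LinearMap.neg_apply, LinearMap.add_apply, flat_swap σ x.1 (N y.1), flat_swap σ (N x.1) y.1]
  ring

/-- The 3-form `t(NX, Y, Z) + t(X, NY, Z) + t(X, Y, NZ)`, as a bilinear map with values in
1-forms. -/
def insertion (t : L →ₗ[R] L →ₗ[R] Module.Dual R L) : L →ₗ[R] L →ₗ[R] Module.Dual R L :=
  t ∘ₗ N + t.compl₂ N + t.compr₂ N.dualMap

theorem insertion_apply (t : L →ₗ[R] L →ₗ[R] Module.Dual R L) (X Y Z : L) :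
    insertion N t X Y Z = t (N X) Y Z + t X (N Y) Z + t X Y (N Z) := rfl

/-- The 3-form `t(NX, NY, Z) + t(X, NY, NZ) + t(NX, Y, NZ)`, as a bilinear map with values in
1-forms. -/
def doubleInsertion (t : L →ₗ[R] L →ₗ[R] Module.Dual R L) : L →ₗ[R] L →ₗ[R] Module.Dual R L :=
  t.compl₁₂ N N + (t.compl₂ N).compr₂ N.dualMap + (t ∘ₗ N).compr₂ N.dualMap

theorem doubleInsertion_apply (t : L →ₗ[R] L →ₗ[R] Module.Dual R L) (X Y Z : L) :
    doubleInsertion N t X Y Z = t (N X) (N Y) Z + t X (N Y) (N Z) + t (N X) Y (N Z) := rfl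

variable (ψ H : L [⋀^Fin 3]→ₗ[R] R)

theorem calH_eq_doubleInsertion :
    calH N H = fun u => doubleInsertion N (contract₂ H) (u 0) (u 1) (u 2) := by
  funext u
  rw [calH, doubleInsertion_apply, ← contract₂_apply, ← contract₂_apply, ← contract₂_apply,
    contract₂_swap_right H (N (u 1)) (u 0) (N (u 2)), contract₂_swap_left H (u 0) (N (u 1)),
    contract₂_swap_left H (N (u 0)) (N (u 2)), contract₂_swap_right H (N (u 0)) (u 1)]
  ring

/-- Twice the 3-form `𝓗 + i_N ψ`: the background of `S_J` deformed by `J`. -/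
def doubleBackground : L →ₗ[R] L →ₗ[R] Module.Dual R L :=
  (doubleInsertion N (contract₂ H) + insertion N (contract₂ ψ)) +
    (doubleInsertion N (contract₂ H) + insertion N (contract₂ ψ))

theorem doubleBackground_apply (X Y Z : L) : doubleBackground N ψ H X Y Z =
    (doubleInsertion N (contract₂ H) X Y Z + insertion N (contract₂ ψ) X Y Z) +
      (doubleInsertion N (contract₂ H) X Y Z + insertion N (contract₂ ψ) X Y Z) := rfl

theorem doubleBackground_swap_left (X Y Z : L) :
    doubleBackground N ψ H Y X Z = -doubleBackground N ψ H X Y Z := by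
  simp only [doubleBackground_apply, doubleInsertion_apply, insertion_apply,
    contract₂_swap_left _ X Y, contract₂_swap_left _ (N X) Y, contract₂_swap_left _ X (N Y),
    contract₂_swap_left _ (N X) (N Y)]
  ring

theorem doubleBackground_swap_right (X Y Z : L) :
    doubleBackground N ψ H X Z Y = -doubleBackground N ψ H X Y Z := by
  simp only [doubleBackground_apply, doubleInsertion_apply, insertion_apply,
    contract₂_swap_right _ _ Y Z, contract₂_swap_right _ _ (N Y) Z,
    contract₂_swap_right _ _ Y (N Z), contract₂_swap_right _ _ (N Y) (N Z)]
  ring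

end Endomorphisms

section Calculus

variable {R : Type*} [CommRing R] [Algebra ℝ R] {L : Type*} [AddCommGroup L] [Module R L]
  (S : AnchoredBracket R L)

theorem lieDer_zero_right (X : L) : S.lieDer X 0 = 0 := by
  ext Z; simp [lieDer_apply]

theorem lieDer_zero_left (α : Module.Dual R L) : S.lieDer 0 α = 0 := by
  ext Z; simp [lieDer_apply]

theorem lieDer_neg_right (X : L) (α : Module.Dual R L) : S.lieDer X (-α) = -S.lieDer X α := by
  ext Z; simp [lieDer_apply]; ring

theorem dFun_zero : S.dFun 0 = 0 := by
  ext Z; simp [dFun_apply]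

theorem dFun_neg (f : R) : S.dFun (-f) = -S.dFun f := by
  ext Z; simp [dFun_apply]

theorem d_insertion (N : Module.End R L) {ψ : L [⋀^Fin 3]→ₗ[R] R} (hψ : ∀ v, S.d ψ v = 0)
    (v : Fin 4 → L) :
    S.d (fun u : Fin 3 → L => insertion N (contract₂ ψ) (u 0) (u 1) (u 2)) v =
      -(S.deform N).d ψ v := by
  obtain ⟨X, Y, Z, W, rfl⟩ : ∃ X Y Z W, v = ![X, Y, Z, W] :=
    ⟨v 0, v 1, v 2, v 3, by ext i; fin_cases i <;> rfl⟩
  have closed_first := hψ ![N X, Y, Z, W]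
  have closed_second := hψ ![X, N Y, Z, W]
  have closed_third := hψ ![X, Y, N Z, W]
  have closed_fourth := hψ ![X, Y, Z, N W]
  rw [d_three_form] at closed_first closed_second closed_third closed_fourth ⊢
  rw [d_three_form]
  simp only [deform_anchor, deform_bracket, Matrix.cons_val, ← contract₂_apply, insertion_apply,
    map_add, map_sub, LinearMap.add_apply, LinearMap.sub_apply]
    at closed_first closed_second closed_third closed_fourth ⊢
  linear_combination closed_first + closed_second + closed_third + closed_fourth

end Calculus

section Deformed

variable {R : Type*} [CommRing R] [Algebra ℝ R] {L : Type*} [AddCommGroup L] [Module R L]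
  (A : LieAlgebroid R L) (π : Bivector R L) (N : Module.End R L)
  (σ : L [⋀^Fin 2]→ₗ[R] R) (H : L [⋀^Fin 3]→ₗ[R] R)

/-- The Courant structure `μ + H`. -/
def twisted : AnchoredBracket R (L × Module.Dual R L) :=
  A.hamiltonian + backgroundHamiltonian H

/-- The deformed structure `S_J`. -/
abbrev deformedTwisted : AnchoredBracket R (L × Module.Dual R L) :=
  (twisted A H).deform (quasiEnd π N σ)

theorem twisted_anchor (x : L × Module.Dual R L) : (twisted A H).anchor x = A.anchor x.1 := by
  simp [twisted, add_anchor, hamiltonian_anchor, backgroundHamiltonian_eq, background_anchor]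

theorem twisted_bracket (x y : L × Module.Dual R L) :
    (twisted A H).bracket x y = (A.bracket x.1 y.1,
        A.lieDer x.1 y.2 - A.lieDer y.1 x.2 + A.dFun (x.2 y.1) - contract₂ H x.1 y.1) := by
  simp [twisted, add_bracket, hamiltonian_bracket, backgroundHamiltonian_eq, background_bracket,
    sub_eq_add_neg]

theorem deformedTwisted_anchor (x : L × Module.Dual R L) :
    (deformedTwisted A π N σ H).anchor x = A.anchor (N x.1 + π.sharp x.2) := by
  rw [deform_anchor, twisted_anchor, quasiEnd_apply]

theorem deformedTwisted_bracket_fst (x y : L × Module.Dual R L) :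
    ((deformedTwisted A π N σ H).bracket x y).1 =
      A.bracket (N x.1 + π.sharp x.2) y.1 + A.bracket x.1 (N y.1 + π.sharp y.2) -
        N (A.bracket x.1 y.1) - π.sharp
          (A.lieDer x.1 y.2 - A.lieDer y.1 x.2 + A.dFun (x.2 y.1) - contract₂ H x.1 y.1) := by
  simp only [deform_bracket, twisted_bracket, quasiEnd_apply, Prod.fst_add, Prod.fst_sub]
  abel

theorem deformedTwisted_bracket_snd (x y : L × Module.Dual R L) (Z : L) :
    ((deformedTwisted A π N σ H).bracket x y).2 Z =
      (A.lieDer (N x.1 + π.sharp x.2) y.2 Z - A.lieDer y.1 (flat σ x.1 - N.dualMap x.2) Z +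
        A.anchor Z (flat σ x.1 y.1 - x.2 (N y.1)) -
        contract₂ H (N x.1 + π.sharp x.2) y.1 Z) +
      (A.lieDer x.1 (flat σ y.1 - N.dualMap y.2) Z - A.lieDer (N y.1 + π.sharp y.2) x.2 Z +
        A.anchor Z (x.2 (N y.1 + π.sharp y.2)) - contract₂ H x.1 (N y.1 + π.sharp y.2) Z) -
      flat σ (A.bracket x.1 y.1) Z + (A.lieDer x.1 y.2 (N Z) - A.lieDer y.1 x.2 (N Z) +
        A.anchor (N Z) (x.2 y.1) - contract₂ H x.1 y.1 (N Z)) := by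
  simp only [deform_bracket, twisted_bracket, quasiEnd_apply, Prod.snd_add, Prod.snd_sub,
    LinearMap.add_apply, LinearMap.sub_apply, LinearMap.dualMap_apply, dFun_apply]
  ring

theorem isPairingCompatible_twisted : (twisted A H).IsPairingCompatible :=
  (isPairingCompatible_hamiltonian A).add
    (isPairingCompatible_background (contract₂_swap_left H) (contract₂_swap_right H))

theorem isPairingCompatible_deformedTwisted : (deformedTwisted A π N σ H).IsPairingCompatible :=
  (isPairingCompatible_twisted A H).deform (pairing_quasiEnd π N σ)

variable {H} in
theorem commutes_twisted (hH : ∀ v, A.d H v = 0) : Commutes (twisted A H) (twisted A H) := by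
  have form_eq : (fun u : Fin 3 → L => contract₂ H (u 0) (u 1) (u 2)) = H := by
    funext u
    rw [contract₂_apply]
    congr 1
    ext i; fin_cases i <;> rfl
  have background_hamiltonian : Commutes (backgroundHamiltonian H) A.hamiltonian :=
    commutes_background_hamiltonian A (by rwa [form_eq])
  have background_background : Commutes (backgroundHamiltonian H) (backgroundHamiltonian H) :=
    commutes_background _ _
  exact ((commutes_hamiltonian A).add_left background_hamiltonian).add_right
    (background_hamiltonian.symm.add_left background_background)

theorem deformedTwisted_bracket_dual (α β : Module.Dual R L) :
    (deformedTwisted A π N σ H).bracket (0, α) (0, β) = (0, A.koszul π α β) := by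
  ext Z
  · rw [deformedTwisted_bracket_fst]; simp [lieDer_zero_left, dFun_zero]
  · rw [deformedTwisted_bracket_snd, koszul_apply, π.skew α β]; simp [lieDer_apply]; ring

variable {A π N σ H} {ψ : L [⋀^Fin 3]→ₗ[R] R}

theorem neg_contract₂_eq_d_flat (hψ : ∀ v, ψ v = -A.d σ v) (X Y Z : L) :
    -contract₂ ψ X Y Z = A.anchor X (flat σ Y Z) - flat σ (A.bracket X Y) Z -
      flat σ Y (A.bracket X Z) - (A.anchor Y (flat σ X Z) - flat σ X (A.bracket Y Z)) +
      A.anchor Z (flat σ X Y) := by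
  rw [contract₂_apply, hψ, d_two_form, neg_neg]
  rfl

theorem contract₂_eq_lieDer_flat (hψ : ∀ v, ψ v = -A.d σ v) (X Y : L) :
    contract₂ ψ X Y = A.lieDer Y (flat σ X) - A.lieDer X (flat σ Y) - A.dFun (flat σ X Y) +
      flat σ (A.bracket X Y) := by
  ext Z
  simp only [LinearMap.add_apply, LinearMap.sub_apply, lieDer_apply, dFun_apply]
  linear_combination -neg_contract₂_eq_d_flat hψ X Y Z

theorem deformedTwisted_bracket_vec_fst (X Y : L) :
    ((deformedTwisted A π N σ H).bracket (X, 0) (Y, 0)).1 =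
      (A.deform N).bracket X Y + π.sharp (contract₂ H X Y) := by
  rw [deformedTwisted_bracket_fst, deform_bracket]
  simp [lieDer_zero_right, dFun_zero]

theorem deformedTwisted_bracket_vec_snd (hψ : ∀ v, ψ v = -A.d σ v) (X Y : L) :
    ((deformedTwisted A π N σ H).bracket (X, 0) (Y, 0)).2 =
      -contract₂ ψ X Y - insertion N (contract₂ H) X Y := by
  ext Z
  rw [deformedTwisted_bracket_snd, LinearMap.sub_apply, LinearMap.neg_apply,
    neg_contract₂_eq_d_flat hψ, insertion_apply]
  simp [lieDer_apply]
  ring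

end Deformed

section DoublyDeformed

variable {R : Type*} [CommRing R] [Algebra ℝ R] {L : Type*} [AddCommGroup L] [Module R L]
  {A : LieAlgebroid R L} {π : Bivector R L} {N : Module.End R L} {σ : L [⋀^Fin 2]→ₗ[R] R}
  {ψ H : L [⋀^Fin 3]→ₗ[R] R}

theorem sharp_koszul (hsep : ∀ X : L, (∀ α : Module.Dual R L, α X = 0) → X = 0)
    (hπ : ∀ α β γ, A.schoutenSq π α β γ = 0) (α β : Module.Dual R L) :
    π.sharp (A.koszul π α β) = A.bracket (π.sharp α) (π.sharp β) := by
  refine sub_eq_zero.mp (hsep _ fun γ => ?_)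
  have half_schoutenSq := hπ α β γ
  rw [schoutenSq, two_mul] at half_schoutenSq
  replace half_schoutenSq := eq_zero_of_add_self_eq_zero R half_schoutenSq
  rw [map_sub, π.skew, koszul_apply]
  simp only [Bivector.eval] at half_schoutenSq
  rw [A.bracket_swap (π.sharp α) (π.sharp γ), map_neg, π.skew β γ, map_neg] at half_schoutenSq
  linear_combination -half_schoutenSq

theorem _root_.IsPoissonQuasiNijenhuis.apply_sharp (h : IsPoissonQuasiNijenhuis A π N ψ H)
    (α : Module.Dual R L) : N (π.sharp α) = π.sharp (N.dualMap α) :=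
  LinearMap.congr_fun h.comm α

theorem d_doubleBackground (h : IsPoissonQuasiNijenhuis A π N ψ H) (v : Fin 4 → L) :
    A.d (fun u : Fin 3 → L => doubleBackground N ψ H (u 0) (u 1) (u 2)) v = 0 := by
  have d_calH := h.d_psi v
  rw [calH_eq_doubleInsertion] at d_calH
  have d_sum : A.d (fun u : Fin 3 → L => doubleBackground N ψ H (u 0) (u 1) (u 2)) v =
      2 * (A.d (fun u : Fin 3 → L => doubleInsertion N (contract₂ H) (u 0) (u 1) (u 2)) v +
        A.d (fun u : Fin 3 → L => insertion N (contract₂ ψ) (u 0) (u 1) (u 2)) v) := by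
    simp only [d, doubleBackground_apply, map_add, two_mul,
      ← Finset.sum_add_distrib, ← mul_add]
    refine Finset.sum_congr rfl fun i _ => ?_
    simp only [Finset.sum_add_distrib]
    ring
  rw [d_sum, A.d_insertion N h.closed_psi v, ← d_calH]
  ring

theorem doublyDeformed_vec_fst (h : IsPoissonQuasiNijenhuis A π N ψ H)
    (hψ : ∀ v, ψ v = -A.d σ v) (X Y : L) :
    (((deformedTwisted A π N σ H).deform (quasiEnd π N σ)).bracket (X, 0) (Y, 0)).1 =
      (((twisted A H).deform (quasiSquare π N σ)).bracket (X, 0) (Y, 0)).1 := by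
  have torsion := h.torsion X Y
  have sharp_contract₂ := congrArg π.sharp (contract₂_eq_lieDer_flat hψ X Y)
  have insertion_eq : insertion N (contract₂ H) X Y =
    contract₂ H (N X) Y + contract₂ H X (N Y) + N.dualMap (contract₂ H X Y) := rfl
  have swap : contract₂ H (N Y) X = -contract₂ H X (N Y) :=
    LinearMap.ext (contract₂_swap_left H _ _)
  rw [deform_bracket (deformedTwisted A π N σ H), deform_bracket (twisted A H) (quasiSquare π N σ)]
  simp only [Prod.fst_add, Prod.fst_sub]
  rw [quasiEnd_apply _ _ _ ((deformedTwisted A π N σ H).bracket (X, 0) (Y, 0)),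
    deformedTwisted_bracket_vec_snd hψ, insertion_eq]
  simp only [deformedTwisted_bracket_fst, twisted_bracket, quasiEnd_apply, quasiSquare_apply,
    squareEnd_apply, map_zero, sub_zero, add_zero, neg_zero, lieDer_zero_right,
    LinearMap.zero_apply, dFun_zero, map_add, map_sub, map_neg, AddMonoidHom.add_apply,
    h.apply_sharp]
  rw [AnchoredBracket.torsion, deform_bracket, swap] at torsion
  simp only [map_add, map_sub, map_neg] at torsion sharp_contract₂
  linear_combination (norm := module) (2 : R) • torsion - sharp_contract₂

theorem doublyDeformed_vec_snd (hψ : ∀ v, ψ v = -A.d σ v) (X Y Z : L) :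
    (((deformedTwisted A π N σ H).deform (quasiEnd π N σ)).bracket (X, 0) (Y, 0)).2 Z =
      (((twisted A H).deform (quasiSquare π N σ)).bracket (X, 0) (Y, 0)).2 Z -
        doubleBackground N ψ H X Y Z := by
  rw [deform_bracket (deformedTwisted A π N σ H), deform_bracket (twisted A H) (quasiSquare π N σ)]
  simp only [Prod.snd_add, Prod.snd_sub, LinearMap.add_apply, LinearMap.sub_apply]
  rw [quasiEnd_apply _ _ _ ((deformedTwisted A π N σ H).bracket (X, 0) (Y, 0)),
    deformedTwisted_bracket_vec_fst]
  simp only [LinearMap.sub_apply, LinearMap.dualMap_apply, deformedTwisted_bracket_vec_snd hψ]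
  simp only [deformedTwisted_bracket_snd]
  simp only [twisted_bracket, quasiEnd_apply, quasiSquare_apply, squareEnd_apply, map_zero,
    sub_zero, add_zero, neg_zero, lieDer_apply, zero_sub, LinearMap.zero_apply, map_add, map_sub,
    map_neg, AddMonoidHom.add_apply, LinearMap.add_apply, LinearMap.sub_apply, LinearMap.neg_apply,
    LinearMap.dualMap_apply, dFun_apply, deform_bracket, doubleBackground_apply,
    doubleInsertion_apply, insertion_apply]
  rw [flat_swap σ Z (π.sharp (contract₂ H X Y)), π.skew]
  linear_combination -2 * neg_contract₂_eq_d_flat hψ (N X) Y Z -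
    2 * neg_contract₂_eq_d_flat hψ X (N Y) Z - neg_contract₂_eq_d_flat hψ X Y (N Z)

theorem doublyDeformed_dual_fst (hsep : ∀ X : L, (∀ α : Module.Dual R L, α X = 0) → X = 0)
    (hπ : ∀ α β γ, A.schoutenSq π α β γ = 0) (α β : Module.Dual R L) :
    (((deformedTwisted A π N σ H).deform (quasiEnd π N σ)).bracket (0, α) (0, β)).1 = 0 := by
  have sharp_koszul_eq := sharp_koszul hsep hπ α β
  have dFun_skew : A.dFun (α (π.sharp β)) = -A.dFun (β (π.sharp α)) := by
    rw [π.skew β α, dFun_neg]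
  rw [deform_bracket (deformedTwisted A π N σ H)]
  simp only [Prod.fst_add, Prod.fst_sub]
  rw [deformedTwisted_bracket_dual, quasiEnd_apply _ _ _ (0, A.koszul π α β)]
  simp only [deformedTwisted_bracket_fst, quasiEnd_apply, map_zero, sub_zero, add_zero, zero_add,
    zero_sub, AddMonoidHom.zero_apply, lieDer_zero_left, LinearMap.zero_apply, dFun_zero, map_add,
    map_neg, dFun_skew]
  rw [sharp_koszul_eq]
  rw [koszul] at sharp_koszul_eq
  simp only [Bivector.eval, map_sub] at sharp_koszul_eq
  linear_combination (norm := module) -sharp_koszul_eq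

theorem doublyDeformed_dual_snd (h : IsPoissonQuasiNijenhuis A π N ψ H) (α β : Module.Dual R L)
    (Z : L) :
    (((deformedTwisted A π N σ H).deform (quasiEnd π N σ)).bracket (0, α) (0, β)).2 Z = 0 := by
  have concomitant := LinearMap.congr_fun (h.concomitant α β) Z
  rw [deform_bracket (deformedTwisted A π N σ H)]
  simp only [Prod.snd_add, Prod.snd_sub, LinearMap.add_apply, LinearMap.sub_apply]
  rw [deformedTwisted_bracket_dual, quasiEnd_apply _ _ _ (0, A.koszul π α β)]
  rw [AnchoredBracket.concomitant] at concomitant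
  simp only [deformedTwisted_bracket_snd]
  simp only [quasiEnd_apply, map_zero, sub_zero, add_zero, zero_add, zero_sub,
    AddMonoidHom.zero_apply, lieDer_apply, LinearMap.zero_apply, map_add, map_sub, koszul_apply,
    LinearMap.dualMap_apply, map_neg, h.apply_sharp, deform_bracket, deform_anchor,
    LinearMap.sub_apply, LinearMap.add_apply, LinearMap.neg_apply, LinearMap.smul_apply,
    add_neg_cancel, Derivation.coe_zero, Pi.zero_apply] at concomitant ⊢
  rw [π.skew β α, π.skew (N.dualMap β) α, LinearMap.dualMap_apply, h.apply_sharp, map_neg, map_neg]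
  linear_combination concomitant

theorem deform_deformedTwisted (hsep : ∀ X : L, (∀ α : Module.Dual R L, α X = 0) → X = 0)
    (h : IsPoissonQuasiNijenhuis A π N ψ H) (hψ : ∀ v, ψ v = -A.d σ v) :
    (deformedTwisted A π N σ H).deform (quasiEnd π N σ) =
      (twisted A H).deform (quasiSquare π N σ) + background (doubleBackground N ψ H) := by
  refine ((isPairingCompatible_deformedTwisted A π N σ H).deform (pairing_quasiEnd π N σ)).ext hsep
    (((isPairingCompatible_twisted A H).deform (pairing_quasiSquare π N σ)).add
      (isPairingCompatible_background (doubleBackground_swap_left N ψ H)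
        (doubleBackground_swap_right N ψ H))) (LinearMap.ext fun x => ?anchor) (fun X Y => ?vec)
    (fun α β => ?dual)
  case anchor =>
    rw [deform_anchor, deformedTwisted_anchor, add_anchor, deform_anchor, twisted_anchor,
      background_anchor, quasiEnd_apply, quasiSquare_apply, squareEnd_apply, add_zero]
    congr 1
    simp only [map_add, map_sub, h.apply_sharp]
    abel
  case vec =>
    rw [add_bracket, background_bracket]
    refine Prod.ext ?_ (LinearMap.ext fun Z => ?_)
    · rw [doublyDeformed_vec_fst h hψ, Prod.fst_add, add_zero]
    · rw [doublyDeformed_vec_snd hψ, Prod.snd_add, LinearMap.add_apply, LinearMap.neg_apply,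
        sub_eq_add_neg]
  case dual =>
    rw [add_bracket, background_bracket, deform_bracket (twisted A H)]
    refine Prod.ext ?_ (LinearMap.ext fun Z => ?_)
    · rw [doublyDeformed_dual_fst hsep h.poisson]
      simp [twisted_bracket, quasiSquare_apply, lieDer_zero_left, dFun_zero]
    · rw [doublyDeformed_dual_snd h]
      simp [twisted_bracket, quasiSquare_apply, lieDer_zero_left, dFun_zero]

theorem isCourant_deformedTwisted (hsep : ∀ X : L, (∀ α : Module.Dual R L, α X = 0) → X = 0)
    (h : IsPoissonQuasiNijenhuis A π N ψ H) (hψ : ∀ v, ψ v = -A.d σ v) :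
    IsCourant (deformedTwisted A π N σ H) := by
  have master : Commutes (twisted A H) (twisted A H) := commutes_twisted A h.closed_H
  have background_twisted : Commutes (background (doubleBackground N ψ H)) (twisted A H) :=
    (commutes_background_hamiltonian A (d_doubleBackground h)).add_right (commutes_background _ _)
  have twice_deformed_twisted :
      Commutes ((deformedTwisted A π N σ H).deform (quasiEnd π N σ)) (twisted A H) := by
    rw [deform_deformedTwisted hsep h hψ]
    exact (master.deform_self _).add_left background_twisted
  have deformed_master := master.deform_deform twice_deformed_twisted
  have compatible := isPairingCompatible_deformedTwisted A π N σ H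
  exact ⟨compatible.pairing_invariant, compatible.bracket_symm, deformed_master.jacobi,
    deformed_master.anchor_bracket⟩

end DoublyDeformed

end AnchoredBracket

namespace ValuedForms

theorem IsHom.ext_interior {R : Type*} [CommRing R] {L : Type*} [AddCommGroup L] [Module R L]
    {p : ℕ} {ξ η : ValuedForms R L R} (hξ : IsHom (p + 1) ξ) (hη : IsHom (p + 1) η)
    (h : ∀ X, ValuedForms.interior X ξ = ValuedForms.interior X η) : ξ = η :=
  ValuedForms.ext_interior
    ((hξ.apply_ne p.succ_ne_zero.symm).trans (hη.apply_ne p.succ_ne_zero.symm).symm) h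

theorem interior_interior_three {R : Type*} [CommRing R] {L : Type*} [AddCommGroup L] [Module R L]
    (φ : L [⋀^Fin 3]→ₗ[R] R) (X Y : L) :
    interior Y (interior X (of φ)) = cov (contract₂ φ X Y) := by
  rw [interior_of_succ, interior_of_succ]
  congr 1
  ext v
  rw [AlternatingMap.ofSubsingleton_apply_apply, contract₂_apply]
  simp only [AlternatingMap.curryLeft_apply_apply]
  congr 1
  ext i; fin_cases i <;> rfl

section KoszulOfFunction

variable {R : Type*} [CommRing R] [Algebra ℝ R] {L : Type*} [AddCommGroup L] [Module R L]
  {S : AnchoredBracket R L} (hS : ∀ X, S.bracket X X = 0) (π : Bivector R L)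

theorem koszulBracket_fn (f : R) (ξ : ValuedForms R L R) :
    koszulBracket hS π (fn f) ξ = interior (π.sharp (S.dFun f)) ξ := by
  rw [koszulBracket_apply, pair_zero_left π (isHom_of _), diff_fn, pair_cov,
    pair_zero_left π (isHom_of (Forms.zeroForm f)).invol]
  simp

theorem koszulBracket_two_fn {ξ : ValuedForms R L R} (hξ : IsHom 2 ξ) (f : R) :
    koszulBracket hS π ξ (fn f) = interior (π.sharp (S.dFun f)) ξ := by
  rw [koszulBracket_skew hS π hξ (isHom_of _), koszulBracket_fn]
  simp [pow_succ]

theorem koszulBracket_three_fn {ξ : ValuedForms R L R} (hξ : IsHom 3 ξ) (f : R) :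
    koszulBracket hS π ξ (fn f) = -interior (π.sharp (S.dFun f)) ξ := by
  rw [koszulBracket_skew hS π hξ (isHom_of _), koszulBracket_fn]
  simp [pow_succ]

end KoszulOfFunction

end ValuedForms

namespace AnchoredBracket

section QuasiForm

variable {R : Type*} [CommRing R] {L : Type*} [AddCommGroup L] [Module R L]

/-- The 3-form `(X, Y, Z) ↦ t X Y Z` of a bilinear map `t` with values in 1-forms. -/
def threeFormOfContraction (t : L →ₗ[R] L →ₗ[R] Module.Dual R L) (left : ∀ X Z, t X X Z = 0)
    (right : ∀ X Z, t X Z Z = 0) : L [⋀^Fin 3]→ₗ[R] R :=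
  { MultilinearMap.mk' (fun v : Fin 3 → L => t (v 0) (v 1) (v 2))
      (fun v i X Y => by fin_cases i <;> simp [Function.update])
      (fun v i f X => by fin_cases i <;> simp [Function.update]) with
    map_eq_zero_of_eq' := fun v i j hv hij => by
      have outer : ∀ X Z, t X Z X = 0 := fun X Z => by
        have polarised := left (X + Z) X
        simpa [left, right] using polarised
      change t (v 0) (v 1) (v 2) = 0
      fin_cases i <;> fin_cases j <;> simp_all }

theorem contract₂_self_left (H : L [⋀^Fin 3]→ₗ[R] R) (X Z : L) : contract₂ H X X Z = 0 :=
  H.map_eq_zero_of_eq ![X, X, Z] (i := 0) (j := 1) rfl (by decide)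

theorem contract₂_self_right (H : L [⋀^Fin 3]→ₗ[R] R) (X Z : L) : contract₂ H X Z Z = 0 :=
  H.map_eq_zero_of_eq ![X, Z, Z] (i := 1) (j := 2) rfl (by decide)

/-- The 3-form `-ψ(X, Y, Z) - H(NX, Y, Z) - H(X, NY, Z) - H(X, Y, NZ)`, which is the form `φ` of
the quasi-bialgebroid. -/
def quasiForm (N : Module.End R L) (H ψ : L [⋀^Fin 3]→ₗ[R] R) : L [⋀^Fin 3]→ₗ[R] R :=
  -ψ - threeFormOfContraction (insertion N (contract₂ H))
    (fun X Z => by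
      rw [insertion_apply, contract₂_swap_left H X (N X), contract₂_self_left]
      ring)
    (fun X Z => by
      rw [insertion_apply, contract₂_swap_right H X Z (N Z), contract₂_self_right]
      ring)

theorem contract₂_quasiForm (N : Module.End R L) (H ψ : L [⋀^Fin 3]→ₗ[R] R) (X Y : L) :
    contract₂ (quasiForm N H ψ) X Y = -contract₂ ψ X Y - insertion N (contract₂ H) X Y := rfl

end QuasiForm

section Structure

variable {R : Type*} [CommRing R] [Algebra ℝ R] {L : Type*} [AddCommGroup L] [Module R L]
  (A : LieAlgebroid R L) (π : Bivector R L) (N : Module.End R L) (H : L [⋀^Fin 3]→ₗ[R] R)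

/-- The bracket `[X, Y]_N + π♯ H(X, Y, ·)` on `A`, with anchor `ρ ∘ N`. -/
def quasiBracket : AnchoredBracket R L where
  anchor := A.anchor ∘ₗ N
  bracket := AddMonoidHom.mk' (fun X => AddMonoidHom.mk'
      (fun Y => (A.deform N).bracket X Y + π.sharp (contract₂ H X Y))
      (fun Y Z => by simp only [map_add]; abel))
    (fun X Y => by
      ext Z
      simp only [map_add, AddMonoidHom.add_apply, LinearMap.add_apply, AddMonoidHom.mk'_apply]
      abel)
  leibniz X Y f := by
    simp only [AddMonoidHom.mk'_apply, (A.deform N).leibniz, map_smul, smul_add]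
    rw [deform_anchor, LinearMap.comp_apply]
    abel

theorem quasiBracket_bracket (X Y : L) : (quasiBracket A π N H).bracket X Y =
    (A.deform N).bracket X Y + π.sharp (contract₂ H X Y) := rfl

theorem quasiBracket_anchor (X : L) : (quasiBracket A π N H).anchor X = A.anchor (N X) := rfl

theorem quasiBracket_dFun (f : R) : (quasiBracket A π N H).dFun f = N.dualMap (A.dFun f) := rfl

theorem quasiBracket_self (X : L) : (quasiBracket A π N H).bracket X X = 0 := by
  have contract₂_self : contract₂ H X X = 0 := LinearMap.ext (contract₂_self_left H X)
  rw [quasiBracket_bracket, deform_bracket, contract₂_self, map_zero, A.bracket_self,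
    A.bracket_swap X (N X)]
  simp

/-- The Koszul bracket on `A*`, with anchor `ρ ∘ π♯`. -/
def dualBracket : AnchoredBracket R (Module.Dual R L) where
  anchor := A.anchor ∘ₗ π.sharp
  bracket := AddMonoidHom.mk' (fun α => AddMonoidHom.mk' (fun β => A.koszul π α β)
      (fun β γ => by
        ext Z
        simp only [koszul_apply, map_add, LinearMap.add_apply, AddMonoidHom.add_apply,
          Derivation.add_apply]
        ring))
    (fun α β => by
      ext γ Z
      simp only [koszul_apply, map_add, LinearMap.add_apply, AddMonoidHom.add_apply,
        AddMonoidHom.mk'_apply, Derivation.add_apply]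
      ring)
  leibniz α β f := by
    ext Z
    simp only [AddMonoidHom.mk'_apply, koszul_apply, map_smul, LinearMap.smul_apply,
      LinearMap.add_apply, smul_eq_mul, Derivation.leibniz, Derivation.smul_apply,
      bracket_smul_left A.bracket_self, map_sub, LinearMap.comp_apply, π.skew α β]
    ring

theorem dualBracket_bracket (α β : Module.Dual R L) :
    (dualBracket A π).bracket α β = A.koszul π α β := rfl

end Structure

section Components

variable {R : Type*} [CommRing R] [Algebra ℝ R] {L : Type*} [AddCommGroup L] [Module R L]
  {A : LieAlgebroid R L} {π : Bivector R L} {N : Module.End R L}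
  {σ : L [⋀^Fin 2]→ₗ[R] R} {H ψ : L [⋀^Fin 3]→ₗ[R] R}

theorem deformedTwisted_bracket_vec (hψ : ∀ v, ψ v = -A.d σ v) (X Y : L) :
    (deformedTwisted A π N σ H).bracket (X, 0) (Y, 0) =
      ((quasiBracket A π N H).bracket X Y, contract₂ (quasiForm N H ψ) X Y) :=
  Prod.ext (deformedTwisted_bracket_vec_fst X Y)
    ((deformedTwisted_bracket_vec_snd hψ X Y).trans (contract₂_quasiForm N H ψ X Y).symm)

theorem deformedTwisted_bracket_dual_vec (α : Module.Dual R L) (X : L) :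
    (deformedTwisted A π N σ H).bracket (0, α) (X, 0) =
      (ValuedForms.dualLie (S := A.toAnchoredBracket) π α X,
        (quasiBracket A π N H).dFun (α X) - (quasiBracket A π N H).lieDer X α) := by
  refine Prod.ext ?_ (LinearMap.ext fun Z => ?_)
  · rw [deformedTwisted_bracket_fst, ValuedForms.dualLie]
    simp only [map_zero, zero_add, AddMonoidHom.zero_apply, add_zero, lieDer_zero_right, zero_sub,
      LinearMap.zero_apply, sub_zero, map_add, map_sub, map_neg]
    abel
  · rw [deformedTwisted_bracket_snd]
    simp only [map_zero, zero_add, AddMonoidHom.zero_apply, add_zero, lieDer_apply, zero_sub,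
      LinearMap.zero_apply, sub_zero, map_add, map_sub, map_neg, LinearMap.sub_apply,
      quasiBracket_anchor, dFun_apply, quasiBracket_bracket, deform_bracket, LinearMap.neg_apply,
      LinearMap.dualMap_apply, Derivation.coe_zero, Pi.zero_apply, π.skew (contract₂ H X Z) α]
    linear_combination -contract₂_swap_left H X (π.sharp α) Z +
      contract₂_swap_right H X (π.sharp α) Z

theorem deformedTwisted_bracket_vec_dual_snd (X : L) (α : Module.Dual R L) :
    ((deformedTwisted A π N σ H).bracket (X, 0) (0, α)).2 = (quasiBracket A π N H).lieDer X α := by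
  ext Z
  rw [deformedTwisted_bracket_snd]
  simp only [map_zero, zero_add, AddMonoidHom.zero_apply, add_zero, lieDer_apply, zero_sub,
    LinearMap.zero_apply, sub_zero, map_add, map_sub, map_neg, quasiBracket_anchor,
    quasiBracket_bracket, deform_bracket, LinearMap.neg_apply, LinearMap.dualMap_apply,
    Derivation.coe_zero, Pi.zero_apply, π.skew (contract₂ H X Z) α]
  linear_combination -contract₂_swap_right H X (π.sharp α) Z

theorem deformedTwisted_bracket_dual_left_snd (α γ : Module.Dual R L) (X : L) :
    ((deformedTwisted A π N σ H).bracket (0, α) (X, γ)).2 =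
      (quasiBracket A π N H).dFun (α X) - (quasiBracket A π N H).lieDer X α + A.koszul π α γ := by
  rw [show (X, γ) = (X, (0 : Module.Dual R L)) + (0, γ) by simp, map_add, Prod.snd_add,
    deformedTwisted_bracket_dual_vec, deformedTwisted_bracket_dual]

theorem deformedTwisted_bracket_vec_left_snd (hψ : ∀ v, ψ v = -A.d σ v) (X Y : L)
    (γ : Module.Dual R L) : ((deformedTwisted A π N σ H).bracket (X, 0) (Y, γ)).2 =
      contract₂ (quasiForm N H ψ) X Y + (quasiBracket A π N H).lieDer X γ := by
  rw [show (Y, γ) = (Y, (0 : Module.Dual R L)) + (0, γ) by simp, map_add, Prod.snd_add,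
    deformedTwisted_bracket_vec hψ, deformedTwisted_bracket_vec_dual_snd]

theorem deformedTwisted_bracket_vec_right_snd (hψ : ∀ v, ψ v = -A.d σ v) (X Y : L)
    (γ : Module.Dual R L) : ((deformedTwisted A π N σ H).bracket (X, γ) (Y, 0)).2 =
      contract₂ (quasiForm N H ψ) X Y +
        ((quasiBracket A π N H).dFun (γ Y) - (quasiBracket A π N H).lieDer Y γ) := by
  rw [show (X, γ) = (X, (0 : Module.Dual R L)) + (0, γ) by simp, map_add, AddMonoidHom.add_apply,
    Prod.snd_add, deformedTwisted_bracket_vec hψ, deformedTwisted_bracket_dual_vec]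

end Components

open ValuedForms

section QuasiDifferential

variable {R : Type*} [CommRing R] [Algebra ℝ R] {L : Type*} [AddCommGroup L] [Module R L]
  {A : LieAlgebroid R L} {π : Bivector R L} {N : Module.End R L}
  {σ : L [⋀^Fin 2]→ₗ[R] R} {H ψ : L [⋀^Fin 3]→ₗ[R] R}

local notation "S_N" => quasiBracket A π N H
local notation "δ_N" => diff (quasiBracket_self A π N H)
local notation "B_π" => koszulBracket A.bracket_self π
local notation "φ_N" => quasiForm N H ψ

theorem koszulBracket_quasiDiff_fn_fn (hc : ∀ α, N (π.sharp α) = π.sharp (N.dualMap α))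
    (f g : R) : B_π (δ_N (fn f)) (fn g) = B_π (fn f) (δ_N (fn g)) := by
  rw [diff_fn, diff_fn, koszulBracket_cov_fn, koszulBracket_fn, interior_cov, quasiBracket_dFun,
    ← hc]
  rfl

theorem anchor_dualLie (hC : IsCourant (deformedTwisted A π N σ H)) (α : Module.Dual R L) (X : L)
    (f : R) : A.anchor (N (dualLie (S := A.toAnchoredBracket) π α X) +
        π.sharp ((S_N).dFun (α X) - (S_N).lieDer X α)) f =
      A.anchor (π.sharp α) (A.anchor (N X) f) - A.anchor (N X) (A.anchor (π.sharp α) f) := by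
  have anchor_bracket := DFunLike.congr_fun (hC.anchor_bracket (0, α) (X, 0)) f
  rw [deformedTwisted_bracket_dual_vec, deformedTwisted_anchor, Derivation.commutator_apply,
    deformedTwisted_anchor, deformedTwisted_anchor] at anchor_bracket
  simpa using anchor_bracket

theorem quasiDiff_koszulBracket_cov_fn (hC : IsCourant (deformedTwisted A π N σ H))
    (α : Module.Dual R L) (f : R) :
    δ_N (B_π (cov α) (fn f)) = B_π (δ_N (cov α)) (fn f) + B_π (cov α) (δ_N (fn f)) := by
  have hα : IsHom 1 (cov α) := isHom_of _
  have hf : IsHom 0 (fn f : ValuedForms R L R) := isHom_of _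
  refine IsHom.ext_interior (p := 0) ?_ ?_ fun X => ?_
  · exact (hα.koszulBracket A.bracket_self π hf (n := 0) rfl).diff _
  · exact ((hα.diff _).koszulBracket A.bracket_self π hf (n := 1) rfl).add
      (hα.koszulBracket A.bracket_self π (hf.diff _) (n := 1) rfl)
  have anchor_eq := anchor_dualLie hC α X f
  have skew_eq := π.skew ((S_N).dFun (α X) - (S_N).lieDer X α) (A.dFun f)
  rw [koszulBracket_cov_fn, diff_fn, koszulBracket_two_fn _ _ (hα.diff _), interior_diff_cov,
    diff_fn, map_add, interior_koszulBracket_cov, interior_cov, interior_cov, interior_cov,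
    koszulBracket_cov_fn, interior_cov, ← fn_sub, ← fn_add]
  congr 1
  simp only [dFun_apply, lieDer_apply, LinearMap.sub_apply, quasiBracket_anchor, map_add, map_sub,
    Derivation.add_apply, Derivation.sub_apply] at anchor_eq skew_eq ⊢
  rw [bracket_skew (quasiBracket_self A π N H) X (π.sharp (A.dFun f)), map_neg]
  linear_combination anchor_eq - skew_eq

theorem quasiDiff_koszulBracket_cov_cov (hC : IsCourant (deformedTwisted A π N σ H))
    (α β : Module.Dual R L) :
    δ_N (B_π (cov α) (cov β)) = B_π (δ_N (cov α)) (cov β) + B_π (cov α) (δ_N (cov β)) := by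
  have hα : IsHom 1 (cov α) := isHom_of _
  have hβ : IsHom 1 (cov β) := isHom_of _
  refine IsHom.ext_interior (p := 1) ?_ ?_ fun X => ?_
  · exact (hα.koszulBracket A.bracket_self π hβ (n := 1) rfl).diff _
  · exact ((hα.diff _).koszulBracket A.bracket_self π hβ (n := 2) rfl).add
      (hα.koszulBracket A.bracket_self π (hβ.diff _) (n := 2) rfl)
  have koszul_sub_swap : ∀ α β γ, A.koszul π α (β - γ) = -A.koszul π α (γ - β) :=
    fun α β γ => by rw [← neg_sub, ← dualBracket_bracket, map_neg, dualBracket_bracket]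
  have jacobi := congrArg Prod.snd (hC.jacobi (0, α) (0, β) (X, 0))
  rw [Prod.snd_add, deformedTwisted_bracket_dual_vec, deformedTwisted_bracket_dual_vec,
    deformedTwisted_bracket_dual, deformedTwisted_bracket_dual_vec,
    deformedTwisted_bracket_dual_left_snd, deformedTwisted_bracket_dual_left_snd, koszul_sub_swap,
    koszul_sub_swap β] at jacobi
  rw [koszulBracket_skew A.bracket_self π (hα.diff _) hβ, koszulBracket_cov_cov, map_add, map_neg,
    map_smul, interior_diff_cov, interior_koszulBracket_cov, interior_koszulBracket_cov,
    interior_diff_cov, interior_diff_cov, interior_diff_cov, interior_diff_cov,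
    koszulBracket_cov_cov, koszulBracket_cov_cov]
  rw [show (-1 : R) ^ ((1 + 1 + 1) * (1 + 1)) = 1 by norm_num, one_smul, ← cov_sub, ← cov_neg,
    ← cov_sub, ← cov_add]
  congr 1
  linear_combination (norm := module) jacobi

theorem quasiDiff_quasiDiff_fn (hC : IsCourant (deformedTwisted A π N σ H))
    (hψ : ∀ v, ψ v = -A.d σ v) (f : R) : δ_N (δ_N (fn f)) = B_π (of (φ_N)) (fn f) := by
  have hf : IsHom 0 (fn f : ValuedForms R L R) := isHom_of _
  have hφ : IsHom 3 (of (φ_N)) := isHom_of _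
  have diff_diff : IsHom 2 (δ_N (δ_N (fn f))) := (hf.diff _).diff _
  have koszul_φ : IsHom 2 (B_π (of (φ_N)) (fn f)) := hφ.koszulBracket A.bracket_self π hf rfl
  refine IsHom.ext_interior diff_diff koszul_φ fun X =>
    IsHom.ext_interior (diff_diff.interior X) (koszul_φ.interior X) fun Y => ?_
  have anchor_bracket := DFunLike.congr_fun (hC.anchor_bracket (X, 0) (Y, 0)) f
  rw [deformedTwisted_bracket_vec hψ, deformedTwisted_anchor, Derivation.commutator_apply,
    deformedTwisted_anchor, deformedTwisted_anchor] at anchor_bracket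
  rw [koszulBracket_three_fn _ _ hφ, map_neg, map_neg,
    ValuedForms.interior_interior X (π.sharp (A.dFun f)), map_neg, neg_neg,
    ValuedForms.interior_interior Y (π.sharp (A.dFun f)), interior_interior_three, interior_cov,
    diff_fn, interior_diff_cov, interior_cov, ← fn_neg]
  congr 1
  rw [← π.skew (contract₂ (φ_N) X Y) (A.dFun f)]
  simp only [dFun_apply, lieDer_apply, LinearMap.sub_apply, quasiBracket_anchor, map_add, map_zero,
    add_zero, Derivation.add_apply] at anchor_bracket ⊢
  linear_combination -anchor_bracket

theorem quasiDiff_quasiDiff_cov (hC : IsCourant (deformedTwisted A π N σ H))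
    (hψ : ∀ v, ψ v = -A.d σ v) (α : Module.Dual R L) :
    δ_N (δ_N (cov α)) = B_π (of (φ_N)) (cov α) := by
  have hα : IsHom 1 (cov α) := isHom_of _
  have hφ : IsHom 3 (of (φ_N)) := isHom_of _
  have diff_diff : IsHom 3 (δ_N (δ_N (cov α))) := (hα.diff _).diff _
  have koszul_φ : IsHom 3 (B_π (of (φ_N)) (cov α)) := hφ.koszulBracket A.bracket_self π hα rfl
  refine IsHom.ext_interior diff_diff koszul_φ fun X =>
    IsHom.ext_interior (diff_diff.interior X) (koszul_φ.interior X) fun Y => ?_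
  have sub_swap : ∀ X,
      (S_N).dFun (α X) - (S_N).lieDer X α = -((S_N).lieDer X α - (S_N).dFun (α X)) :=
    fun X => (neg_sub _ _).symm
  have jacobi := congrArg Prod.snd (hC.jacobi (0, α) (X, 0) (Y, 0))
  rw [Prod.snd_add, deformedTwisted_bracket_dual_vec, deformedTwisted_bracket_dual_vec,
    deformedTwisted_bracket_vec hψ, deformedTwisted_bracket_dual_left_snd,
    deformedTwisted_bracket_vec_left_snd hψ, deformedTwisted_bracket_vec_right_snd hψ] at jacobi
  simp only [sub_swap, lieDer_neg_right, LinearMap.neg_apply, dFun_neg] at jacobi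
  rw [koszulBracket_skew A.bracket_self π hφ hα, map_neg, map_smul, map_neg, map_smul,
    interior_koszulBracket_cov, map_sub, interior_koszulBracket_cov, interior_interior_three,
    interior_interior_three, interior_interior_three, koszulBracket_cov_cov,
    interior_diff, map_sub, interior_lie, interior_diff_cov, interior_diff_cov, interior_diff_cov,
    lie_cov, interior_diff_cov]
  rw [show (-1 : R) ^ ((3 + 1) * (1 + 1)) = 1 by norm_num, one_smul, ← cov_sub, ← cov_sub,
    ← cov_sub, ← cov_sub, ← cov_neg]
  congr 1
  linear_combination (norm := module) jacobi

theorem quasiDiff_quasiForm (hC : IsCourant (deformedTwisted A π N σ H))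
    (hψ : ∀ v, ψ v = -A.d σ v) : δ_N (of (φ_N)) = 0 := by
  have diff_φ : IsHom 4 (δ_N (of (φ_N))) := (isHom_of _).diff _
  refine IsHom.ext_interior diff_φ (isHom_zero 4) fun X =>
    IsHom.ext_interior (diff_φ.interior X) ((isHom_zero 4).interior X) fun Y =>
    IsHom.ext_interior ((diff_φ.interior X).interior Y)
      (((isHom_zero 4).interior X).interior Y) fun Z => ?_
  have jacobi := congrArg Prod.snd (hC.jacobi (X, 0) (Y, 0) (Z, 0))
  rw [Prod.snd_add, deformedTwisted_bracket_vec hψ, deformedTwisted_bracket_vec hψ,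
    deformedTwisted_bracket_vec hψ, deformedTwisted_bracket_vec_left_snd hψ,
    deformedTwisted_bracket_vec_left_snd hψ, deformedTwisted_bracket_vec_right_snd hψ] at jacobi
  rw [interior_diff, map_sub, map_sub, interior_lie, interior_diff, map_sub, map_sub, interior_lie,
    interior_lie, interior_interior_three, interior_interior_three, interior_interior_three,
    interior_interior_three, interior_interior_three, interior_interior_three, interior_diff_cov,
    lie_cov, lie_cov, map_zero, map_zero, map_zero, ← cov_zero]
  simp only [← cov_sub]
  congr 1
  linear_combination (norm := module) jacobi

end QuasiDifferential

section DefinesQuasiBialgebroid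

variable {R : Type*} [CommRing R] [Algebra ℝ R] {L : Type*} [AddCommGroup L] [Module R L]
  {A : LieAlgebroid R L} {π : Bivector R L} {N : Module.End R L}
  {σ : L [⋀^Fin 2]→ₗ[R] R} {H ψ : L [⋀^Fin 3]→ₗ[R] R}

theorem koszul_jacobi (hC : IsCourant (deformedTwisted A π N σ H)) (α β γ : Module.Dual R L) :
    A.koszul π α (A.koszul π β γ) =
      A.koszul π (A.koszul π α β) γ + A.koszul π β (A.koszul π α γ) := by
  simpa only [deformedTwisted_bracket_dual, Prod.snd_add] using
    congrArg Prod.snd (hC.jacobi (0, α) (0, β) (0, γ))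

theorem anchor_koszul (hC : IsCourant (deformedTwisted A π N σ H)) (α β : Module.Dual R L) :
    A.anchor (π.sharp (A.koszul π α β)) = ⁅A.anchor (π.sharp α), A.anchor (π.sharp β)⁆ := by
  simpa only [deformedTwisted_bracket_dual, deformedTwisted_anchor, map_zero, zero_add] using
    hC.anchor_bracket (0, α) (0, β)

/-- The Lie algebroid `A*` with the Koszul bracket. -/
def dualLieAlgebroid (hC : IsCourant (deformedTwisted A π N σ H)) :
    LieAlgebroid R (Module.Dual R L) where
  toAnchoredBracket := dualBracket A π
  bracket_self α := by
    ext Z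
    rw [dualBracket_bracket, koszul_apply, π.alt]
    simp
  jacobi := koszul_jacobi hC
  anchor_bracket := anchor_koszul hC

theorem isGerstenhaber_koszulBracket (hL : LocallyFramed R L)
    (hC : IsCourant (deformedTwisted A π N σ H)) :
    IsGerstenhaber (koszulBracket A.bracket_self π) where
  degree_zero P Q := by
    obtain ⟨f, hf⟩ := exists_fn (isHom_of P)
    obtain ⟨g, hg⟩ := exists_fn (isHom_of Q)
    exact (congrArg₂ (fun ξ η => koszulBracket A.bracket_self π ξ η) hf hg).trans
      (koszulBracket_fn_fn _ _ f g)
  degree p q n P Q hn := (isHom_of P).koszulBracket A.bracket_self π (isHom_of Q) hn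
  skew p q P Q := by
    rw [real_neg_one_pow_smul]
    exact koszulBracket_skew A.bracket_self π (isHom_of P) (isHom_of Q)
  leibniz p q P Q T := by
    have map_mul :=
      (isGradedDerivation_koszulBracket A.bracket_self π (isHom_of P)).map_mul (of Q) T
    rw [(isHom_of Q).invol_pow_eq, map_smul, LinearMap.smul_apply] at map_mul
    rw [real_neg_one_pow_smul]
    exact map_mul
  jacobi p q P Q T := by
    rw [real_neg_one_pow_smul]
    convert koszulBracket_jacobi (hS := A.bracket_self) (π := π) hL
      (fun α β f => by rw [anchor_koszul hC, Derivation.commutator_apply]) (koszul_jacobi hC)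
      (isHom_of P) (isHom_of Q) T

/-- The Lie quasi-bialgebroid structure on `(A*, A)` encoded by the deformed structure `S_J`. -/
def lieQuasiBialgebroid (hL : LocallyFramed R L) (hc : ∀ α, N (π.sharp α) = π.sharp (N.dualMap α))
    (hψ : ∀ v, ψ v = -A.d σ v) (hC : IsCourant (deformedTwisted A π N σ H)) :
    LieQuasiBialgebroid R L where
  lie := dualLieAlgebroid hC
  gerst := koszulBracket A.bracket_self π
  δ := diff (quasiBracket_self A π N H)
  φ := quasiForm N H ψ
  isGerstenhaber := isGerstenhaber_koszulBracket hL hC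
  gerst_fun := koszulBracket_cov_fn A.bracket_self π
  gerst_one := koszulBracket_cov_cov π A.bracket_self
  δ_degree p P := (isHom_of P).diff _
  δ_wedge p P T := by
    rw [real_neg_one_pow_smul]
    refine (diff_mul _ _ _).trans ?_
    rw [(isHom_of P).invol_eq, map_smul]
    rfl
  δ_gerst p P T := by
    rw [real_neg_one_pow_smul]
    exact derivation_koszulBracket hL (isGradedDerivation_diff _) (fun _ _ hP => hP.diff _)
      (koszulBracket_quasiDiff_fn_fn hc) (quasiDiff_koszulBracket_cov_fn hC)
      (quasiDiff_koszulBracket_cov_cov hC) (isHom_of P) T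
  δ_sq T := derivation_sq hL (isGradedDerivation_diff _) (isHom_of _)
    (quasiDiff_quasiDiff_fn hC hψ) (quasiDiff_quasiDiff_cov hC hψ) T
  δ_φ := quasiDiff_quasiForm hC hψ

theorem exists_diff_cov_eq_of {S : AnchoredBracket R L} (hS : ∀ X, S.bracket X X = 0)
    (α : Module.Dual R L) : ∃ P : L [⋀^Fin 2]→ₗ[R] R, diff hS (cov α) = of P ∧ ∀ X Y,
      P ![X, Y] = S.anchor X (α Y) - S.anchor Y (α X) - α (S.bracket X Y) := by
  refine ⟨_, diff_of hS _, fun X Y => ?_⟩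
  have interior_eq := interior_diff_cov (hS := hS) X α
  rw [diff_of, interior_of_succ] at interior_eq
  have apply_eq := DFunLike.congr_fun (of_injective interior_eq) ![Y]
  rw [AlternatingMap.curryLeft_apply_apply, AlternatingMap.ofSubsingleton_apply_apply,
    LinearMap.sub_apply, lieDer_apply, dFun_apply] at apply_eq
  refine apply_eq.trans ?_
  simp only [Matrix.cons_val]
  ring

theorem definesLieQuasiBialgebroid (hL : LocallyFramed R L)
    (hc : ∀ α, N (π.sharp α) = π.sharp (N.dualMap α))
    (hψ : ∀ v, ψ v = -A.d σ v) (hC : IsCourant (deformedTwisted A π N σ H)) :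
    DefinesLieQuasiBialgebroid (deformedTwisted A π N σ H) := by
  refine ⟨lieQuasiBialgebroid hL hc hψ hC, fun α => ?_,
    fun α β => deformedTwisted_bracket_dual .., fun f => ⟨_, diff_fn _ f, fun X => ?_⟩,
    fun α => ?_, fun X Y Z => ?_⟩
  · rw [deformedTwisted_anchor, map_zero, zero_add]; rfl
  · rw [deformedTwisted_anchor, map_zero, add_zero]; rfl
  · obtain ⟨P, diff_eq, apply_eq⟩ := exists_diff_cov_eq_of (quasiBracket_self A π N H) α
    refine ⟨P, diff_eq, fun X Y => ?_⟩
    rw [deformedTwisted_anchor, deformedTwisted_anchor, deformedTwisted_bracket_vec hψ, apply_eq]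
    simp only [quasiBracket_anchor, map_zero, add_zero]
  · rw [deformedTwisted_bracket_vec hψ]; rfl

end DefinesQuasiBialgebroid

end AnchoredBracket

section SmoothSections

open Bundle

variable {E : Type*} [NormedAddCommGroup E] [NormedSpace ℝ E]
    {HM : Type*} [TopologicalSpace HM] {I : ModelWithCorners ℝ E HM}
    {M : Type*} [TopologicalSpace M] [ChartedSpace HM M]
    {F : Type*} [NormedAddCommGroup F] [NormedSpace ℝ F]
    {V : M → Type*} [TopologicalSpace (Bundle.TotalSpace F V)]
    [∀ x, AddCommGroup (V x)] [∀ x, Module ℝ (V x)] [∀ x, TopologicalSpace (V x)]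
    [FiberBundle F V] [VectorBundle ℝ F V]

theorem smoothSection_sum_apply {ι : Type*} [Fintype ι] (s : ι → Cₛ^∞⟮I; F, V⟯) (y : M) :
    (∑ i, s i) y = ∑ i, s i y :=
  map_sum (⟨⟨fun X => X y, rfl⟩, fun _ _ => rfl⟩ : Cₛ^∞⟮I; F, V⟯ →+ V y) s Finset.univ

variable [FiniteDimensional ℝ E] [IsManifold I ∞ M] [T2Space M] [ContMDiffVectorBundle ∞ F V I]
    {ι : Type*} (e : Trivialization F (Bundle.TotalSpace.proj : Bundle.TotalSpace F V → M))
    [MemTrivializationAtlas e] (b : Module.Basis ι ℝ F) {x : M} (f : SmoothBumpFunction I x)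

/-- The `i`-th section of the local frame of `e` and `b`, cut off to a global section by the bump
function `f`. -/
def cutoffFrame (hf : tsupport f ⊆ e.baseSet) (i : ι) : Cₛ^∞⟮I; F, V⟯ :=
  ⟨(f : M → ℝ) • e.localFrame b i, ContMDiffOn.smul_section_of_tsupport f.contMDiff.contMDiffOn
    e.open_baseSet hf (e.contMDiffOn_localFrame_baseSet ∞ b i)⟩

theorem contMDiff_smul_localFrameCoeff [FiniteDimensional ℝ F] (hf : tsupport f ⊆ e.baseSet)
    (i : ι) (X : Cₛ^∞⟮I; F, V⟯) :
    ContMDiff I 𝓘(ℝ, ℝ) ∞ fun y => f y • e.localFrameCoeff I b i y (X y) :=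
  have : ContMDiffVectorBundle 1 F V I := ContMDiffVectorBundle.of_le (n := ∞) (by simp)
  contMDiff_of_tsupport fun _ hy => f.contMDiffAt.smul (contMDiffAt_localFrameCoeff b
    (hf (tsupport_smul_subset_left _ _ hy)) X.contMDiff.contMDiffAt i)

/-- The `i`-th coefficient in the local frame of `e` and `b`, cut off by the bump function `f`. -/
def cutoffCoeff [FiniteDimensional ℝ F] (hf : tsupport f ⊆ e.baseSet) (i : ι) :
    Module.Dual C^∞⟮I, M; ℝ⟯ Cₛ^∞⟮I; F, V⟯ where
  toFun X := ⟨_, contMDiff_smul_localFrameCoeff e b f hf i X⟩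
  map_add' X Y := by
    ext y
    exact (congrArg (f y • ·) (map_add (e.localFrameCoeff I b i y) (X y) (Y y))).trans
      (smul_add _ _ _)
  map_smul' g X := by
    ext y
    exact (congrArg (f y • ·) (map_smul (e.localFrameCoeff I b i y) (g y) (X y))).trans
      (mul_left_comm _ _ _)

theorem sum_cutoffCoeff_smul_cutoffFrame [FiniteDimensional ℝ F] [Fintype ι]
    (hf : tsupport f ⊆ e.baseSet) (X : Cₛ^∞⟮I; F, V⟯) (y : M) :
    (∑ i, cutoffCoeff e b f hf i X • cutoffFrame e b f hf i) y = (f y * f y) • X y := by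
  have summand_apply (i : ι) : (cutoffCoeff e b f hf i X • cutoffFrame e b f hf i) y =
      (f y * f y) • e.localFrameCoeff I b i y (X y) • e.localFrame b i y := by
    refine (smul_smul (f y * _) (f y) (e.localFrame b i y)).trans ?_
    rw [smul_smul, mul_right_comm]
  rw [smoothSection_sum_apply, Finset.sum_congr rfl fun i _ => summand_apply i,
    ← Finset.smul_sum]
  by_cases hy : y ∈ e.baseSet
  · rw [← Trivialization.eq_sum_localFrameCoeff_smul (I := I) (b := b) (s := X) hy]
  · rw [image_eq_zero_of_notMem_tsupport fun h => hy (hf h), zero_mul, zero_smul, zero_smul]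

variable [FiniteDimensional ℝ F]

theorem exists_isFraming (x : M) :
    ∃ χ : C^∞⟮I, M; ℝ⟯, IsFraming Cₛ^∞⟮I; F, V⟯ χ ∧ χ x = 1 := by
  let e := trivializationAt F V x
  let b := Module.finBasis ℝ F
  obtain ⟨f, -, hf⟩ := (SmoothBumpFunction.nhds_basis_tsupport (I := I) x).mem_iff.mp
    (e.open_baseSet.mem_nhds (FiberBundle.mem_baseSet_trivializationAt F V x))
  let χ : C^∞⟮I, M; ℝ⟯ := ⟨fun y => f y * f y, f.contMDiff.mul f.contMDiff⟩
  have framing (X : Cₛ^∞⟮I; F, V⟯) : χ • X =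
      ∑ i, cutoffCoeff e b f hf i X • cutoffFrame e b f hf i := by
    ext y
    exact (sum_cutoffCoeff_smul_cutoffFrame e b f hf X y).symm
  refine ⟨χ, ⟨_, _, _, framing⟩, ?_⟩
  change f x * f x = 1
  rw [f.eq_one, one_mul]

theorem locallyFramed_smoothSection : LocallyFramed C^∞⟮I, M; ℝ⟯ Cₛ^∞⟮I; F, V⟯ where
  eq_zero a h := by
    ext x
    obtain ⟨χ, isFraming, χ_eq_one⟩ := exists_isFraming (I := I) (F := F) (V := V) x
    have mul_eq_zero : χ x * a x = 0 := DFunLike.congr_fun (h χ isFraming) x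
    rwa [χ_eq_one, one_mul] at mul_eq_zero
  section_eq_zero X h := by
    ext x
    obtain ⟨χ, isFraming, χ_eq_one⟩ := exists_isFraming (I := I) (F := F) (V := V) x
    have smul_eq_zero : χ x • X x = 0 := DFunLike.congr_fun (h χ isFraming) x
    rwa [χ_eq_one, one_smul] at smul_eq_zero

end SmoothSections

end

theorem mainTheorem5_general {R : Type*} [CommRing R] [Algebra ℝ R]
    {L : Type*} [AddCommGroup L] [Module R L] (hL : LocallyFramed R L)
    (A : LieAlgebroid R L) (π : Bivector R L) (N : Module.End R L)
    (σ : L [⋀^Fin 2]→ₗ[R] R) (ψ H : L [⋀^Fin 3]→ₗ[R] R)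
    (hψ : ∀ v, ψ v = -A.d σ v)
    (h : IsPoissonQuasiNijenhuis A π N ψ H) :
    DefinesLieQuasiBialgebroid
        (bigBracket (π.toEnd + tensorToEnd N + twoFormToEnd σ)
          (A.hamiltonian + backgroundHamiltonian H)) ∧
      IsCourant
        (bigBracket (π.toEnd + tensorToEnd N + twoFormToEnd σ)
          (A.hamiltonian + backgroundHamiltonian H)) := by
  have isCourant := AnchoredBracket.isCourant_deformedTwisted hL.eq_zero_of_forall_dual h hψ
  exact ⟨AnchoredBracket.definesLieQuasiBialgebroid hL h.apply_sharp hψ isCourant, isCourant⟩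

theorem mainTheorem5
    {E : Type*} [NormedAddCommGroup E] [NormedSpace ℝ E] [FiniteDimensional ℝ E]
    {HM : Type*} [TopologicalSpace HM] (I : ModelWithCorners ℝ E HM)
    {M : Type*} [TopologicalSpace M] [ChartedSpace HM M] [IsManifold I ∞ M]
    [BoundarylessManifold I M] [T2Space M] [SecondCountableTopology M]
    (F : Type*) [NormedAddCommGroup F] [NormedSpace ℝ F] [FiniteDimensional ℝ F]
    (V : M → Type*) [TopologicalSpace (Bundle.TotalSpace F V)]
    [∀ x, AddCommGroup (V x)] [∀ x, Module ℝ (V x)] [∀ x, TopologicalSpace (V x)]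
    [FiberBundle F V] [VectorBundle ℝ F V] [ContMDiffVectorBundle ∞ F V I]
    (A : LieAlgebroid C^∞⟮I, M; ℝ⟯ Cₛ^∞⟮I; F, V⟯)
    (π : Bivector C^∞⟮I, M; ℝ⟯ Cₛ^∞⟮I; F, V⟯)
    (N : Module.End C^∞⟮I, M; ℝ⟯ Cₛ^∞⟮I; F, V⟯)
    (σ : Cₛ^∞⟮I; F, V⟯ [⋀^Fin 2]→ₗ[C^∞⟮I, M; ℝ⟯] C^∞⟮I, M; ℝ⟯)
    (ψ H : Cₛ^∞⟮I; F, V⟯ [⋀^Fin 3]→ₗ[C^∞⟮I, M; ℝ⟯] C^∞⟮I, M; ℝ⟯)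
    (hψ : ∀ v, ψ v = -A.d σ v)
    (h : IsPoissonQuasiNijenhuis A π N ψ H) :
    DefinesLieQuasiBialgebroid
        (bigBracket (π.toEnd + tensorToEnd N + twoFormToEnd σ)
          (A.hamiltonian + backgroundHamiltonian H)) ∧
      IsCourant
        (bigBracket (π.toEnd + tensorToEnd N + twoFormToEnd σ)
          (A.hamiltonian + backgroundHamiltonian H)) :=
  mainTheorem5_general locallyFramed_smoothSection A π N σ ψ H hψ h
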